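/- Consider the fourth Painlevé equation $$y''=\frac{(y')^2}{2y}+\frac32y^3+4xy^2+2\Bigl(x^2-2\alpha+\frac\beta2\Bigr)y-\frac{\beta^2}{2y}$$ with complex parameters such that $\alpha-\frac\beta2=\frac12+n$, $n\in\mathbb Z_{\ge0}$, and $\alpha+\frac12\notin\mathbb Z$. A *classical solution* is a meromorphic solution obtained by Bäcklund transformations $R_0^\pm,R_\infty^\pm$ from a solution of one of the Riccati equations $y'=-y^2-2xy-\beta$ ($\alpha=\frac12$), $y'=y^2+2xy+\beta$ ($\alpha=-\frac12$), $y'=y^2+2xy-\beta$ ($\alpha-\frac\beta2=-\frac12$), $y'=-y^2-2xy+\beta$ ($\alpha-\frac\beta2=\frac12$), where $$R_0^+[y]=y+\frac{2(1+2\alpha)y}{y'-y^2-2xy-\beta},\ (\alpha,\beta)\mapsto(-\alpha-1,\beta-2\alpha-1);\qquad R_0^-[y]=y+\frac{2(1-2\alpha)y}{y'+y^2+2xy+\beta},\ (\alpha,\beta)\mapsto(-\alpha+1,\beta-2\alpha+1);$$ $$R_\infty^\pm[y]=\pm\frac{y'}{2y}-\frac y2-x+\frac{\beta}{2y},\ (\alpha,\beta)\mapsto(-\alpha,\beta-2\alpha\mp1).$$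 Let $\Theta(t)=0,\frac12,1$ for $t<0$, $t=0$, $t>0$. Powers of $x$ are taken with $\ln x=\ln|x|+i\arg x$, $\arg x\in(-\frac\pi4,\frac{7\pi}4)$, and all $O$-terms are for $|x|\to\infty$, uniform in closed subsectors. There is a family of classical solutions, depending on a parameter $c\in\mathbb C\cup\{\infty\}$, with the following asymptotics. (i) For $\arg x\in(-\frac\pi4,\frac\pi4)$ and $c\in\mathbb C$, $$y=\frac{\beta}{2x}\bigl(1+O(x^{-2})\bigr)+\mu_1x^{2n-\beta}e^{-x^2}\bigl(1+O(x^{-2})\bigr),\quad \mu_1=-2\bigl(c+i\sqrt\pi\,\Theta(\arg x)\bigr)\frac{2^{n-\beta/2}}{n!\,\Gamma(-\beta/2)};$$ for $c=\infty$, $y=-2x(1+O(x^{-2}))$. (ii) For $\arg x\in(\frac\pi4,\frac{3\pi}4)$: if $c+i\sqrt\pi\ne0$, $$y=-2x\bigl(1+O(x^{-2})\bigr)+\mu_2x^{4\alpha-\beta}e^{x^2}\bigl(1+O(x^{-2})\bigr),\quad \mu_2=2\sqrt\pi\Bigl(\frac{i\sqrt\pi}{(c+i\sqrt\pi)(e^{-i\pi\beta}-1)}+\Theta(\arg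 x-\tfrac\pi2)\Bigr)e^{-i\pi\beta/2}\frac{2^{2\alpha-\beta/2}}{n!\,\Gamma(\alpha+\frac12)};$$ if $c+i\sqrt\pi=0$, $y=\frac{\beta}{2x}(1+O(x^{-2}))$. (iii) For $\arg x\in(\frac{3\pi}4,\frac{5\pi}4)$: if $c(1-e^{i\pi\beta})+i\sqrt\pi\ne0$, $$y=\frac{\beta}{2x}\bigl(1+O(x^{-2})\bigr)+\mu_3x^{2n-\beta}e^{-x^2}\bigl(1+O(x^{-2})\bigr),\quad \mu_3=-2i\sqrt\pi\Bigl(\frac{c+i\sqrt\pi}{c(1-e^{i\pi\beta})+i\sqrt\pi}-\Theta(\arg x-\pi)\Bigr)e^{i\pi\beta}\frac{2^{n-\beta/2}}{n!\,\Gamma(-\beta/2)};$$ if $c(1-e^{i\pi\beta})+i\sqrt\pi=0$, $y=-2x(1+O(x^{-2}))$. (iv) For $\arg x\in(\frac{5\pi}4,\frac{7\pi}4)$: if $c\ne0$, $$y=-2x\bigl(1+O(x^{-2})\bigr)+\mu_4x^{4\alpha-\beta}e^{x^2}\bigl(1+O(x^{-2})\bigr),\quad \mu_4=2\sqrt\pi\Bigl(\frac{i\sqrt\pi}{c(1-e^{i\pi\beta})}+1-\Theta(\arg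 x-\tfrac{3\pi}2)\Bigr)e^{-3i\pi\beta/2}\frac{2^{2\alpha-\beta/2}}{n!\,\Gamma(\alpha+\frac12)};$$ if $c=0$, $y=\frac{\beta}{2x}(1+O(x^{-2}))$. For $c=\infty$ the formulas of (ii)–(iv) hold with the limits of $\mu_2,\mu_3,\mu_4$ as $c\to\infty$. Here the splitting into an algebraic background and an exponentially small term has the following precise meaning. In the sector $|\arg x-\theta_0|<\frac\pi4$, with leading term $A=\frac{\beta}{2x}$ or $A=-2x$, the background is $B^-$ for $\arg x<\theta_0$, $B^+$ for $\arg x>\theta_0$ and $\frac12(B^-+B^+)$ on the Stokes ray $\arg x=\theta_0$, where $B^\mp$, independent of $c$, are solutions of the Painlevé equation with $B^-=A(1+O(x^{-2}))$ for $\arg x\in(\theta_0-\frac{3\pi}4,\theta_0+\frac\pi4)$ and $B^+=A(1+O(x^{-2}))$ for $\arg x\in(\theta_0-\frac\pi4,\theta_0+\frac{3\pi}4)$. With $E$ the exponential factor ($x^{2n-\beta}e^{-x^2}$ or $x^{4\alpha-\beta}e^{x^2}$), $y$ minus the background is $\mu E(1+O(x^{-2}))$; on the Stokes ray itself it is this up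 to an additional $O(E^2)$. -/

import Mathlib

open Filter

noncomputable section

namespace PainleveIV

/-- The fourth Painlevé equation
`y'' = (y')² / (2y) + (3/2) y³ + 4 x y² + 2 (x² - a) y - b / (2y)` with
`a = 2 α - β / 2`, `b = β²`, for a function `y` meromorphic on the whole plane and not identically
zero. `MeromorphicNFOn` means that `y` is meromorphic and that its value at every regular point is
the analytic one; the equation is required off a closed discrete set (that is, off the poles and
the zeros of `y`). -/
def IsSolution (α β : ℂ) (y : ℂ → ℂ) : Prop :=
  MeromorphicNFOn y Set.univ ∧
  ∀ᶠ x in codiscrete ℂ, y x ≠ 0 ∧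
    deriv (deriv y) x =
      (deriv y x) ^ 2 / (2 * y x) + 3 / 2 * (y x) ^ 3 + 4 * x * (y x) ^ 2
        + 2 * (x ^ 2 - (2 * α - β / 2)) * y x - β ^ 2 / (2 * y x)

/-- A meromorphic function, not identically zero, that satisfies the Riccati equation
`y' = σ (y² + 2 x y) + q`. -/
def IsRiccati (σ q : ℂ) (y : ℂ → ℂ) : Prop :=
  MeromorphicNFOn y Set.univ ∧
  ∀ᶠ x in codiscrete ℂ, y x ≠ 0 ∧ deriv y x = σ * ((y x) ^ 2 + 2 * x * y x) + q

/-- The (one-parameter) classical solutions of the fourth Painlevé equation with the parameters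
`α`, `β`: the solutions of the Riccati equations, and everything that is generated from
them by the Bäcklund transformations `R₀⁺`, `R₀⁻`, `R_∞⁺`, `R_∞⁻`. A transformation may be applied
only if its denominators and the function that it produces are not identically zero. -/
inductive IsClassical : ℂ → ℂ → (ℂ → ℂ) → Prop
  | riccati_mm (β : ℂ) (y : ℂ → ℂ) (h : IsRiccati (-1) (-β) y) : IsClassical (1 / 2) β y
  | riccati_pp (β : ℂ) (y : ℂ → ℂ) (h : IsRiccati 1 β y) : IsClassical (-1 / 2) β y
  | riccati_pm (β : ℂ) (y : ℂ → ℂ) (h : IsRiccati 1 (-β) y) : IsClassical (β / 2 - 1 / 2) β y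
  | riccati_mp (β : ℂ) (y : ℂ → ℂ) (h : IsRiccati (-1) β y) : IsClassical (β / 2 + 1 / 2) β y
  | zero_plus (α β : ℂ) (y w : ℂ → ℂ) (h : IsClassical α β y)
      (hw : MeromorphicNFOn w Set.univ)
      (hR : ∀ᶠ x in codiscrete ℂ, w x ≠ 0 ∧ deriv y x - (y x) ^ 2 - 2 * x * y x - β ≠ 0 ∧
        w x = y x + 2 * (1 + 2 * α) * y x / (deriv y x - (y x) ^ 2 - 2 * x * y x - β)) :
      IsClassical (-α - 1) (β - 2 * α - 1) w
  | zero_minus (α β : ℂ) (y w : ℂ → ℂ) (h : IsClassical α β y)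
      (hw : MeromorphicNFOn w Set.univ)
      (hR : ∀ᶠ x in codiscrete ℂ, w x ≠ 0 ∧ deriv y x + (y x) ^ 2 + 2 * x * y x + β ≠ 0 ∧
        w x = y x + 2 * (1 - 2 * α) * y x / (deriv y x + (y x) ^ 2 + 2 * x * y x + β)) :
      IsClassical (-α + 1) (β - 2 * α + 1) w
  | infty_plus (α β : ℂ) (y w : ℂ → ℂ) (h : IsClassical α β y)
      (hw : MeromorphicNFOn w Set.univ)
      (hR : ∀ᶠ x in codiscrete ℂ, w x ≠ 0 ∧ y x ≠ 0 ∧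
        w x = deriv y x / (2 * y x) - y x / 2 - x + β / (2 * y x)) :
      IsClassical (-α) (β - 2 * α - 1) w
  | infty_minus (α β : ℂ) (y w : ℂ → ℂ) (h : IsClassical α β y)
      (hw : MeromorphicNFOn w Set.univ)
      (hR : ∀ᶠ x in codiscrete ℂ, w x ≠ 0 ∧ y x ≠ 0 ∧
        w x = -deriv y x / (2 * y x) - y x / 2 - x + β / (2 * y x)) :
      IsClassical (-α) (β - 2 * α + 1) w

/-- The point `x = r e^{iφ}`. -/
def pt (r φ : ℝ) : ℂ := (r : ℂ) * Complex.exp ((φ : ℂ) * Complex.I)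

/-- The power `x ^ p` at `x = r e^{iφ}`, with the branch `ln x = ln r + i φ`, i.e. `arg x = φ`. -/
def pw (p : ℂ) (r φ : ℝ) : ℂ := Complex.exp (p * ((Real.log r : ℂ) + (φ : ℂ) * Complex.I))

/-- The step function with value `1 / 2` at the jump. -/
def Theta (t : ℝ) : ℝ := if t < 0 then 0 else if t = 0 then 1 / 2 else 1

/-- `f = A (1 + O(x⁻²))` as `|x| → ∞` in the open sector `φ₁ < arg x < φ₂`, uniformly on
closed subsectors. -/
def AsympIn (f A : ℂ → ℂ) (φ₁ φ₂ : ℝ) : Prop :=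
  ∀ θ₁ θ₂ : ℝ, φ₁ < θ₁ → θ₂ < φ₂ → ∃ C R : ℝ, 0 < R ∧ ∀ r φ : ℝ, R ≤ r → θ₁ ≤ φ → φ ≤ θ₂ →
    ‖f (pt r φ) - A (pt r φ)‖ ≤ C * r⁻¹ ^ 2 * ‖A (pt r φ)‖

/-- `B` is a solution of the Painlevé equation which is `A (1 + O(x⁻²))`, without any
oscillating or exponential term, in the sector `φ₁ < arg x < φ₂`. -/
def IsTruncated (α β : ℂ) (A B : ℂ → ℂ) (φ₁ φ₂ : ℝ) : Prop :=
  IsSolution α β B ∧ AsympIn B A φ₁ φ₂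

/-- `f = B + μ E (1 + O(x⁻²))` as `|x| → ∞` in the sector `|arg x - θ₀| < π / 4`, uniformly on
closed subsectors, where, with `t = Θ(arg x - θ₀)`, the algebraic background is
`B = (1 - t) Bm + t Bp` (so `Bm` before the Stokes ray `arg x = θ₀`, `Bp` after it, and their mean
on it) and the multiplier of the exponential `E` is `μ t`. On the ray itself, where the background
is a mean of two solutions, terms of the order `E²` are allowed as well. -/
def ExpCorrected (f Bm Bp : ℂ → ℂ) (E : ℝ → ℝ → ℂ) (μ : ℝ → ℂ) (θ₀ : ℝ) : Prop :=
  ∀ θ₁ θ₂ : ℝ, θ₀ - Real.pi / 4 < θ₁ → θ₂ < θ₀ + Real.pi / 4 →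
    ∃ C R : ℝ, 0 < R ∧ ∀ r φ t : ℝ, R ≤ r → θ₁ ≤ φ → φ ≤ θ₂ → t = Theta (φ - θ₀) →
      ‖f (pt r φ) - ((1 - (t : ℂ)) * Bm (pt r φ) + (t : ℂ) * Bp (pt r φ)) - μ t * E r φ‖
        ≤ C * (r⁻¹ ^ 2 * ‖μ t * E r φ‖ + t * (1 - t) * ‖E r φ‖ ^ 2)

/-- The algebraic leading term `β / (2x)`. -/
def leadSmall (β : ℂ) : ℂ → ℂ := fun x => β / (2 * x)

/-- The algebraic leading term `-2x`. -/
def leadLarge : ℂ → ℂ := fun x => -2 * x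

/-- `x^{2n-β} e^{-x²}`. -/
def expSmall (n : ℕ) (β : ℂ) : ℝ → ℝ → ℂ :=
  fun r φ => pw (2 * n - β) r φ * Complex.exp (-(pt r φ) ^ 2)

/-- `x^{4α-β} e^{x²}`. -/
def expLarge (α β : ℂ) : ℝ → ℝ → ℂ :=
  fun r φ => pw (4 * α - β) r φ * Complex.exp ((pt r φ) ^ 2)

/-- The number `i √π`. -/
def iSqrtPi : ℂ := Complex.I * (Real.sqrt Real.pi : ℂ)

/-- `2^{n-β/2} / (n! Γ(-β/2))`. -/
def normSmall (n : ℕ) (β : ℂ) : ℂ :=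
  (2 : ℂ) ^ ((n : ℂ) - β / 2) / ((n.factorial : ℂ) * Complex.Gamma (-β / 2))

/-- `2^{2α-β/2} / (n! Γ(α+1/2))`. -/
def normLarge (n : ℕ) (α β : ℂ) : ℂ :=
  (2 : ℂ) ^ (2 * α - β / 2) / ((n.factorial : ℂ) * Complex.Gamma (α + 1 / 2))

/-- The multiplier in the first sector, with `κ = c`. -/
def mu1 (n : ℕ) (β κ : ℂ) (t : ℝ) : ℂ :=
  -2 * (κ + iSqrtPi * t) * normSmall n β

/-- The multiplier in the second sector, with `κ = i√π / ((c + i√π) (e^{-iπβ} - 1))`. -/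
def mu2 (n : ℕ) (α β κ : ℂ) (t : ℝ) : ℂ :=
  2 * (Real.sqrt Real.pi : ℂ) * (κ + t) * Complex.exp (-(Complex.I * Real.pi * β / 2))
    * normLarge n α β

/-- The multiplier in the third sector, with `κ = (c + i√π) / (c (1 - e^{iπβ}) + i√π)`. -/
def mu3 (n : ℕ) (β κ : ℂ) (t : ℝ) : ℂ :=
  -2 * iSqrtPi * (κ - t) * Complex.exp (Complex.I * Real.pi * β) * normSmall n β

/-- The multiplier in the fourth sector, with `κ = i√π / (c (1 - e^{iπβ}))`. -/
def mu4 (n : ℕ) (α β κ : ℂ) (t : ℝ) : ℂ :=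
  2 * (Real.sqrt Real.pi : ℂ) * (κ + 1 - t) * Complex.exp (-(3 * Complex.I * Real.pi * β / 2))
    * normLarge n α β

end PainleveIV

end

/-! The equation with parameters α, β is encoded by a first-order system for y and p = R_∞⁺[y] with
constants Y = β and P = 2α - β + 1 (`IsTriple`). On the line α - β/2 = 1/2 + n one has P = 2n + 2.
For n = 0 the system is solved by y = w'/w, where w'' + 2xw' - βw = 0 is the Weber equation; the
solutions w up to a factor form a projective line, and its points are the values of c. The
composition R₀⁻ ∘ R_∞⁺ keeps Y and raises P by 2, so n steps lead from the Riccati case to the given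
parameters (`IsTriple.step`, `level`).

The connection problem is therefore solved at the Weber level. Put s = -β/2 and q = e^{2πis} =
e^{-iπβ}. Every solution is A·`psiM` + C·`psi0`, with `psiM` ~ z^{-s} and `psi0` recessive on the
positive axis, and c = C/A. Across the Stokes ray `psiM` is exchanged for `psiP`, which ~ z^{-s} on
the other side, and c turns into c + i√π (`psi_eq_psiP`): this is the term with Θ. A quarter turn, w
↦ e^{-z²} w'(iz), exchanges s and -s and acts on (A, C) by an explicit linear map (`hat_psi`), which
is found by comparing Gamma factors at 0. Iterating it gives the coordinate C/A in all four sectors,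
hence the rational functions of c in the multipliers. A member is exceptional in a sector where its
A vanishes. A member whose coordinate is 0 or -i√π has no recessive component on one side of the
ray, is algebraic in a wider sector, and serves as a background.

The asymptotics are then carried up the hierarchy in the variable ℓ = ln x. Near the real axis a =
xy and b = xp tend to Y/2 and -P/2. Near the imaginary axis a = x(2x + y + p) and b = -xp satisfy
the same system, with -x² for x² and 2 - Y - P for Y, so both cases are instances of `Loc`. By
Cauchy's estimate d/dℓ preserves bounds (`SO.deriv`), so that the differential equations become
algebraic relations between limits and no higher expansions are needed. The difference of two
solutions with the same algebraic leading behaviour is governed by the Wronskian at the Weber level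
(`Dominant.lDiff`); each step multiplies the multiplier by an explicit factor (`LDiff.step_even`,
`LDiff.step_odd`), and the products are the factorials and Gamma functions of the theorem.

On the Stokes ray the background is the mean of two solutions, and the two one-sided estimates are
averaged. If the averaged multiplier vanishes, an O(E²) bound for a second difference is needed. At
the Weber level that difference is zero, by linearity in c; sums, products and reciprocals keep it
O(E²) up to powers of x (`HasJet`), and the differential equations remove these powers
(`second_difference`). -/

noncomputable section

namespace PainleveIV

open Topology Set

/-! ### Meromorphic functions up to a closed discrete set -/

theorem eventually_codiscrete_iff {Q : ℂ → Prop} :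
    (∀ᶠ x in codiscrete ℂ, Q x) ↔ ∀ x, ∀ᶠ z in 𝓝[≠] x, Q z := by
  rw [Filter.Eventually, mem_codiscrete]
  refine forall_congr' fun x => ?_
  rw [disjoint_principal_right, compl_compl]
  rfl

theorem eventually_nhdsNE_nhds {Q : ℂ → Prop} {x : ℂ} (h : ∀ᶠ z in 𝓝[≠] x, Q z) :
    ∀ᶠ z in 𝓝[≠] x, ∀ᶠ w in 𝓝 z, Q w := by
  have h' := eventually_eventually_nhdsWithin.2 h
  filter_upwards [h', self_mem_nhdsWithin] with z hz hzx
  rwa [(isOpen_compl_singleton.nhdsWithin_eq hzx)] at hz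

theorem eventually_codiscrete_nhds {Q : ℂ → Prop} (h : ∀ᶠ x in codiscrete ℂ, Q x) :
    ∀ᶠ x in codiscrete ℂ, ∀ᶠ w in 𝓝 x, Q w := by
  rw [eventually_codiscrete_iff] at *
  exact fun x => eventually_nhdsNE_nhds (h x)

theorem AnalyticAt.eq_of_codiscrete {f g : ℂ → ℂ} {x : ℂ} (hf : AnalyticAt ℂ f x)
    (hg : AnalyticAt ℂ g x) (h : ∀ᶠ z in codiscrete ℂ, f z = g z) : f x = g x := by
  have h1 := eventually_codiscrete_iff.1 h x
  exact tendsto_nhds_unique_of_eventuallyEq (hf.continuousAt.mono_left nhdsWithin_le_nhds)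
    (hg.continuousAt.mono_left nhdsWithin_le_nhds) h1

/-- The normal form of a meromorphic function on the plane. -/
def nf (f : ℂ → ℂ) : ℂ → ℂ := toMeromorphicNFOn f univ

theorem nf_nf (f : ℂ → ℂ) : MeromorphicNFOn (nf f) univ := by
  exact meromorphicNFOn_toMeromorphicNFOn f univ

theorem nf_codiscrete {f : ℂ → ℂ} (hf : Meromorphic f) :
    ∀ᶠ x in codiscrete ℂ, nf f x = f x := by
  filter_upwards [toMeromorphicNFOn_eqOn_codiscrete hf.meromorphicOn] with x hx
  exact hx.symm

theorem nf_eventuallyEq {f : ℂ → ℂ} (hf : Meromorphic f) {x : ℂ} (hx : AnalyticAt ℂ f x) :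
    nf f =ᶠ[𝓝 x] f := by
  have := toMeromorphicNFOn_eq_toMeromorphicNFAt_on_nhds (U := univ) hf.meromorphicOn (mem_univ x)
  rwa [toMeromorphicNFAt_eq_self.2 hx.meromorphicNFAt] at this

theorem nf_analyticAt {f : ℂ → ℂ} (hf : Meromorphic f) {x : ℂ} (hx : AnalyticAt ℂ f x) :
    AnalyticAt ℂ (nf f) x :=
  hx.congr (nf_eventuallyEq hf hx).symm

theorem MeromorphicNFOn.meromorphic {f : ℂ → ℂ} (hf : MeromorphicNFOn f univ) : Meromorphic f :=
  fun x => (hf (mem_univ x)).meromorphicAt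

/-- If f vanished identically near a point, the equation would read 0 = -c. The nonzero constant
term alone thus makes `y`, `p` and `stepDen` admissible denominators. -/
theorem eventually_ne_zero_of_deriv {f g : ℂ → ℂ} {c : ℂ} (hf : Meromorphic f) (hc : c ≠ 0)
    (h : ∀ᶠ x in codiscrete ℂ, HasDerivAt f (f x * g x - c) x) :
    ∀ᶠ x in codiscrete ℂ, f x ≠ 0 := by
  rw [eventually_codiscrete_iff] at *
  intro x
  rcases (hf x).eventually_eq_zero_or_eventually_ne_zero with h0 | h0
  · exfalso
    obtain ⟨z, hz1, hz2⟩ := ((eventually_nhdsNE_nhds h0).and (h x)).exists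
    have h2 : HasDerivAt f 0 z := (hasDerivAt_const z (0 : ℂ)).congr_of_eventuallyEq hz1
    have h3 := h2.unique hz2
    rw [hz1.self_of_nhds] at h3
    exact hc (by linear_combination h3)
  · exact h0

/-! ### The first-order system -/

/-- The first-order system for `y` and `p = R_∞⁺[y]` that is equivalent to the fourth Painlevé
equation with `β = Y` and `2 α - β + 1 = P`. -/
structure IsTriple (Y P : ℂ) (y p : ℂ → ℂ) : Prop where
  y_nf : MeromorphicNFOn y univ
  p_nf : MeromorphicNFOn p univ
  ode : ∀ᶠ x in codiscrete ℂ, HasDerivAt y (y x * (y x + 2 * p x + 2 * x) - Y) x ∧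
    HasDerivAt p (p x * (-2 * x - 2 * y x - p x) - P) x

namespace IsTriple

variable {Y P : ℂ} {y p : ℂ → ℂ}

theorem y_ne_zero (h : IsTriple Y P y p) (hY : Y ≠ 0) : ∀ᶠ x in codiscrete ℂ, y x ≠ 0 :=
  eventually_ne_zero_of_deriv (MeromorphicNFOn.meromorphic h.y_nf) hY (h.ode.mono fun _ hx => hx.1)

theorem p_ne_zero (h : IsTriple Y P y p) (hP : P ≠ 0) : ∀ᶠ x in codiscrete ℂ, p x ≠ 0 :=
  eventually_ne_zero_of_deriv (MeromorphicNFOn.meromorphic h.p_nf) hP (h.ode.mono fun _ hx => hx.2)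

/-- The first equation expresses p through y and y'; differentiating it and inserting the second
eliminates p. -/
theorem isSolution (h : IsTriple Y P y p) (hY : Y ≠ 0) {α β : ℂ} (hβ : Y = β)
    (hα : P = 2 * α - β + 1) : IsSolution α β y := by
  refine ⟨h.y_nf, ?_⟩
  filter_upwards [h.y_ne_zero hY, h.ode, eventually_codiscrete_nhds h.ode] with x hx hode hev
  refine ⟨hx, ?_⟩
  have h1 : deriv y =ᶠ[𝓝 x] fun z => y z * (y z + 2 * p z + 2 * z) - Y :=
    hev.mono fun z hz => hz.1.deriv
  have h2 := ((hode.1.mul ((hode.1.add (hode.2.const_mul 2)).add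
    ((hasDerivAt_id x).const_mul 2))).sub_const Y)
  have h3 : deriv (deriv y) x = _ := (h2.congr_of_eventuallyEq h1).deriv
  rw [h3, hode.1.deriv]
  simp only [Pi.add_apply, id]
  subst hβ hα
  field_simp
  ring

/-- The residual denominator `y + P / p` of the transformation that raises `P` by `2`. -/
def stepDen (P : ℂ) (y p : ℂ → ℂ) : ℂ → ℂ := fun x => y x + P / p x

/-- The Bäcklund transformation `R₀⁻ ∘ R_∞⁺` on the first component. -/
def stepY (Y P : ℂ) (y p : ℂ → ℂ) : ℂ → ℂ := fun x => p x - (Y + P) / stepDen P y p x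

/-- The Bäcklund transformation `R₀⁻ ∘ R_∞⁺` on the second component. -/
def stepP (Y P : ℂ) (y p : ℂ → ℂ) : ℂ → ℂ :=
  fun x => -2 * x - stepY Y P y p x - stepDen P y p x

theorem meromorphic_stepDen (h : IsTriple Y P y p) : Meromorphic (stepDen P y p) :=
  (MeromorphicNFOn.meromorphic h.y_nf).add
    ((Meromorphic.const P).div (MeromorphicNFOn.meromorphic h.p_nf))

theorem meromorphic_stepY (h : IsTriple Y P y p) : Meromorphic (stepY Y P y p) :=
  (MeromorphicNFOn.meromorphic h.p_nf).sub ((Meromorphic.const _).div h.meromorphic_stepDen)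

theorem meromorphic_id : Meromorphic (fun x : ℂ => x) := fun x => .id x

theorem meromorphic_stepP (h : IsTriple Y P y p) : Meromorphic (stepP Y P y p) :=
  (((Meromorphic.const (-2)).mul meromorphic_id).sub h.meromorphic_stepY).sub h.meromorphic_stepDen

/-- The terms P/p and P²/p² recombine into the denominator itself. The resulting form is the one
required by `eventually_ne_zero_of_deriv`, so Y + P ≠ 0 keeps the denominator from vanishing. -/
theorem hasDerivAt_stepDen {x : ℂ} (hp : p x ≠ 0)
    (hode : HasDerivAt y (y x * (y x + 2 * p x + 2 * x) - Y) x ∧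
      HasDerivAt p (p x * (-2 * x - 2 * y x - p x) - P) x) :
    HasDerivAt (stepDen P y p) (stepDen P y p x * (2 * p x + 2 * x + stepDen P y p x)
      - (Y + P)) x := by
  have h1 := hode.1.add ((hasDerivAt_const x P).div hode.2 hp)
  refine h1.congr_deriv ?_
  simp only [stepDen]
  field_simp
  ring

theorem stepDen_ne_zero (h : IsTriple Y P y p) (hP : P ≠ 0) (hYP : Y + P ≠ 0) :
    ∀ᶠ x in codiscrete ℂ, stepDen P y p x ≠ 0 := by
  refine eventually_ne_zero_of_deriv (g := fun x => 2 * p x + 2 * x + stepDen P y p x)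
    h.meromorphic_stepDen hYP ?_
  filter_upwards [h.p_ne_zero hP, h.ode] with x hp hode
  exact hasDerivAt_stepDen hp hode

theorem step (h : IsTriple Y P y p) (hP : P ≠ 0) (hYP : Y + P ≠ 0) :
    IsTriple Y (P + 2) (nf (stepY Y P y p)) (nf (stepP Y P y p)) := by
  refine ⟨nf_nf _, nf_nf _, ?_⟩
  filter_upwards [h.p_ne_zero hP, h.stepDen_ne_zero hP hYP, h.ode,
    eventually_codiscrete_nhds (nf_codiscrete h.meromorphic_stepY),
    eventually_codiscrete_nhds (nf_codiscrete h.meromorphic_stepP)] with x hp hd hode hy1 hp1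
  have e1 := hasDerivAt_stepDen hp hode
  have e2 : HasDerivAt (stepY Y P y p) _ x := hode.2.sub ((hasDerivAt_const x (Y + P)).div e1 hd)
  have e3 : HasDerivAt (stepP Y P y p) _ x := (((hasDerivAt_id x).const_mul (-2)).sub e2).sub e1
  rw [hy1.self_of_nhds, hp1.self_of_nhds]
  constructor
  · refine (e2.congr_of_eventuallyEq hy1).congr_deriv ?_
    -- Eliminating y in favour of the denominator leaves a rational identity in x, p and d.
    have : y x = stepDen P y p x - P / p x := by simp [stepDen]
    rw [this]
    simp only [stepP, stepY]
    generalize stepDen P y p x = d at *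
    field_simp
    ring
  · refine (e3.congr_of_eventuallyEq hp1).congr_deriv ?_
    have : y x = stepDen P y p x - P / p x := by simp [stepDen]
    rw [this]
    simp only [stepP, stepY]
    generalize stepDen P y p x = d at *
    field_simp
    ring

/-- R_∞⁺ sends y to p with parameters (-α, Y - 2α - 1), and R₀⁻ sends these to (α + 1, Y). The
denominator of R₀⁻ at p is -2p times `stepDen`. -/
theorem isClassical_step (h : IsTriple Y P y p) (hY : Y ≠ 0) (hP : P ≠ 0) (hYP : Y + P ≠ 0)
    {α : ℂ} (hα : P = 2 * α - Y + 1) (hc : IsClassical α Y y) :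
    IsClassical (α + 1) Y (nf (stepY Y P y p)) := by
  have h1 : IsClassical (-α) (Y - 2 * α - 1) p := by
    refine .infty_plus α Y y p hc h.p_nf ?_
    filter_upwards [h.p_ne_zero hP, h.y_ne_zero hY, h.ode] with x hp hy hode
    refine ⟨hp, hy, ?_⟩
    rw [hode.1.deriv]
    field_simp
    ring
  have h2 := IsClassical.zero_minus (-α) (Y - 2 * α - 1) p (nf (stepY Y P y p)) h1 (nf_nf _) (by
    filter_upwards [h.p_ne_zero hP, h.stepDen_ne_zero hP hYP, h.ode,
      nf_codiscrete h.meromorphic_stepY, (h.step hP hYP).y_ne_zero hY] with x hp hd hode hs hne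
    refine ⟨hne, ?_⟩
    have e : deriv p x + (p x) ^ 2 + 2 * x * p x + (Y - 2 * α - 1)
        = -2 * p x * stepDen P y p x := by
      rw [hode.2.deriv]
      simp only [stepDen]
      subst hα
      field_simp
      ring
    rw [e]
    refine ⟨by simp [hp, hd], ?_⟩
    rw [hs]
    simp only [stepY]
    generalize stepDen P y p x = d at *
    subst hα
    field_simp
    ring)
  convert h2 using 1 <;> ring

end IsTriple

/-! ### The hierarchy generated from a solution of the Weber equation -/

/-- `w` is an entire solution, with derivative `w'`, of `w'' + 2 x w' - Y w = 0`. -/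
structure IsWeber (Y : ℂ) (w w' : ℂ → ℂ) : Prop where
  left : ∀ x, HasDerivAt w (w' x) x
  right : ∀ x, HasDerivAt w' (-2 * x * w' x + Y * w x) x

namespace IsWeber

variable {Y : ℂ} {w w' v v' : ℂ → ℂ}

theorem analyticAt_left (h : IsWeber Y w w') (x : ℂ) : AnalyticAt ℂ w x :=
  (show Differentiable ℂ w from fun z => (h.left z).differentiableAt).analyticAt x

theorem analyticAt_right (h : IsWeber Y w w') (x : ℂ) : AnalyticAt ℂ w' x :=
  (show Differentiable ℂ w' from fun z => (h.right z).differentiableAt).analyticAt x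

theorem meromorphic_left (h : IsWeber Y w w') : Meromorphic w :=
  fun x => (h.analyticAt_left x).meromorphicAt

theorem meromorphic_right (h : IsWeber Y w w') : Meromorphic w' :=
  fun x => (h.analyticAt_right x).meromorphicAt

theorem add (h : IsWeber Y w w') (k : IsWeber Y v v') :
    IsWeber Y (fun x => w x + v x) (fun x => w' x + v' x) :=
  ⟨fun x => (h.left x).add (k.left x), fun x =>
    ((h.right x).add (k.right x)).congr_deriv (by ring)⟩

theorem const_mul (h : IsWeber Y w w') (c : ℂ) :
    IsWeber Y (fun x => c * w x) (fun x => c * w' x) :=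
  ⟨fun x => (h.left x).const_mul c, fun x => ((h.right x).const_mul c).congr_deriv (by ring)⟩

theorem eventually_ne_zero {f : ℂ → ℂ} (hf : ∀ x, AnalyticAt ℂ f x) (h0 : ¬ ∀ x, f x = 0) :
    ∀ᶠ x in codiscrete ℂ, f x ≠ 0 := by
  rw [eventually_codiscrete_iff]
  intro x
  rcases (hf x).eventually_eq_zero_or_eventually_ne_zero with h | h
  · exfalso
    refine h0 fun z => ?_
    have := AnalyticOnNhd.eqOn_zero_of_preconnected_of_eventuallyEq_zero (f := f) (U := univ)
      (fun z _ => hf z) isPreconnected_univ (mem_univ x) h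
    exact this (mem_univ z)
  · exact h

/-- The Wronskian of two solutions is a multiple of `exp (-x²)`. -/
theorem wronskian (h : IsWeber Y w w') (k : IsWeber Y v v') (x : ℂ) :
    w x * v' x - w' x * v x = (w 0 * v' 0 - w' 0 * v 0) * Complex.exp (-x ^ 2) := by
  have hd : ∀ x, HasDerivAt (fun x => (w x * v' x - w' x * v x) * Complex.exp (x ^ 2)) 0 x := by
    intro x
    have h1 := (((h.left x).mul (k.right x)).sub ((h.right x).mul (k.left x))).mul
      (((hasDerivAt_id x).pow 2).cexp)
    refine h1.congr_deriv ?_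
    simp
    ring
  have := is_const_of_deriv_eq_zero (fun x => (hd x).differentiableAt) (fun x => (hd x).deriv) x 0
  simp only [ne_eq, OfNat.ofNat_ne_zero, not_false_eq_true, zero_pow, Complex.exp_zero,
    mul_one] at this
  rw [← this, mul_assoc, ← Complex.exp_add]
  simp

theorem not_forall_left (h : IsWeber Y w w') (h0 : w 0 ≠ 0 ∨ w' 0 ≠ 0) : ¬ ∀ x, w x = 0 := by
  intro hz
  have : w' 0 = 0 := by
    have e : w = fun _ => 0 := funext hz
    have h1 := h.left 0
    rw [e] at h1
    exact h1.unique (hasDerivAt_const _ _)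
  simp [hz 0, this] at h0

theorem not_forall_right (h : IsWeber Y w w') (hY : Y ≠ 0) (h0 : w 0 ≠ 0 ∨ w' 0 ≠ 0) :
    ¬ ∀ x, w' x = 0 := by
  intro hz
  refine h.not_forall_left h0 fun x => ?_
  have e : w' = fun _ => 0 := funext hz
  have h1 := h.right x
  rw [e] at h1
  have := h1.unique (hasDerivAt_const _ _)
  simpa [hY] using this

theorem ne_zero_left (h : IsWeber Y w w') (h0 : w 0 ≠ 0 ∨ w' 0 ≠ 0) :
    ∀ᶠ x in codiscrete ℂ, w x ≠ 0 :=
  eventually_ne_zero h.analyticAt_left (h.not_forall_left h0)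

theorem ne_zero_right (h : IsWeber Y w w') (hY : Y ≠ 0) (h0 : w 0 ≠ 0 ∨ w' 0 ≠ 0) :
    ∀ᶠ x in codiscrete ℂ, w' x ≠ 0 :=
  eventually_ne_zero h.analyticAt_right (h.not_forall_right hY h0)

/-- Two solutions with the same initial data coincide. -/
theorem eq_of_initial (h : IsWeber Y w w') (k : IsWeber Y v v') (h0 : w 0 = v 0)
    (h1 : w' 0 = v' 0) {a a' b b' : ℂ → ℂ} (ha : IsWeber Y a a') (hb : IsWeber Y b b')
    (hab : a 0 * b' 0 - a' 0 * b 0 ≠ 0) (x : ℂ) : w x = v x ∧ w' x = v' x := by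
  -- The difference has zero initial data, so its Wronskians with a and b vanish. Since a and b are
  -- independent at every point, Cramer's rule makes the difference zero.
  have hd := h.add (k.const_mul (-1))
  have e1 := hd.wronskian ha x
  have e2 := hd.wronskian hb x
  have e3 := ha.wronskian hb x
  simp only [h0, h1] at e1 e2
  have hne : a x * b' x - a' x * b x ≠ 0 := by
    rw [e3]; exact mul_ne_zero hab (Complex.exp_ne_zero _)
  constructor
  · refine sub_eq_zero.1 ((mul_eq_zero.1 ?_).resolve_right hne)
    linear_combination a x * e2 - b x * e1
  · refine sub_eq_zero.1 ((mul_eq_zero.1 ?_).resolve_right hne)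
    linear_combination a' x * e2 - b' x * e1

end IsWeber

/-- The first member of the hierarchy: the logarithmic derivative of `w`. -/
def baseY (w w' : ℂ → ℂ) : ℂ → ℂ := fun x => w' x / w x

/-- The companion of `baseY`. -/
def baseP (Y : ℂ) (w w' : ℂ → ℂ) : ℂ → ℂ := fun x => -2 * x - w' x / w x + Y * (w x / w' x)

/-- The hierarchy of solutions generated from `w`. -/
def level (Y : ℂ) (w w' : ℂ → ℂ) : ℕ → (ℂ → ℂ) × (ℂ → ℂ)
  | 0 => (nf (baseY w w'), nf (baseP Y w w'))
  | n + 1 => (nf (IsTriple.stepY Y (2 * n + 2) (level Y w w' n).1 (level Y w w' n).2),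
      nf (IsTriple.stepP Y (2 * n + 2) (level Y w w' n).1 (level Y w w' n).2))

namespace IsWeber

variable {Y : ℂ} {w w' : ℂ → ℂ}

theorem meromorphic_baseY (h : IsWeber Y w w') : Meromorphic (baseY w w') :=
  h.meromorphic_right.div h.meromorphic_left

theorem meromorphic_baseP (h : IsWeber Y w w') : Meromorphic (baseP Y w w') :=
  (((Meromorphic.const (-2)).mul IsTriple.meromorphic_id).sub
    (h.meromorphic_right.div h.meromorphic_left)).add
    ((Meromorphic.const Y).mul (h.meromorphic_left.div h.meromorphic_right))

theorem isTriple_base (h : IsWeber Y w w') (hY : Y ≠ 0) (h0 : w 0 ≠ 0 ∨ w' 0 ≠ 0) :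
    IsTriple Y 2 (nf (baseY w w')) (nf (baseP Y w w')) := by
  refine ⟨nf_nf _, nf_nf _, ?_⟩
  filter_upwards [h.ne_zero_left h0, h.ne_zero_right hY h0,
    eventually_codiscrete_nhds (nf_codiscrete h.meromorphic_baseY),
    eventually_codiscrete_nhds (nf_codiscrete h.meromorphic_baseP)] with x hw hw' hy1 hp1
  have e2 : HasDerivAt (baseY w w') _ x := (h.right x).div (h.left x) hw
  have e3 : HasDerivAt (baseP Y w w') _ x := (((hasDerivAt_id x).const_mul (-2)).sub e2).add
    (((h.left x).div (h.right x) hw').const_mul Y)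
  rw [hy1.self_of_nhds, hp1.self_of_nhds]
  constructor
  · refine (e2.congr_of_eventuallyEq hy1).congr_deriv ?_
    simp only [baseP, baseY]
    field_simp
    ring
  · refine (e3.congr_of_eventuallyEq hp1).congr_deriv ?_
    simp only [baseP, baseY]
    field_simp
    ring

theorem isClassical_base (h : IsWeber Y w w') (hY : Y ≠ 0) (h0 : w 0 ≠ 0 ∨ w' 0 ≠ 0) :
    IsClassical (Y / 2 + 1 / 2) Y (nf (baseY w w')) := by
  refine .riccati_mp Y _ ⟨nf_nf _, ?_⟩
  filter_upwards [h.ne_zero_left h0, (h.isTriple_base hY h0).y_ne_zero hY,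
    eventually_codiscrete_nhds (nf_codiscrete h.meromorphic_baseY)] with x hw hne hy1
  have e2 : HasDerivAt (baseY w w') _ x := (h.right x).div (h.left x) hw
  refine ⟨hne, ?_⟩
  rw [(e2.congr_of_eventuallyEq hy1).deriv, hy1.self_of_nhds]
  simp only [baseY]
  field_simp
  ring

/-- The base needs Y ≠ 0, which is m = 0; the step from level n needs Y + P ≠ 0 with P = 2n + 2,
which is m = n + 1. -/
theorem isTriple_level (h : IsWeber Y w w') (hY : ∀ m : ℕ, Y + 2 * m ≠ 0)
    (h0 : w 0 ≠ 0 ∨ w' 0 ≠ 0) (n : ℕ) :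
    IsTriple Y (2 * n + 2) (level Y w w' n).1 (level Y w w' n).2 := by
  induction n with
  | zero => simpa [level] using h.isTriple_base (by simpa using hY 0) h0
  | succ n ih =>
    have := ih.step (by norm_cast) (by simpa [mul_add] using hY (n + 1))
    simp only [level]
    convert this using 1
    push_cast; ring

theorem isClassical_level (h : IsWeber Y w w') (hY : ∀ m : ℕ, Y + 2 * m ≠ 0)
    (h0 : w 0 ≠ 0 ∨ w' 0 ≠ 0) (n : ℕ) :
    IsClassical (Y / 2 + 1 / 2 + n) Y (level Y w w' n).1 := by
  have hY0 : Y ≠ 0 := by simpa using hY 0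
  induction n with
  | zero => simpa [level] using h.isClassical_base hY0 h0
  | succ n ih =>
    have := (h.isTriple_level hY h0 n).isClassical_step hY0 (by norm_cast)
      (by simpa [mul_add] using hY (n + 1)) (by ring) ih
    simp only [level]
    convert this using 1
    push_cast; ring

end IsWeber

end PainleveIV

end

noncomputable section

namespace PainleveIV

open Topology Set MeasureTheory

/-! ### Integrals of Weber type -/

/-- The integrand `t^{s-1} e^{-κ t² - x t}`. -/
def weberKernel (κ s x : ℂ) (t : ℝ) : ℂ := (t : ℂ) ^ (s - 1) * Complex.exp (-κ * t ^ 2 - x * t)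

/-- The integral `∫₀^∞ t^{s-1} e^{-κ t² - x t} dt`. -/
def weberInt (κ s x : ℂ) : ℂ := ∫ t in Ioi (0 : ℝ), weberKernel κ s x t

/-- The condition under which `weberInt` converges at infinity. -/
def Admissible (κ x : ℂ) : Prop := 0 < κ.re ∨ κ = 0 ∧ 0 < x.re

/-- For k > 0 the linear exponent is absorbed by completing the square: -kt² - mt ≤ m²/(2k) -
(k/2)t². -/
theorem integrableOn_weber_real {σ k m : ℝ} (hσ : 0 < σ) (h : 0 < k ∨ k = 0 ∧ 0 < m) :
    IntegrableOn (fun t : ℝ => t ^ (σ - 1) * Real.exp (-k * t ^ 2 - m * t)) (Ioi 0) := by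
  rcases h with hk | ⟨rfl, hm⟩
  · have h1 := (integrableOn_rpow_mul_exp_neg_mul_sq (b := k / 2) (by positivity)
      (s := σ - 1) (by linarith)).const_mul (Real.exp (m ^ 2 / (2 * k)))
    refine h1.mono' ?_ ?_
    · refine ContinuousOn.aestronglyMeasurable (fun t ht => ?_) measurableSet_Ioi
      refine (ContinuousAt.mul (Real.continuousAt_rpow_const _ _ (Or.inl (ne_of_gt ht)))
        (by fun_prop)).continuousWithinAt
    · filter_upwards [ae_restrict_mem measurableSet_Ioi] with t ht
      have ht' : 0 ≤ t ^ (σ - 1) := Real.rpow_nonneg (le_of_lt ht) _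
      rw [Real.norm_of_nonneg (by positivity), mul_left_comm, ← Real.exp_add]
      refine mul_le_mul_of_nonneg_left (Real.exp_le_exp.2 ?_) ht'
      have : m ^ 2 / (2 * k) + -(k / 2) * t ^ 2 - (-k * t ^ 2 - m * t)
          = (m + k * t) ^ 2 / (2 * k) := by
        field_simp; ring
      have h2 : 0 ≤ (m + k * t) ^ 2 / (2 * k) := by positivity
      linarith
  · have h1 := integrableOn_rpow_mul_exp_neg_mul_rpow (p := 1) (s := σ - 1) (b := m) (by linarith)
      one_pos hm
    refine h1.congr_fun (fun t _ => ?_) measurableSet_Ioi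
    simp

theorem norm_weberKernel (κ s x : ℂ) {t : ℝ} (ht : 0 < t) :
    ‖weberKernel κ s x t‖ = t ^ (s.re - 1) * Real.exp (-κ.re * t ^ 2 - x.re * t) := by
  rw [weberKernel, norm_mul, Complex.norm_cpow_eq_rpow_re_of_pos ht, Complex.norm_exp]
  have : (-κ * (t : ℂ) ^ 2 - x * t).re = -κ.re * t ^ 2 - x.re * t := by
    rw [← Complex.ofReal_pow]
    simp [-Complex.ofReal_pow]
  rw [this, Complex.sub_re, Complex.one_re]

theorem continuousOn_weberKernel (κ s x : ℂ) : ContinuousOn (weberKernel κ s x) (Ioi 0) := by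
  intro t ht
  refine (ContinuousAt.mul (Complex.continuousAt_ofReal_cpow_const _ _ (Or.inr (ne_of_gt ht)))
    (by fun_prop)).continuousWithinAt

theorem aestronglyMeasurable_weberKernel (κ s x : ℂ) :
    AEStronglyMeasurable (weberKernel κ s x) (volume.restrict (Ioi 0)) :=
  (continuousOn_weberKernel κ s x).aestronglyMeasurable measurableSet_Ioi

theorem Admissible.real {κ x : ℂ} (h : Admissible κ x) : 0 < κ.re ∨ κ.re = 0 ∧ 0 < x.re := by
  rcases h with h | ⟨h, h'⟩
  · exact Or.inl h
  · exact Or.inr ⟨by simp [h], h'⟩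

theorem integrableOn_weberKernel {κ s x : ℂ} (hs : 0 < s.re) (h : Admissible κ x) :
    IntegrableOn (weberKernel κ s x) (Ioi 0) := by
  refine (integrableOn_weber_real hs h.real).mono' (aestronglyMeasurable_weberKernel κ s x) ?_
  filter_upwards [ae_restrict_mem measurableSet_Ioi] with t ht
  rw [norm_weberKernel _ _ _ ht]

theorem weberKernel_succ (κ s x : ℂ) {t : ℝ} (ht : 0 < t) :
    weberKernel κ (s + 1) x t = t * weberKernel κ s x t := by
  simp only [weberKernel]
  rw [show s + 1 - 1 = (s - 1) + 1 by ring, Complex.cpow_add _ _ (by exact_mod_cast ht.ne'),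
    Complex.cpow_one]
  ring

theorem hasDerivAt_weberInt {κ s x : ℂ} (hs : 0 < s.re) (h : Admissible κ x) :
    HasDerivAt (weberInt κ s) (-weberInt κ (s + 1) x) x := by
  -- The dominating function uses the rate Re x - ε. For κ = 0 this must stay positive on the whole
  -- ball; for Re κ > 0 any radius will do.
  obtain ⟨ε, hε, hm⟩ : ∃ ε : ℝ, 0 < ε ∧ (0 < κ.re ∨ κ.re = 0 ∧ 0 < x.re - ε) := by
    rcases h.real with h | ⟨h, h'⟩
    · exact ⟨1, one_pos, Or.inl h⟩
    · exact ⟨x.re / 2, by positivity, Or.inr ⟨h, by linarith⟩⟩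
  have key := hasDerivAt_integral_of_dominated_loc_of_deriv_le (μ := volume.restrict (Ioi (0:ℝ)))
    (F := fun x t => weberKernel κ s x t) (F' := fun x t => -weberKernel κ (s + 1) x t) (x₀ := x)
    (bound := fun t : ℝ => t ^ ((s.re + 1) - 1) * Real.exp (-κ.re * t ^ 2 - (x.re - ε) * t))
    (Metric.ball_mem_nhds x hε)
    (Eventually.of_forall fun z => aestronglyMeasurable_weberKernel κ s z)
    (integrableOn_weberKernel hs h) (aestronglyMeasurable_weberKernel κ (s + 1) x).neg ?_
    (integrableOn_weber_real (by positivity) hm) ?_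
  · have := key.2
    rw [integral_neg] at this
    exact this
  · filter_upwards [ae_restrict_mem measurableSet_Ioi] with t ht z hz
    rw [norm_neg, norm_weberKernel _ _ _ ht]
    have ht' : (0 : ℝ) < t := ht
    simp only [Complex.add_re, Complex.one_re]
    gcongr
    have h1 := (Complex.abs_re_le_norm (z - x)).trans (mem_ball_iff_norm.1 hz).le
    rw [Complex.sub_re] at h1
    linarith [(abs_le.1 h1).1]
  · filter_upwards [ae_restrict_mem measurableSet_Ioi] with t ht z _
    rw [weberKernel_succ _ _ _ ht]
    have h1 : HasDerivAt (fun z : ℂ => -κ * (t : ℂ) ^ 2 - z * t) (-(t : ℂ)) z := by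
      exact (((hasDerivAt_id z).mul_const (t : ℂ)).const_sub (-κ * (t : ℂ) ^ 2)).congr_deriv (by simp)
    refine (h1.cexp.const_mul ((t : ℂ) ^ (s - 1))).congr_deriv ?_
    simp only [weberKernel]
    ring

/-- Integration by parts: t^s e^{-κt² - xt} vanishes at both ends of the half-line. -/
theorem weberInt_recurrence {κ s x : ℂ} (hs : 0 < s.re) (h : Admissible κ x) :
    s * weberInt κ s x = 2 * κ * weberInt κ (s + 2) x + x * weberInt κ (s + 1) x := by
  have i0 := integrableOn_weberKernel hs h
  have i1 : IntegrableOn (weberKernel κ (s + 1) x) (Ioi 0) :=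
    integrableOn_weberKernel (by simp; positivity) h
  have i2 : IntegrableOn (weberKernel κ (s + 2) x) (Ioi 0) :=
    integrableOn_weberKernel (by simp; positivity) h
  have hint := ((i0.const_mul s).sub (i2.const_mul (2 * κ))).sub (i1.const_mul x)
  have hd : ∀ t ∈ Ioi (0 : ℝ), HasDerivAt (weberKernel κ (s + 1) x)
      (s * weberKernel κ s x t - 2 * κ * weberKernel κ (s + 2) x t
        - x * weberKernel κ (s + 1) x t) t := by
    intro t ht
    have ht' : (t : ℂ) ≠ 0 := by exact_mod_cast ne_of_gt ht
    have h1 : HasDerivAt (fun z : ℂ => z ^ s * Complex.exp (-κ * z ^ 2 - x * z)) _ (t : ℂ) :=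
      ((hasDerivAt_id (t : ℂ)).cpow_const (c := s)
        (Complex.ofReal_mem_slitPlane.2 ht)).mul
      ((((hasDerivAt_id (t : ℂ)).pow 2).const_mul (-κ)).sub
        ((hasDerivAt_id (t : ℂ)).const_mul x)).cexp
    have h2 := h1.comp_ofReal
    have e : weberKernel κ (s + 1) x =
        fun t : ℝ => (t : ℂ) ^ s * Complex.exp (-κ * (t : ℂ) ^ 2 - x * t) := by
      funext t; simp [weberKernel]
    rw [show s + 2 = s + 1 + 1 by ring, weberKernel_succ κ (s + 1) x ht]
    rw [e]
    refine h2.congr_deriv ?_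
    simp only [weberKernel, id]
    have e2 : (t : ℂ) ^ s = t * (t : ℂ) ^ (s - 1) := by
      rw [show s = (s - 1) + 1 by ring, Complex.cpow_add _ _ ht', Complex.cpow_one]
      ring_nf
    rw [e2]
    simp
    ring
  have hc : ContinuousWithinAt (weberKernel κ (s + 1) x) (Ici 0) 0 := by
    refine ContinuousAt.continuousWithinAt (ContinuousAt.mul ?_ (by fun_prop))
    exact Complex.continuousAt_ofReal_cpow_const _ _ (Or.inl (by simpa using hs))
  have key := integral_Ioi_of_hasDerivAt_of_tendsto hc hd hint
    (tendsto_zero_of_hasDerivAt_of_integrableOn_Ioi hd hint i1)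
  rw [integral_sub (by exact (i0.const_mul s).sub (i2.const_mul (2 * κ))) (i1.const_mul x),
    integral_sub (i0.const_mul s) (i2.const_mul (2 * κ)), integral_const_mul, integral_const_mul,
    integral_const_mul] at key
  have z0 : weberKernel κ (s + 1) x 0 = 0 := by
    have : s ≠ 0 := by rintro rfl; simp at hs
    simp [weberKernel, this]
  rw [z0] at key
  simp only [weberInt]
  linear_combination key

/-- The Gamma integral with a complex rate. -/
theorem weberInt_zero_left {s x : ℂ} (hs : 0 < s.re) (hx : 0 < x.re) :
    weberInt 0 s x = x ^ (-s) * Complex.Gamma s := by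
  -- By the recurrence z^s times the integral is constant on the right half-plane; its value at z =
  -- 1 is Euler's integral.
  have hd : ∀ z ∈ {z : ℂ | 0 < z.re}, HasDerivAt (fun z => z ^ s * weberInt 0 s z) 0 z := by
    intro z hz
    have hz0 : z ≠ 0 := by rintro rfl; simp at hz
    have ha : Admissible 0 z := Or.inr ⟨rfl, hz⟩
    have h1 := ((hasDerivAt_id z).cpow_const (c := s) (Or.inl hz)).mul (hasDerivAt_weberInt hs ha)
    refine h1.congr_deriv ?_
    have h2 := weberInt_recurrence hs ha
    have e2 : z ^ s = z * z ^ (s - 1) := by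
      rw [show s = (s - 1) + 1 by ring, Complex.cpow_add _ _ hz0, Complex.cpow_one]
      ring_nf
    simp only [id, e2]
    linear_combination z ^ (s - 1) * h2
  have ho : IsOpen {z : ℂ | 0 < z.re} := isOpen_lt continuous_const Complex.continuous_re
  have hcv : Convex ℝ {z : ℂ | 0 < z.re} := convex_halfSpace_re_gt 0
  have h1 := ho.is_const_of_deriv_eq_zero hcv.isPreconnected
    (fun z hz => (hd z hz).differentiableAt.differentiableWithinAt)
    (fun z hz => (hd z hz).deriv) (x := x) (y := 1) hx (by simp)
  have h2 : weberInt 0 s 1 = Complex.Gamma s := by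
    rw [Complex.Gamma_eq_integral hs, Complex.GammaIntegral, weberInt]
    refine setIntegral_congr_fun measurableSet_Ioi fun t _ => ?_
    simp [weberKernel, mul_comm]
  have hx0 : x ≠ 0 := by rintro rfl; simp at hx
  simp only [Complex.one_cpow, one_mul] at h1
  rw [← h2, ← h1, ← mul_assoc, ← Complex.cpow_add _ _ hx0]
  simp

/-- The substitution u = t² turns this into the Gamma integral with exponent s/2 and rate κ. -/
theorem weberInt_zero_right {κ s : ℂ} (hs : 0 < s.re) (hκ : 0 < κ.re) :
    weberInt κ s 0 = κ ^ (-s / 2) * Complex.Gamma (s / 2) / 2 := by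
  have hs2 : 0 < (s / 2).re := by simpa using hs
  have h1 := integral_comp_rpow_Ioi_of_pos (g := weberKernel 0 (s / 2) κ) (p := 2) two_pos
  have h2 := weberInt_zero_left hs2 hκ
  rw [weberInt, ← h1] at h2
  rw [neg_div, ← h2, eq_div_iff two_ne_zero, weberInt, ← integral_mul_const]
  refine setIntegral_congr_fun measurableSet_Ioi fun t ht => ?_
  have ht' : (t : ℂ) ≠ 0 := by exact_mod_cast ne_of_gt ht
  have e1 : (((t ^ (2 : ℝ) : ℝ)) : ℂ) = (t : ℂ) ^ 2 := by norm_num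
  have e2 : ((t : ℂ) ^ 2) ^ (s / 2 - 1) = (t : ℂ) ^ (s - 2) := by
    rw [sq, Complex.mul_cpow_ofReal_nonneg (le_of_lt ht) (le_of_lt ht), ← Complex.cpow_add _ _ ht']
    ring_nf
  have e3 : (t : ℂ) ^ (s - 1) = t * (t : ℂ) ^ (s - 2) := by
    rw [show s - 1 = (s - 2) + 1 by ring, Complex.cpow_add _ _ ht', Complex.cpow_one, mul_comm]
  simp only [weberKernel, e1, e2, e3]
  norm_num
  ring_nf

theorem norm_exp_sub_one_le_of_re_nonpos {z : ℂ} (hz : z.re ≤ 0) : ‖Complex.exp z - 1‖ ≤ ‖z‖ := by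
  have hcv : Convex ℝ {z : ℂ | z.re ≤ 0} := convex_halfSpace_re_le 0
  have := hcv.norm_image_sub_le_of_norm_hasDerivWithin_le (f := Complex.exp) (f' := Complex.exp)
    (C := 1) (x := 0) (y := z) (fun w _ => (Complex.hasDerivAt_exp w).hasDerivWithinAt)
    (fun w hw => by rw [Complex.norm_exp]; exact Real.exp_le_one_iff.2 hw) (by simp) hz
  simpa using this

/-- The leading term is the integral with κ = 0. Since |e^{-κt²} - 1| ≤ ‖κ‖t² for Re κ > 0, the
error is a Gamma integral with exponent raised by 2. -/
theorem norm_weberInt_sub_le {κ s ξ : ℂ} (hs : 0 < s.re) (hκ : 0 < κ.re) (hξ : 0 < ξ.re) :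
    ‖weberInt κ s ξ - ξ ^ (-s) * Complex.Gamma s‖
      ≤ ‖κ‖ * Real.Gamma (s.re + 2) * ξ.re ^ (-(s.re + 2)) := by
  rw [← weberInt_zero_left hs hξ, weberInt, weberInt,
    ← integral_sub (integrableOn_weberKernel hs (Or.inl hκ))
      (integrableOn_weberKernel hs (Or.inr ⟨rfl, hξ⟩))]
  have h1 := Real.integral_rpow_mul_exp_neg_mul_Ioi (a := s.re + 2) (r := ξ.re) (by positivity) hξ
  have h2 : ‖κ‖ * Real.Gamma (s.re + 2) * ξ.re ^ (-(s.re + 2)) =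
      ∫ t in Ioi (0 : ℝ), ‖κ‖ * (t ^ (s.re + 2 - 1) * Real.exp (-(0:ℝ) * t ^ 2 - ξ.re * t)) := by
    rw [integral_const_mul]
    simp only [neg_zero, zero_mul, zero_sub]
    rw [h1, one_div, Real.inv_rpow hξ.le, Real.rpow_neg hξ.le]
    ring
  rw [h2]
  refine norm_integral_le_of_norm_le ((integrableOn_weber_real (by positivity)
    (Or.inr ⟨rfl, hξ⟩)).const_mul _) ?_
  filter_upwards [ae_restrict_mem measurableSet_Ioi] with t ht
  have ht' : (0 : ℝ) < t := ht
  have e : weberKernel κ s ξ t - weberKernel 0 s ξ t =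
      weberKernel 0 s ξ t * (Complex.exp (-κ * t ^ 2) - 1) := by
    simp only [weberKernel]
    rw [sub_eq_add_neg (-κ * (t : ℂ) ^ 2), Complex.exp_add]
    simp
    ring
  rw [e, norm_mul, norm_weberKernel _ _ _ ht']
  have h3 : ‖Complex.exp (-κ * t ^ 2) - 1‖ ≤ ‖κ‖ * t ^ 2 := by
    refine (norm_exp_sub_one_le_of_re_nonpos ?_).trans (by simp)
    rw [← Complex.ofReal_pow, Complex.re_mul_ofReal]
    have := mul_nonneg hκ.le (sq_nonneg t)
    simp; linarith
  have h4 : t ^ (s.re + 2 - 1) = t ^ (s.re - 1) * t ^ 2 := by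
    rw [show s.re + 2 - 1 = (s.re - 1) + 2 by ring, Real.rpow_add ht']
    norm_num
  rw [h4]
  simp only [Complex.zero_re]
  refine (mul_le_mul_of_nonneg_left h3 (by positivity)).trans (le_of_eq (by ring))

end PainleveIV

end

noncomputable section

namespace PainleveIV

open Topology Set MeasureTheory Asymptotics

/-! ### Horizontal strips in the logarithmic plane -/

/-- The filter of points `ℓ` with `θ₁ ≤ Im ℓ ≤ θ₂` and `Re ℓ → ∞`; with `x = e^ℓ` it describes
`x → ∞` in a closed sector. -/
def strip (θ₁ θ₂ : ℝ) : Filter ℂ := comap Complex.re atTop ⊓ 𝓟 {ℓ | θ₁ ≤ ℓ.im ∧ ℓ.im ≤ θ₂}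

theorem eventually_strip {θ₁ θ₂ : ℝ} {Q : ℂ → Prop} :
    (∀ᶠ ℓ in strip θ₁ θ₂, Q ℓ) ↔
      ∃ R : ℝ, ∀ ℓ : ℂ, R ≤ ℓ.re → θ₁ ≤ ℓ.im → ℓ.im ≤ θ₂ → Q ℓ := by
  rw [strip, eventually_inf_principal, eventually_comap, eventually_atTop]
  constructor
  · rintro ⟨R, h⟩
    exact ⟨R, fun ℓ h1 h2 h3 => h _ h1 ℓ rfl ⟨h2, h3⟩⟩
  · rintro ⟨R, h⟩
    exact ⟨R, fun b hb ℓ hℓ h2 => h ℓ (hℓ ▸ hb) h2.1 h2.2⟩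

theorem strip_mono {θ₁ θ₂ θ₁' θ₂' : ℝ} (h1 : θ₁ ≤ θ₁') (h2 : θ₂' ≤ θ₂) :
    strip θ₁' θ₂' ≤ strip θ₁ θ₂ :=
  inf_le_inf_left _ (principal_mono.2 fun _ h => ⟨h1.trans h.1, h.2.trans h2⟩)

theorem tendsto_re_strip (θ₁ θ₂ : ℝ) : Tendsto Complex.re (strip θ₁ θ₂) atTop :=
  tendsto_comap.mono_left inf_le_left

theorem tendsto_add_strip (θ₁ θ₂ a : ℝ) :
    Tendsto (fun ℓ : ℂ => ℓ + a * Complex.I) (strip θ₁ θ₂) (strip (θ₁ + a) (θ₂ + a)) := by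
  intro s hs
  obtain ⟨R, hR⟩ := eventually_strip.1 (show ∀ᶠ ℓ in strip (θ₁ + a) (θ₂ + a), ℓ ∈ s from hs)
  refine eventually_strip.2 ⟨R, fun ℓ h1 h2 h3 => hR _ ?_ ?_ ?_⟩ <;> simp <;> assumption

/-- The function `x² = e^{2ℓ}`. -/
def sqX (ℓ : ℂ) : ℂ := Complex.exp (2 * ℓ)

theorem sqX_ne_zero (ℓ : ℂ) : sqX ℓ ≠ 0 := Complex.exp_ne_zero _

theorem norm_sqX (ℓ : ℂ) : ‖sqX ℓ‖ = Real.exp (2 * ℓ.re) := by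
  simp [sqX, Complex.norm_exp]

theorem hasDerivAt_sqX (ℓ : ℂ) : HasDerivAt sqX (2 * sqX ℓ) ℓ := by
  refine (((hasDerivAt_id ℓ).const_mul 2).cexp).congr_deriv ?_
  simp [sqX, mul_comm]

theorem tendsto_norm_sqX (θ₁ θ₂ : ℝ) : Tendsto (fun ℓ => ‖sqX ℓ‖) (strip θ₁ θ₂) atTop := by
  simp only [norm_sqX]
  exact Real.tendsto_exp_atTop.comp ((tendsto_re_strip θ₁ θ₂).const_mul_atTop two_pos)

theorem tendsto_sqX_inv (θ₁ θ₂ : ℝ) : Tendsto (fun ℓ => (sqX ℓ)⁻¹) (strip θ₁ θ₂) (𝓝 0) := by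
  rw [tendsto_zero_iff_norm_tendsto_zero]
  simp only [norm_inv]
  exact (tendsto_norm_sqX θ₁ θ₂).inv_tendsto_atTop

/-! ### The rotated integral representation -/

/-- Each sequence lists the successive derivatives of an entire function, so agreement at 0 is
agreement of Taylor coefficients. -/
theorem eq_of_taylor {f g : ℕ → ℂ → ℂ} (hf : ∀ m x, HasDerivAt (f m) (f (m + 1) x) x)
    (hg : ∀ m x, HasDerivAt (g m) (g (m + 1) x) x) (h0 : ∀ m, f m 0 = g m 0) (x : ℂ) :
    f 0 x = g 0 x := by
  have key : ∀ {f : ℕ → ℂ → ℂ}, (∀ m x, HasDerivAt (f m) (f (m + 1) x) x) →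
      ∀ m, iteratedDeriv m (f 0) = f m := by
    intro f hf m
    induction m with
    | zero => exact iteratedDeriv_zero
    | succ m ih => rw [iteratedDeriv_succ, ih]; exact funext fun x => (hf m x).deriv
  rw [← Complex.taylorSeries_eq_of_entire' (c := 0) (z := x)
      (show Differentiable ℂ (f 0) from fun x => (hf 0 x).differentiableAt),
    ← Complex.taylorSeries_eq_of_entire' (c := 0) (z := x)
      (show Differentiable ℂ (g 0) from fun x => (hg 0 x).differentiableAt)]
  refine tsum_congr fun m => ?_
  rw [key hf, key hg, h0]

/-- This is the rotation t ↦ e^{iψ}t of the path of integration, obtained without contour integrals: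
both sides are entire in x, their m-th derivatives have the same shape with s + m for s, and at x =
0 both are evaluated by `weberInt_zero_right`. The range of ψ keeps Re κ positive. -/
theorem weberInt_rotate {s : ℂ} (hs : 0 < s.re) {ψ : ℝ} (h1 : -(Real.pi / 4) < ψ)
    (h2 : ψ < Real.pi / 4) (x : ℂ) :
    weberInt (1 / 4) s x = Complex.exp (ψ * Complex.I * s) *
      weberInt (Complex.exp (2 * (ψ * Complex.I)) / 4) s (x * Complex.exp (ψ * Complex.I)) := by
  set κ : ℂ := Complex.exp (2 * (ψ * Complex.I)) / 4 with hκ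
  have hκre : 0 < κ.re := by
    rw [hκ, show (2 * (ψ * Complex.I) : ℂ) = ((2 * ψ : ℝ) : ℂ) * Complex.I by push_cast; ring,
      show (4 : ℂ) = ((4 : ℝ) : ℂ) by norm_num, Complex.div_ofReal_re, Complex.exp_ofReal_mul_I_re]
    have := Real.cos_pos_of_mem_Ioo (x := 2 * ψ) ⟨by linarith, by linarith⟩
    positivity
  have hre : ∀ m : ℕ, 0 < (s + m).re := fun m => by simp; positivity
  have key := eq_of_taylor
    (f := fun m x => (-1) ^ m * weberInt (1 / 4) (s + m) x)
    (g := fun m x => (-1) ^ m * (Complex.exp (ψ * Complex.I * (s + m)) *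
      weberInt κ (s + m) (x * Complex.exp (ψ * Complex.I)))) ?_ ?_ ?_ x
  · simpa using key
  · intro m x
    refine ((hasDerivAt_weberInt (hre m) (Or.inl (by norm_num))).const_mul _).congr_deriv ?_
    push_cast
    rw [← add_assoc]
    ring
  · intro m x
    have h := (hasDerivAt_weberInt (x := x * Complex.exp (ψ * Complex.I)) (hre m)
      (Or.inl hκre)).comp x ((hasDerivAt_id x).mul_const _)
    refine ((h.const_mul _).const_mul _).congr_deriv ?_
    push_cast
    rw [← add_assoc, mul_add (ψ * Complex.I) (s + m) 1, Complex.exp_add]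
    ring_nf
  · intro m
    simp only [zero_mul]
    rw [weberInt_zero_right (hre m) hκre, weberInt_zero_right (hre m) (by norm_num)]
    have hl : κ ^ (-(s + m) / 2) =
        Complex.exp (-(ψ * Complex.I * (s + m))) * (1 / 4 : ℂ) ^ (-(s + m) / 2) := by
      have hlog : Complex.log κ = 2 * (ψ * Complex.I) + Complex.log (1 / 4) := by
        rw [hκ, div_eq_mul_one_div, show (1 / 4 : ℂ) = ((1 / 4 : ℝ) : ℂ) by norm_num,
          Complex.log_mul_ofReal _ (by norm_num) _ (Complex.exp_ne_zero _), Complex.log_exp,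
          Complex.ofReal_log (by norm_num)]
        · ring
        · simp; linarith
        · simp; linarith
      rw [Complex.cpow_def_of_ne_zero (by simp [hκ]), Complex.cpow_def_of_ne_zero (by norm_num),
        hlog, ← Complex.exp_add]
      congr 1
      ring
    rw [hl, Complex.exp_neg]
    field_simp [Complex.exp_ne_zero]

/-- An entire function `g` and `g₁ = -g'`, which have the initial data and the asymptotics of
`∫₀^∞ t^{s-1} e^{-t²/4 - x t} dt`. -/
structure IsParabolic (s : ℂ) (g g₁ : ℂ → ℂ) : Prop where
  left : ∀ x, HasDerivAt g (-g₁ x) x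
  right : ∀ x, HasDerivAt g₁ (2 * x * g₁ x - 2 * s * g x) x
  zero_left : g 0 = 2 ^ (s - 1) * Complex.Gamma (s / 2)
  zero_right : g₁ 0 = 2 ^ s * Complex.Gamma ((s + 1) / 2)
  asymp_left : ∀ θ < 3 * Real.pi / 4,
    (fun ℓ => g (Complex.exp ℓ) - Complex.Gamma s * Complex.exp (-s * ℓ))
      =O[strip (-θ) θ] fun ℓ => Complex.exp (-(s + 2) * ℓ)
  asymp_right : ∀ θ < 3 * Real.pi / 4,
    (fun ℓ => g₁ (Complex.exp ℓ) - Complex.Gamma (s + 1) * Complex.exp (-(s + 1) * ℓ))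
      =O[strip (-θ) θ] fun ℓ => Complex.exp (-(s + 3) * ℓ)

/-- The direct comparison with Γ(s)x^{-s} needs Re x > 0. For arg x = φ the path is turned by ψ =
-φ/3, after which κ has argument -2φ/3 and the new variable has argument 2φ/3; both have positive
real part exactly when |φ| < 3π/4. -/
theorem weberInt_asymp {s : ℂ} (hs : 0 < s.re) {θ : ℝ} (hθ : θ < 3 * Real.pi / 4) :
    (fun ℓ => weberInt (1 / 4) s (Complex.exp ℓ) - Complex.Gamma s * Complex.exp (-s * ℓ))
      =O[strip (-θ) θ] fun ℓ => Complex.exp (-(s + 2) * ℓ) := by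
  by_cases hθ0 : 0 ≤ θ
  swap
  · have : strip (-θ) θ = ⊥ := by
      rw [← empty_mem_iff_bot]
      exact eventually_strip.2 ⟨0, fun ℓ _ h1 h2 => by exfalso; linarith⟩
    rw [this]
    exact isBigO_bot _ _
  set δ := Real.cos (2 * θ / 3) with hδ
  have hδ0 : 0 < δ := Real.cos_pos_of_mem_Ioo ⟨by linarith [Real.pi_pos], by linarith⟩
  set K : ℝ := Real.exp (|s.im| * θ / 3) * (1 / 4 * Real.Gamma (s.re + 2) * δ ^ (-(s.re + 2)))
    * Real.exp (|s.im| * θ)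
  refine IsBigO.of_bound K (eventually_strip.2 ⟨0, fun ℓ _ h1 h2 => ?_⟩)
  set φ := ℓ.im
  have hφ : |φ| ≤ θ := abs_le.2 ⟨h1, h2⟩
  set ψ : ℝ := -φ / 3 with hψ
  have hψ1 : -(Real.pi / 4) < ψ := by rw [hψ]; linarith
  have hψ2 : ψ < Real.pi / 4 := by rw [hψ]; linarith
  rw [weberInt_rotate hs hψ1 hψ2]
  set κ : ℂ := Complex.exp (2 * (ψ * Complex.I)) / 4 with hκ
  have hκre : 0 < κ.re := by
    rw [hκ, show (2 * (ψ * Complex.I) : ℂ) = ((2 * ψ : ℝ) : ℂ) * Complex.I by push_cast; ring,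
      show (4 : ℂ) = ((4 : ℝ) : ℂ) by norm_num, Complex.div_ofReal_re, Complex.exp_ofReal_mul_I_re]
    have := Real.cos_pos_of_mem_Ioo (x := 2 * ψ) ⟨by linarith, by linarith⟩
    positivity
  have hκn : ‖κ‖ = 1 / 4 := by
    rw [hκ, norm_div, Complex.norm_exp]; simp
  rw [← Complex.exp_add]
  set ξ := Complex.exp (ℓ + ψ * Complex.I) with hξ
  have him : (ℓ + ψ * Complex.I).im = 2 * φ / 3 := by
    simp [hψ]; ring
  have hξre : ξ.re = Real.exp ℓ.re * Real.cos (2 * φ / 3) := by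
    rw [hξ, Complex.exp_re, him]; simp
  have hcos : δ ≤ Real.cos (2 * φ / 3) := by
    rw [hδ, ← Real.cos_abs (2 * φ / 3)]
    refine Real.cos_le_cos_of_nonneg_of_le_pi (abs_nonneg _) (by linarith) ?_
    rw [abs_div, abs_mul]; norm_num; linarith
  have hξ0 : 0 < ξ.re := by rw [hξre]; have := hδ0.trans_le hcos; positivity
  have hpow : ξ ^ (-s) = Complex.exp (-s * (ℓ + ψ * Complex.I)) := by
    rw [Complex.cpow_def_of_ne_zero (by rw [hξ]; exact Complex.exp_ne_zero _), hξ, Complex.log_exp,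
      mul_comm]
    · rw [him]; linarith [Real.pi_pos]
    · rw [him]; linarith [Real.pi_pos]
  have e : Complex.exp (ψ * Complex.I * s) * weberInt κ s ξ
      - Complex.Gamma s * Complex.exp (-s * ℓ)
      = Complex.exp (ψ * Complex.I * s) * (weberInt κ s ξ - ξ ^ (-s) * Complex.Gamma s) := by
    have : Complex.exp (-s * ℓ) = Complex.exp (ψ * Complex.I * s) *
        Complex.exp (-s * (ℓ + ψ * Complex.I)) := by
      rw [← Complex.exp_add]; congr 1; ring
    rw [hpow, this]
    ring
  rw [e, norm_mul]
  have b1 : ‖Complex.exp (ψ * Complex.I * s)‖ ≤ Real.exp (|s.im| * θ / 3) := by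
    rw [Complex.norm_exp]
    refine Real.exp_le_exp.2 ?_
    have : (ψ * Complex.I * s).re = s.im * φ / 3 := by simp [hψ]; ring
    rw [this]
    refine (le_abs_self _).trans ?_
    rw [abs_div, abs_mul]
    norm_num
    gcongr
  have b2 := norm_weberInt_sub_le hs hκre hξ0
  have b3 : ξ.re ^ (-(s.re + 2)) ≤ δ ^ (-(s.re + 2)) * Real.exp (-(s.re + 2) * ℓ.re) := by
    rw [hξre, mul_comm, Real.mul_rpow (hδ0.le.trans hcos) (Real.exp_pos _).le, ← Real.exp_mul]
    refine mul_le_mul ?_ (le_of_eq (by ring_nf)) (Real.exp_pos _).le (by positivity)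
    exact Real.rpow_le_rpow_of_nonpos hδ0 hcos (by linarith)
  have b4 : Real.exp (-(s.re + 2) * ℓ.re) ≤
      Real.exp (|s.im| * θ) * ‖Complex.exp (-(s + 2) * ℓ)‖ := by
    rw [Complex.norm_exp, ← Real.exp_add]
    refine Real.exp_le_exp.2 ?_
    have : (-(s + 2) * ℓ).re = -(s.re + 2) * ℓ.re + s.im * φ := by
      simp [φ]
    rw [this]
    have : |s.im * φ| ≤ |s.im| * θ := by rw [abs_mul]; gcongr
    linarith [(abs_le.1 this).1]
  have hG : 0 < Real.Gamma (s.re + 2) := Real.Gamma_pos_of_pos (by linarith)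
  calc _ ≤ Real.exp (|s.im| * θ / 3) * (‖κ‖ * Real.Gamma (s.re + 2) * ξ.re ^ (-(s.re + 2))) := by
        gcongr
    _ ≤ Real.exp (|s.im| * θ / 3) * (1 / 4 * Real.Gamma (s.re + 2) * (δ ^ (-(s.re + 2)) *
        (Real.exp (|s.im| * θ) * ‖Complex.exp (-(s + 2) * ℓ)‖))) := by
        rw [hκn]
        gcongr
        exact b3.trans (by gcongr)
    _ = _ := by ring

theorem exists_isParabolic_of_pos {s : ℂ} (hs : 0 < s.re) :
    ∃ g g₁ : ℂ → ℂ, IsParabolic s g g₁ := by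
  have hs1 : 0 < (s + 1).re := by simp; positivity
  have ha : ∀ x, Admissible (1 / 4) x := fun x => Or.inl (by norm_num)
  have h4 : ∀ t : ℂ, (1 / 4 : ℂ) ^ (-t / 2) = 2 ^ t := by
    intro t
    rw [Complex.cpow_def_of_ne_zero (by norm_num), Complex.cpow_def_of_ne_zero two_ne_zero]
    congr 1
    have : Complex.log (1 / 4) = -2 * Complex.log 2 := by
      have h : Real.log (1 / 4) = -2 * Real.log 2 := by
        rw [one_div, Real.log_inv, show (4 : ℝ) = 2 ^ 2 by norm_num, Real.log_pow]
        push_cast; ring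
      have h' := congrArg (fun r : ℝ => (r : ℂ)) h
      push_cast [Complex.ofReal_log] at h'
      rw [Complex.ofReal_log (by norm_num), Complex.ofReal_log (by norm_num)] at h'
      push_cast at h'
      exact h'
    rw [this]; ring
  refine ⟨weberInt (1 / 4) s, weberInt (1 / 4) (s + 1), fun x => hasDerivAt_weberInt hs (ha x),
    fun x => (hasDerivAt_weberInt hs1 (ha x)).congr_deriv ?_, ?_, ?_,
    fun θ hθ => weberInt_asymp hs hθ, fun θ hθ => ?_⟩
  · have := weberInt_recurrence hs (ha x)
    rw [add_assoc, one_add_one_eq_two]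
    linear_combination 2 * this
  · rw [weberInt_zero_right hs (by norm_num), h4, Complex.cpow_sub _ _ two_ne_zero, Complex.cpow_one]
    ring
  · rw [weberInt_zero_right hs1 (by norm_num), h4, Complex.cpow_add _ _ two_ne_zero,
      Complex.cpow_one]
    ring
  · have := weberInt_asymp hs1 hθ
    rwa [add_assoc s 1 2, show (1 : ℂ) + 2 = 3 by norm_num] at this

/-- Continuation to the left in s: the recurrence expresses the function at s through those at s + 1
and s + 2, at the price of a division by s. -/
theorem exists_isParabolic {s : ℂ} (hs : ∀ m : ℕ, s ≠ -m) : ∃ g g₁ : ℂ → ℂ, IsParabolic s g g₁ := by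
  suffices h : ∀ N : ℕ, ∀ s : ℂ, (∀ m : ℕ, s ≠ -m) → -(N : ℝ) < s.re →
      ∃ g g₁ : ℂ → ℂ, IsParabolic s g g₁ by
    obtain ⟨N, hN⟩ := exists_nat_gt (-s.re)
    exact h N s hs (by linarith)
  intro N
  induction N with
  | zero => intro s _ h; exact exists_isParabolic_of_pos (by simpa using h)
  | succ N ih =>
    intro s hs h
    have hs0 : s ≠ 0 := by simpa using hs 0
    obtain ⟨g, g₁, hg⟩ := ih (s + 1)
      (fun m hm => hs (m + 1) (by push_cast; linear_combination hm))
      (by push_cast at h; simp; linarith)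
    refine ⟨fun x => (g₁ x + 2 * x * g x) / (2 * s), g, fun x => ?_, fun x => ?_, ?_, ?_, ?_, ?_⟩
    · refine (((hg.right x).add (((hasDerivAt_id x).const_mul 2).mul (hg.left x))).div_const
        (2 * s)).congr_deriv ?_
      simp only [id]
      field_simp
      ring
    · refine (hg.left x).congr_deriv ?_
      field_simp
      ring
    · have h1 : Complex.Gamma ((s + 1 + 1) / 2) = s / 2 * Complex.Gamma (s / 2) := by
        rw [← Complex.Gamma_add_one _ (by simpa using hs0)]; congr 1; ring
      simp only [hg.zero_right, h1]
      rw [Complex.cpow_add _ _ two_ne_zero, Complex.cpow_sub _ _ two_ne_zero]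
      field_simp
      norm_num
      ring
    · rw [hg.zero_left]; simp
    · intro θ hθ
      have a1 := hg.asymp_right θ hθ
      have a0 := hg.asymp_left θ hθ
      have h1 : Complex.Gamma (s + 1) = s * Complex.Gamma s := Complex.Gamma_add_one _ hs0
      -- The summand g₁ has order x^{-(s+2)} and belongs to the error; the leading term Γ(s)x^{-s}
      -- comes from 2xg/(2s).
      have b1 : (fun ℓ => g₁ (Complex.exp ℓ)) =O[strip (-θ) θ]
          fun ℓ => Complex.exp (-(s + 2) * ℓ) := by
        have c1 : (fun ℓ => Complex.exp (-(s + 1 + 3) * ℓ)) =O[strip (-θ) θ]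
            fun ℓ => Complex.exp (-(s + 2) * ℓ) := by
          have : (fun ℓ => Complex.exp (-(s + 1 + 3) * ℓ)) =
              fun ℓ => (sqX ℓ)⁻¹ * Complex.exp (-(s + 2) * ℓ) := by
            funext ℓ
            rw [sqX, ← Complex.exp_neg, ← Complex.exp_add]; congr 1; ring
          rw [this]
          simpa using ((tendsto_sqX_inv (-θ) θ).isBigO_one ℂ).mul
            (isBigO_refl (fun ℓ => Complex.exp (-(s + 2) * ℓ)) _)
        have c2 : (fun ℓ => Complex.Gamma (s + 1 + 1) * Complex.exp (-(s + 1 + 1) * ℓ))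
            =O[strip (-θ) θ] fun ℓ => Complex.exp (-(s + 2) * ℓ) := by
          have : s + 1 + 1 = s + 2 := by ring
          rw [this]
          exact isBigO_const_mul_self _ _ _
        simpa using (a1.trans c1).add c2
      have b2 : (fun ℓ => 2 * Complex.exp ℓ * (g (Complex.exp ℓ) -
          Complex.Gamma (s + 1) * Complex.exp (-(s + 1) * ℓ))) =O[strip (-θ) θ]
          fun ℓ => Complex.exp (-(s + 2) * ℓ) := by
        have := (isBigO_const_mul_self (2 : ℂ) Complex.exp (strip (-θ) θ)).mul a0
        refine this.congr_right fun ℓ => ?_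
        rw [← Complex.exp_add]; congr 1; ring
      refine ((b1.add b2).const_mul_left (1 / (2 * s))).congr_left fun ℓ => ?_
      have e : Complex.exp (-s * ℓ) = Complex.exp ℓ * Complex.exp (-(s + 1) * ℓ) := by
        rw [← Complex.exp_add]; congr 1; ring
      rw [e, h1]
      field_simp
      ring
    · intro θ hθ
      have := hg.asymp_left θ hθ
      rwa [add_assoc s 1 2, show (1 : ℂ) + 2 = 3 by norm_num] at this

end PainleveIV

end

noncomputable section

namespace PainleveIV

open Topology Set MeasureTheory Asymptotics

/-! ### Decay of x^κ e^{-x²} around the positive axis. -/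

theorem isBigO_exp_sub_sqX (κ : ℂ) {θ₁ θ₂ : ℝ} (h1 : -(Real.pi / 4) < θ₁)
    (h2 : θ₂ < Real.pi / 4) :
    (fun ℓ => Complex.exp (κ * ℓ - sqX ℓ)) =O[strip θ₁ θ₂] fun _ => (1 : ℂ) := by
  set θ := max |θ₁| |θ₂| with hθ
  by_cases hθθ : θ₁ ≤ θ₂
  swap
  · have : strip θ₁ θ₂ = ⊥ := by
      rw [← empty_mem_iff_bot]
      exact eventually_strip.2 ⟨0, fun ℓ _ h1 h2 => by exfalso; linarith⟩
    rw [this]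
    exact isBigO_bot _ _
  have hθ4 : θ < Real.pi / 4 := by
    refine max_lt (abs_lt.2 ⟨h1, by linarith⟩) (abs_lt.2 ⟨by linarith, h2⟩)
  have hθ0 : 0 ≤ θ := (abs_nonneg _).trans (le_max_left _ _)
  set δ := Real.cos (2 * θ) with hδ
  have hδ0 : 0 < δ := Real.cos_pos_of_mem_Ioo ⟨by linarith, by linarith⟩
  refine IsBigO.of_bound (Real.exp (κ.re ^ 2 / (8 * δ) + |κ.im| * θ))
    (eventually_strip.2 ⟨0, fun ℓ h0 h1 h2 => ?_⟩)
  have hφ : |ℓ.im| ≤ θ := abs_le_max_abs_abs h1 h2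
  rw [norm_one, mul_one, Complex.norm_exp]
  refine Real.exp_le_exp.2 ?_
  have hre : (κ * ℓ - sqX ℓ).re = κ.re * ℓ.re - κ.im * ℓ.im
      - Real.exp (2 * ℓ.re) * Real.cos (2 * ℓ.im) := by
    simp [sqX, Complex.exp_re]
  rw [hre]
  have hcos : δ ≤ Real.cos (2 * ℓ.im) := by
    rw [hδ, ← Real.cos_abs (2 * ℓ.im)]
    refine Real.cos_le_cos_of_nonneg_of_le_pi (abs_nonneg _) (by linarith) ?_
    rw [abs_mul]; norm_num; linarith
  -- A quadratic lower bound for |x|² = e^{2 Re ℓ} already beats the linear exponent, by completing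
  -- the square.
  have he : 2 * ℓ.re ^ 2 ≤ Real.exp (2 * ℓ.re) := by
    have := Real.quadratic_le_exp_of_nonneg (x := 2 * ℓ.re) (by linarith)
    nlinarith
  have hm : 2 * ℓ.re ^ 2 * δ ≤ Real.exp (2 * ℓ.re) * Real.cos (2 * ℓ.im) := by gcongr
  have hsq : κ.re * ℓ.re ≤ κ.re ^ 2 / (8 * δ) + 2 * ℓ.re ^ 2 * δ := by
    have : κ.re ^ 2 / (8 * δ) + 2 * ℓ.re ^ 2 * δ - κ.re * ℓ.re
        = (κ.re - 4 * δ * ℓ.re) ^ 2 / (8 * δ) := by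
      field_simp; ring
    have h2 : 0 ≤ (κ.re - 4 * δ * ℓ.re) ^ 2 / (8 * δ) := by positivity
    linarith
  have him : |κ.im * ℓ.im| ≤ |κ.im| * θ := by rw [abs_mul]; gcongr
  linarith [(abs_le.1 him).1]

/-! ### Distinguished solutions of the Weber equation -/

/-- The parameter `s` is not an integer. -/
def NotInt (s : ℂ) : Prop := ∀ m : ℤ, s ≠ m

theorem NotInt.neg {s : ℂ} (h : NotInt s) : NotInt (-s) := fun m hm => h (-m) (by
  push_cast; linear_combination -hm)

theorem NotInt.ne_zero {s : ℂ} (h : NotInt s) : s ≠ 0 := by simpa using h 0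

theorem NotInt.gamma_ne_zero {s : ℂ} (h : NotInt s) : Complex.Gamma s ≠ 0 :=
  Complex.Gamma_ne_zero fun m hm => h (-m) (by simp [hm])

theorem NotInt.gamma_half_ne_zero {s : ℂ} (h : NotInt s) : Complex.Gamma (s / 2) ≠ 0 :=
  Complex.Gamma_ne_zero fun m hm => h (-2 * m) (by push_cast; linear_combination 2 * hm)

theorem NotInt.gamma_half_ne_zero' {s : ℂ} (h : NotInt s) : Complex.Gamma ((s + 1) / 2) ≠ 0 :=
  Complex.Gamma_ne_zero fun m hm => h (-2 * m - 1) (by push_cast; linear_combination 2 * hm)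

open Classical in
/-- A parabolic cylinder function and minus its derivative. -/
def parab (s : ℂ) : (ℂ → ℂ) × (ℂ → ℂ) :=
  if h : ∃ g g₁ : ℂ → ℂ, IsParabolic s g g₁ then (h.choose, h.choose_spec.choose) else (0, 0)

theorem NotInt.isParabolic {s : ℂ} (h : NotInt s) : IsParabolic s (parab s).1 (parab s).2 := by
  have h' := exists_isParabolic (s := s) fun m hm => h (-m) (by simp [hm])
  simp only [parab, h', dif_pos]
  exact h'.choose_spec.choose_spec

/-- `e^{iπ s/2}`. -/
def phase (s : ℂ) : ℂ := Complex.exp (Complex.I * (Real.pi * s / 2))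

theorem phase_ne_zero (s : ℂ) : phase s ≠ 0 := Complex.exp_ne_zero _

theorem phase_neg (s : ℂ) : phase (-s) = (phase s)⁻¹ := by
  rw [phase, phase, ← Complex.exp_neg]; congr 1; ring

/-- The solution that behaves like `z^{-s}` for `-5π/4 < arg z < π/4`. -/
def psiM (s z : ℂ) : ℂ := phase s / Complex.Gamma s * (parab s).1 (Complex.I * z)

/-- The derivative of `psiM`. -/
def psiM' (s z : ℂ) : ℂ :=
  phase s / Complex.Gamma s * (-Complex.I * (parab s).2 (Complex.I * z))

/-- The solution that behaves like `z^{-s}` for `-π/4 < arg z < 5π/4`. -/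
def psiP (s z : ℂ) : ℂ := phase (-s) / Complex.Gamma s * (parab s).1 (-Complex.I * z)

/-- The derivative of `psiP`. -/
def psiP' (s z : ℂ) : ℂ :=
  phase (-s) / Complex.Gamma s * (Complex.I * (parab s).2 (-Complex.I * z))

/-- `√π` as a complex number. -/
def sqrtPi : ℂ := (Real.sqrt Real.pi : ℂ)

theorem sqrtPi_sq : sqrtPi ^ 2 = Real.pi := by
  rw [sqrtPi, ← Complex.ofReal_pow, Real.sq_sqrt Real.pi_pos.le]

theorem sqrtPi_ne_zero : sqrtPi ≠ 0 := by
  have : Real.sqrt Real.pi ≠ 0 := (Real.sqrt_pos.2 Real.pi_pos).ne'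
  simpa [sqrtPi] using this

/-- The solution that is recessive for `-π/4 < arg z < π/4`. -/
def psi0 (s z : ℂ) : ℂ := Complex.I / sqrtPi * psiP s z + -Complex.I / sqrtPi * psiM s z

/-- The derivative of `psi0`. -/
def psi0' (s z : ℂ) : ℂ := Complex.I / sqrtPi * psiP' s z + -Complex.I / sqrtPi * psiM' s z

/-- The solution with the coordinates `(A, C)`. -/
def psi (s A C z : ℂ) : ℂ := A * psiM s z + C * psi0 s z

/-- The derivative of `psi`. -/
def psi' (s A C z : ℂ) : ℂ := A * psiM' s z + C * psi0' s z

/-- Normalisation of the values at zero. -/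
def cU (s : ℂ) : ℂ := (Complex.Gamma ((s + 1) / 2))⁻¹

/-- Normalisation of the derivatives at zero. -/
def cV (s : ℂ) : ℂ := 2 * (Complex.Gamma (s / 2))⁻¹

/-- The change of the dependent variable that accompanies the rotation `x = i z`. -/
def hat (w' : ℂ → ℂ) (z : ℂ) : ℂ := Complex.exp (-z ^ 2) * w' (Complex.I * z)

/-- The derivative of `hat`. -/
def hat' (s : ℂ) (w : ℂ → ℂ) (z : ℂ) : ℂ :=
  -2 * Complex.I * s * (Complex.exp (-z ^ 2) * w (Complex.I * z))

theorem IsWeber.hat {s : ℂ} {w w' : ℂ → ℂ} (h : IsWeber (-2 * s) w w') :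
    IsWeber (-2 * (-s)) (hat w') (hat' s w) := by
  have he : ∀ z : ℂ, HasDerivAt (fun z : ℂ => Complex.exp (-z ^ 2))
      (-2 * z * Complex.exp (-z ^ 2)) z := fun z =>
    (((hasDerivAt_id z).pow 2).neg.cexp).congr_deriv (by simp; ring)
  have hi : ∀ z : ℂ, HasDerivAt (fun z : ℂ => Complex.I * z) Complex.I z := fun z =>
    ((hasDerivAt_id z).const_mul Complex.I).congr_deriv (by simp)
  refine ⟨fun z => ?_, fun z => ?_⟩
  · refine ((he z).mul ((h.right (Complex.I * z)).comp z (hi z))).congr_deriv ?_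
    simp only [hat', Function.comp]
    linear_combination (-2 * z * Complex.exp (-z ^ 2) * w' (Complex.I * z)) * Complex.I_sq
  · refine (((he z).mul ((h.left (Complex.I * z)).comp z (hi z))).const_mul
      (-2 * Complex.I * s)).congr_deriv ?_
    simp only [PainleveIV.hat, hat', Function.comp]
    linear_combination (-2 * s * Complex.exp (-z ^ 2) * w' (Complex.I * z)) * Complex.I_sq


theorem NotInt.isWeber_psiM {s : ℂ} (h : NotInt s) : IsWeber (-2 * s) (psiM s) (psiM' s) := by
  have hi : ∀ z : ℂ, HasDerivAt (fun z : ℂ => Complex.I * z) Complex.I z := fun z =>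
    ((hasDerivAt_id z).const_mul Complex.I).congr_deriv (by simp)
  refine ⟨fun z => ?_, fun z => ?_⟩
  · refine (((h.isParabolic.left _).comp z (hi z)).const_mul _).congr_deriv ?_
    simp only [psiM']
    ring
  · refine ((((h.isParabolic.right _).comp z (hi z)).const_mul (-Complex.I)).const_mul
      (phase s / Complex.Gamma s)).congr_deriv ?_
    simp only [psiM, psiM']
    generalize phase s / Complex.Gamma s = k
    linear_combination (2 * s * (parab s).1 (Complex.I * z) - 2 * Complex.I * z *
      (parab s).2 (Complex.I * z)) * k * Complex.I_sq

theorem NotInt.isWeber_psiP {s : ℂ} (h : NotInt s) : IsWeber (-2 * s) (psiP s) (psiP' s) := by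
  have hi : ∀ z : ℂ, HasDerivAt (fun z : ℂ => -Complex.I * z) (-Complex.I) z := fun z =>
    ((hasDerivAt_id z).const_mul (-Complex.I)).congr_deriv (by simp)
  refine ⟨fun z => ?_, fun z => ?_⟩
  · refine (((h.isParabolic.left _).comp z (hi z)).const_mul _).congr_deriv ?_
    simp only [psiP']
    ring
  · refine ((((h.isParabolic.right _).comp z (hi z)).const_mul Complex.I).const_mul
      (phase (-s) / Complex.Gamma s)).congr_deriv ?_
    simp only [psiP, psiP']
    generalize phase (-s) / Complex.Gamma s = k
    linear_combination (2 * s * (parab s).1 (-Complex.I * z) + 2 * Complex.I * z *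
      (parab s).2 (-Complex.I * z)) * k * Complex.I_sq

theorem NotInt.isWeber_psi0 {s : ℂ} (h : NotInt s) : IsWeber (-2 * s) (psi0 s) (psi0' s) :=
  (h.isWeber_psiP.const_mul _).add (h.isWeber_psiM.const_mul _)

theorem NotInt.isWeber_psi {s : ℂ} (h : NotInt s) (A C : ℂ) :
    IsWeber (-2 * s) (psi s A C) (psi' s A C) :=
  (h.isWeber_psiM.const_mul _).add (h.isWeber_psi0.const_mul _)

theorem cU_ne_zero {s : ℂ} (h : NotInt s) : cU s ≠ 0 := inv_ne_zero h.gamma_half_ne_zero'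

theorem cV_ne_zero {s : ℂ} (h : NotInt s) : cV s ≠ 0 :=
  mul_ne_zero two_ne_zero (inv_ne_zero h.gamma_half_ne_zero)

theorem gamma_duplication (s : ℂ) :
    Complex.Gamma (s / 2) * Complex.Gamma ((s + 1) / 2) * 2 ^ s =
      2 * Complex.Gamma s * sqrtPi := by
  have := Complex.Gamma_mul_Gamma_add_half (s / 2)
  rw [show s / 2 + 1 / 2 = (s + 1) / 2 by ring, show 2 * (s / 2) = s by ring,
    Complex.cpow_sub _ _ two_ne_zero, Complex.cpow_one] at this
  have h2 : (2 : ℂ) ^ s ≠ 0 := by simp [Complex.cpow_eq_zero_iff]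
  rw [this, sqrtPi]
  field_simp

theorem cU_mul_cV {s : ℂ} (h : NotInt s) : cU s * cV s * sqrtPi = 2 ^ s / Complex.Gamma s := by
  have h1 := h.gamma_ne_zero
  have h2 := h.gamma_half_ne_zero
  have h3 := h.gamma_half_ne_zero'
  simp only [cU, cV]
  field_simp
  linear_combination -gamma_duplication s

theorem psiM_zero {s : ℂ} (h : NotInt s) : psiM s 0 = sqrtPi * phase s * cU s := by
  have h1 := h.gamma_ne_zero
  have h3 := h.gamma_half_ne_zero'
  simp only [psiM, mul_zero, h.isParabolic.zero_left, cU]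
  rw [Complex.cpow_sub _ _ two_ne_zero, Complex.cpow_one]
  field_simp
  linear_combination phase s * gamma_duplication s

theorem psiP_zero {s : ℂ} (h : NotInt s) : psiP s 0 = sqrtPi * phase (-s) * cU s := by
  have h1 := h.gamma_ne_zero
  have h3 := h.gamma_half_ne_zero'
  simp only [psiP, mul_zero, h.isParabolic.zero_left, cU]
  rw [Complex.cpow_sub _ _ two_ne_zero, Complex.cpow_one]
  field_simp
  linear_combination phase (-s) * gamma_duplication s

theorem psiM'_zero {s : ℂ} (h : NotInt s) :
    psiM' s 0 = -Complex.I * sqrtPi * phase s * cV s := by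
  have h1 := h.gamma_ne_zero
  have h3 := h.gamma_half_ne_zero
  simp only [psiM', mul_zero, h.isParabolic.zero_right, cV]
  field_simp
  linear_combination -phase s * gamma_duplication s

theorem psiP'_zero {s : ℂ} (h : NotInt s) :
    psiP' s 0 = Complex.I * sqrtPi * phase (-s) * cV s := by
  have h1 := h.gamma_ne_zero
  have h3 := h.gamma_half_ne_zero
  simp only [psiP', mul_zero, h.isParabolic.zero_right, cV]
  field_simp
  linear_combination phase (-s) * gamma_duplication s

theorem psi0_zero {s : ℂ} (h : NotInt s) :
    psi0 s 0 = Complex.I * (phase (-s) - phase s) * cU s := by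
  have := sqrtPi_ne_zero
  simp only [psi0, psiM_zero h, psiP_zero h]
  field_simp
  ring

theorem psi0'_zero {s : ℂ} (h : NotInt s) :
    psi0' s 0 = -(phase (-s) + phase s) * cV s := by
  have := sqrtPi_ne_zero
  simp only [psi0', psiM'_zero h, psiP'_zero h]
  field_simp
  linear_combination cV s * (phase s + phase (-s)) * Complex.I_sq

/-- The four values at 0 are Gamma factors, which the duplication formula collapses. This constant
shows that `psiM` and `psi0` form a basis, and it is the source of 2^s/Γ(s) in every multiplier. -/
theorem wronskian_psiM_psi0 {s : ℂ} (h : NotInt s) :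
    psiM s 0 * psi0' s 0 - psiM' s 0 * psi0 s 0 = -2 * 2 ^ s / Complex.Gamma s := by
  rw [mul_div_assoc, ← cU_mul_cV h, psiM_zero h, psi0'_zero h, psiM'_zero h, psi0_zero h, phase_neg]
  have := phase_ne_zero s
  field_simp
  linear_combination sqrtPi * cU s * cV s * (1 - phase s ^ 2) * Complex.I_sq

theorem wronskian_psiM_psi0_ne_zero {s : ℂ} (h : NotInt s) :
    psiM s 0 * psi0' s 0 - psiM' s 0 * psi0 s 0 ≠ 0 := by
  rw [wronskian_psiM_psi0 h]
  have h2 : (2 : ℂ) ^ s ≠ 0 := by simp [Complex.cpow_eq_zero_iff]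
  have := h.gamma_ne_zero
  simp [h2, this]

/-- The recessive solution in terms of `psiP`. -/
theorem psi_eq_psiP (s A C z : ℂ) :
    psi s A C z = A * psiP s z + (C + iSqrtPi * A) * psi0 s z ∧
    psi' s A C z = A * psiP' s z + (C + iSqrtPi * A) * psi0' s z := by
  -- The definition of `psi0` reads `psiM` = `psiP` + i√π `psi0`: this is the Stokes jump of the
  -- coordinate.
  have := sqrtPi_ne_zero
  have e : iSqrtPi = Complex.I * sqrtPi := rfl
  constructor
  · simp only [psi, psi0, e]
    field_simp
    linear_combination (A * sqrtPi * (psiM s z - psiP s z)) * Complex.I_sq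
  · simp only [psi', psi0', e]
    field_simp
    linear_combination (A * sqrtPi * (psiM' s z - psiP' s z)) * Complex.I_sq

/-- Euler's reflection formula. Together with `cV_mul_cV_neg` it trades the constants for -s for
those for s, as the quarter turn requires. -/
theorem cU_mul_cU_neg (s : ℂ) :
    cU s * cU (-s) = (phase s + phase (-s)) / (2 * Real.pi) := by
  have := Complex.Gamma_mul_Gamma_one_sub ((s + 1) / 2)
  rw [show 1 - (s + 1) / 2 = (-s + 1) / 2 by ring] at this
  rw [cU, cU, ← mul_inv, this, show (Real.pi : ℂ) * ((s + 1) / 2) = Real.pi * s / 2 + Real.pi / 2 by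
    ring, Complex.sin_add_pi_div_two, Complex.cos, phase, phase]
  rw [inv_div, show Complex.I * (Real.pi * -s / 2) = -(Real.pi * s / 2) * Complex.I by ring,
    mul_comm Complex.I, div_div]

theorem cV_mul_cV_neg {s : ℂ} (h : NotInt s) :
    cV s * cV (-s) = -(s * (phase (-s) - phase s) * Complex.I) / Real.pi := by
  have := Complex.Gamma_mul_Gamma_one_sub (s / 2)
  have h0 := h.ne_zero
  have h1 : Complex.Gamma (1 - s / 2) = -(s / 2) * Complex.Gamma (-(s / 2)) := by
    rw [← Complex.Gamma_add_one _ (by simpa using h0)]; congr 1; ring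
  have h3 : Complex.Gamma (-(s / 2)) ≠ 0 := by simpa [neg_div] using h.neg.gamma_half_ne_zero
  have h4 := h.gamma_half_ne_zero
  have hpi : (Real.pi : ℂ) ≠ 0 := by exact_mod_cast Real.pi_ne_zero
  have h5 : Complex.sin (Real.pi * (s / 2)) ≠ 0 := by
    intro h5
    rw [h5, h1, div_zero] at this
    simp [h0, h3, h4] at this
  rw [h1, eq_div_iff h5, Complex.sin] at this
  simp only [cV, phase, neg_div]
  rw [show Complex.I * (Real.pi * -s / 2) = -(Real.pi * (s / 2)) * Complex.I by ring,
    show Complex.I * (Real.pi * s / 2) = (Real.pi * (s / 2)) * Complex.I by ring]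
  field_simp
  field_simp at this
  linear_combination -this

/-- `psi0` is, up to a factor, the rotation of a solution with algebraic behaviour. -/
theorem hat_psiP {s : ℂ} (h : NotInt s) (z : ℂ) :
    hat (psiP' (-s)) z = -(Complex.I * sqrtPi * s * phase s / (Real.pi * cU s * cV s)) * psi0 s z ∧
    hat' (-s) (psiP (-s)) z =
      -(Complex.I * sqrtPi * s * phase s / (Real.pi * cU s * cV s)) * psi0' s z := by
  have hw : IsWeber (-2 * s) (hat (psiP' (-s))) (hat' (-s) (psiP (-s))) := by
    simpa using h.neg.isWeber_psiP.hat
  have hu := cU_ne_zero h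
  have hv := cV_ne_zero h
  have hpi : (Real.pi : ℂ) ≠ 0 := by exact_mod_cast Real.pi_ne_zero
  -- Both sides solve the same Weber equation, so their values and derivatives at 0 decide.
  refine hw.eq_of_initial (h.isWeber_psi0.const_mul _) ?_ ?_ h.isWeber_psiM h.isWeber_psi0
    (wronskian_psiM_psi0_ne_zero h) z
  · have e : cV (-s) = -(s * (phase (-s) - phase s) * Complex.I) / Real.pi / cV s := by
      rw [← cV_mul_cV_neg h]; field_simp
    simp only [hat, psi0_zero h]
    rw [mul_zero, psiP'_zero h.neg, e, neg_neg]
    simp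
    field_simp
  · have e : cU (-s) = (phase s + phase (-s)) / (2 * Real.pi) / cU s := by
      rw [← cU_mul_cU_neg]; field_simp
    simp only [hat', psi0'_zero h]
    rw [mul_zero, psiP_zero h.neg, e, neg_neg]
    simp
    field_simp
    ring

/-- The coordinates of a rotated solution. -/
theorem hat_psi {s : ℂ} (h : NotInt s) (A C : ℂ) :
    ∃ c : ℂ, c ≠ 0 ∧ ∀ z,
      hat (psi' s A C) z = c * psi (-s) ((1 - phase s ^ 4) * (C + iSqrtPi * A)) (Real.pi * A) z ∧
      hat' s (psi s A C) z =
        c * psi' (-s) ((1 - phase s ^ 4) * (C + iSqrtPi * A)) (Real.pi * A) z := by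
  have hu := cU_ne_zero h
  have hv := cV_ne_zero h
  have hE := phase_ne_zero s
  have hpi : (Real.pi : ℂ) ≠ 0 := by exact_mod_cast Real.pi_ne_zero
  have h4 : 1 - phase s ^ 4 ≠ 0 := by
    rw [phase, ← Complex.exp_nat_mul, sub_ne_zero, ne_comm, Ne, Complex.exp_eq_one_iff]
    rintro ⟨m, hm⟩
    refine h m ?_
    push_cast at hm
    have : Complex.I * (2 * Real.pi) * (s - m) = 0 := by linear_combination hm
    simpa [hpi, sub_eq_zero] using this
  -- The factor is forced by the case A = 0, where a multiple of `psi0` is rotated into a multiple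
  -- of `psiM (-s)`.
  refine ⟨-2 * sqrtPi * cU s * cV s * phase s / (1 - phase s ^ 4), ?_, fun z => ?_⟩
  · have := sqrtPi_ne_zero
    simp [hu, hv, hE, h4, this]
  refine (h.isWeber_psi A C).hat.eq_of_initial ((h.neg.isWeber_psi _ _).const_mul _) ?_ ?_
    h.neg.isWeber_psiM h.neg.isWeber_psi0 (wronskian_psiM_psi0_ne_zero h.neg) z
  · have e : cU (-s) = (phase s + phase (-s)) / (2 * Real.pi) / cU s := by
      rw [← cU_mul_cU_neg]; field_simp
    simp only [hat, psi', psi, mul_zero, psiM'_zero h, psi0'_zero h, psiM_zero h.neg,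
      psi0_zero h.neg, neg_neg, e, phase_neg, iSqrtPi, ← sqrtPi_sq]
    rw [← sqrtPi]
    have := sqrtPi_ne_zero
    simp
    field_simp
    ring
  · have e : cV (-s) = -(s * (phase (-s) - phase s) * Complex.I) / Real.pi / cV s := by
      rw [← cV_mul_cV_neg h]; field_simp
    simp only [hat', psi', psi, mul_zero, psiM'_zero h.neg, psi0'_zero h.neg, psiM_zero h,
      psi0_zero h, neg_neg, e, phase_neg, iSqrtPi, ← sqrtPi_sq]
    rw [← sqrtPi]
    have := sqrtPi_ne_zero
    simp
    field_simp
    linear_combination (-(phase s ^ 2 + phase s ^ 4 - phase s ^ 6 - 1) * s * A * sqrtPi) * Complex.I_sq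

end PainleveIV

end

noncomputable section

namespace PainleveIV

open Topology Set Asymptotics

/-! ### Calculus of asymptotic relations in open sectors -/

/-- `Q` holds far out in every closed subsector of `φ₁ < Im ℓ < φ₂`. -/
def Ev (φ₁ φ₂ : ℝ) (Q : ℂ → Prop) : Prop :=
  ∀ θ₁ θ₂ : ℝ, φ₁ < θ₁ → θ₂ < φ₂ → ∀ᶠ ℓ in strip θ₁ θ₂, Q ℓ

/-- `f = O(g)` in every closed subsector of `φ₁ < Im ℓ < φ₂`. -/
def SO (φ₁ φ₂ : ℝ) (f g : ℂ → ℂ) : Prop :=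
  ∀ θ₁ θ₂ : ℝ, φ₁ < θ₁ → θ₂ < φ₂ → f =O[strip θ₁ θ₂] g

/-- `f = c + O(x⁻²)` in every closed subsector of `φ₁ < Im ℓ < φ₂`. -/
def Near (φ₁ φ₂ : ℝ) (f : ℂ → ℂ) (c : ℂ) : Prop :=
  SO φ₁ φ₂ (fun ℓ => f ℓ - c) fun ℓ => (sqX ℓ)⁻¹

variable {φ₁ φ₂ : ℝ} {f g h k : ℂ → ℂ} {c d : ℂ} {Q Q' : ℂ → Prop}

namespace Ev

theorem of_forall (hQ : ∀ ℓ, Q ℓ) : Ev φ₁ φ₂ Q := fun _ _ _ _ => Eventually.of_forall hQ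

theorem and (h1 : Ev φ₁ φ₂ Q) (h2 : Ev φ₁ φ₂ Q') : Ev φ₁ φ₂ fun ℓ => Q ℓ ∧ Q' ℓ :=
  fun θ₁ θ₂ a b => (h1 θ₁ θ₂ a b).and (h2 θ₁ θ₂ a b)

theorem mono (h1 : Ev φ₁ φ₂ Q) (h2 : ∀ ℓ, Q ℓ → Q' ℓ) : Ev φ₁ φ₂ Q' :=
  fun θ₁ θ₂ a b => (h1 θ₁ θ₂ a b).mono h2

end Ev

namespace SO

theorem refl (f : ℂ → ℂ) : SO φ₁ φ₂ f f := fun _ _ _ _ => isBigO_refl _ _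

theorem trans (h1 : SO φ₁ φ₂ f g) (h2 : SO φ₁ φ₂ g h) : SO φ₁ φ₂ f h :=
  fun θ₁ θ₂ a b => (h1 θ₁ θ₂ a b).trans (h2 θ₁ θ₂ a b)

theorem add (h1 : SO φ₁ φ₂ f h) (h2 : SO φ₁ φ₂ g h) : SO φ₁ φ₂ (fun ℓ => f ℓ + g ℓ) h :=
  fun θ₁ θ₂ a b => (h1 θ₁ θ₂ a b).add (h2 θ₁ θ₂ a b)

theorem sub (h1 : SO φ₁ φ₂ f h) (h2 : SO φ₁ φ₂ g h) : SO φ₁ φ₂ (fun ℓ => f ℓ - g ℓ) h :=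
  fun θ₁ θ₂ a b => (h1 θ₁ θ₂ a b).sub (h2 θ₁ θ₂ a b)

theorem neg (h1 : SO φ₁ φ₂ f h) : SO φ₁ φ₂ (fun ℓ => -f ℓ) h :=
  fun θ₁ θ₂ a b => (h1 θ₁ θ₂ a b).neg_left

theorem mul (h1 : SO φ₁ φ₂ f h) (h2 : SO φ₁ φ₂ g k) :
    SO φ₁ φ₂ (fun ℓ => f ℓ * g ℓ) fun ℓ => h ℓ * k ℓ :=
  fun θ₁ θ₂ a b => (h1 θ₁ θ₂ a b).mul (h2 θ₁ θ₂ a b)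

theorem const_mul (c : ℂ) (h1 : SO φ₁ φ₂ f h) : SO φ₁ φ₂ (fun ℓ => c * f ℓ) h :=
  fun θ₁ θ₂ a b => (h1 θ₁ θ₂ a b).const_mul_left c

theorem congr (h1 : SO φ₁ φ₂ f h) (h2 : Ev φ₁ φ₂ fun ℓ => f ℓ = g ℓ) : SO φ₁ φ₂ g h :=
  fun θ₁ θ₂ a b => (h1 θ₁ θ₂ a b).congr' (h2 θ₁ θ₂ a b) EventuallyEq.rfl

theorem congr_left (h1 : SO φ₁ φ₂ f h) (h2 : ∀ ℓ, f ℓ = g ℓ) : SO φ₁ φ₂ g h :=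
  h1.congr (.of_forall h2)

theorem congr_right (h1 : SO φ₁ φ₂ f g) (h2 : ∀ ℓ, g ℓ = h ℓ) : SO φ₁ φ₂ f h :=
  fun θ₁ θ₂ a b => (h1 θ₁ θ₂ a b).congr_right h2

theorem mono_sector {ψ₁ ψ₂ : ℝ} (h1 : SO φ₁ φ₂ f g) (ha : φ₁ ≤ ψ₁) (hb : ψ₂ ≤ φ₂) :
    SO ψ₁ ψ₂ f g :=
  fun θ₁ θ₂ a b => h1 θ₁ θ₂ (ha.trans_lt a) (b.trans_le hb)

theorem const (c : ℂ) : SO φ₁ φ₂ (fun _ => c) fun _ => 1 :=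
  fun _ _ _ _ => isBigO_const_const _ one_ne_zero _

theorem sqX_inv : SO φ₁ φ₂ (fun ℓ => (sqX ℓ)⁻¹) fun _ => 1 :=
  fun θ₁ θ₂ _ _ => (tendsto_sqX_inv θ₁ θ₂).isBigO_one ℂ

/-- Cauchy's estimate: differentiation with respect to `ℓ` preserves bounds. -/
theorem deriv {ν : ℂ} {f' : ℂ → ℂ} (h1 : SO φ₁ φ₂ f fun ℓ => Complex.exp (ν * ℓ))
    (h2 : Ev φ₁ φ₂ fun ℓ => HasDerivAt f (f' ℓ) ℓ) :
    SO φ₁ φ₂ f' fun ℓ => Complex.exp (ν * ℓ) := by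
  intro θ₁ θ₂ a b
  -- Half the margin to the boundary: discs of radius δ around points of the closed strip stay in a
  -- larger closed strip, and e^{νℓ} varies on them by a factor of at most e^{‖ν‖δ}.
  obtain ⟨δ, hδ, hδ1, hδ2⟩ : ∃ δ : ℝ, 0 < δ ∧ φ₁ < θ₁ - δ ∧ θ₂ + δ < φ₂ := by
    refine ⟨min (θ₁ - φ₁) (φ₂ - θ₂) / 2, ?_, ?_, ?_⟩
    · have : 0 < min (θ₁ - φ₁) (φ₂ - θ₂) := lt_min (by linarith) (by linarith)
      positivity
    · linarith [min_le_left (θ₁ - φ₁) (φ₂ - θ₂)]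
    · linarith [min_le_right (θ₁ - φ₁) (φ₂ - θ₂)]
  obtain ⟨C, hC⟩ := (h1 _ _ hδ1 hδ2).bound
  obtain ⟨R, hR⟩ := eventually_strip.1 (hC.and (h2 _ _ hδ1 hδ2))
  refine IsBigO.of_bound (|C| * Real.exp (‖ν‖ * δ) / δ) (eventually_strip.2 ⟨R + δ,
    fun ℓ e1 e2 e3 => ?_⟩)
  have hin : ∀ z ∈ Metric.closedBall ℓ δ, R ≤ z.re ∧ θ₁ - δ ≤ z.im ∧ z.im ≤ θ₂ + δ := by
    intro z hz
    rw [mem_closedBall_iff_norm] at hz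
    have i1 := (Complex.abs_re_le_norm (z - ℓ)).trans hz
    have i2 := (Complex.abs_im_le_norm (z - ℓ)).trans hz
    rw [Complex.sub_re, abs_le] at i1
    rw [Complex.sub_im, abs_le] at i2
    exact ⟨by linarith, by linarith, by linarith⟩
  have hdiff : DifferentiableOn ℂ f (Metric.closedBall ℓ δ) := fun z hz => by
    obtain ⟨j1, j2, j3⟩ := hin z hz
    exact (hR z j1 j2 j3).2.differentiableAt.differentiableWithinAt
  have hb : ∀ z ∈ Metric.sphere ℓ δ,
      ‖f z‖ ≤ |C| * Real.exp (‖ν‖ * δ) * ‖Complex.exp (ν * ℓ)‖ := by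
    intro z hz
    obtain ⟨j1, j2, j3⟩ := hin z (Metric.sphere_subset_closedBall hz)
    refine (hR z j1 j2 j3).1.trans ?_
    have : ‖Complex.exp (ν * z)‖ ≤ Real.exp (‖ν‖ * δ) * ‖Complex.exp (ν * ℓ)‖ := by
      rw [show ν * z = ν * (z - ℓ) + ν * ℓ by ring, Complex.exp_add, norm_mul]
      gcongr
      rw [Complex.norm_exp]
      refine Real.exp_le_exp.2 ((Complex.re_le_norm _).trans ?_)
      rw [norm_mul, mem_sphere_iff_norm.1 hz]
    rw [mul_assoc]
    exact mul_le_mul (le_abs_self _) this (norm_nonneg _) (abs_nonneg _)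
  obtain ⟨j1, j2, j3⟩ := hin ℓ (Metric.mem_closedBall_self hδ.le)
  have hd := (hR ℓ j1 j2 j3).2.deriv
  rw [← hd]
  refine (Complex.norm_deriv_le_of_forall_mem_sphere_norm_le hδ
    (hdiff.diffContOnCl_ball subset_rfl) hb).trans (le_of_eq (by ring))

end SO

namespace Near

theorem const (c : ℂ) : Near φ₁ φ₂ (fun _ => c) c := fun θ₁ θ₂ _ _ => by
  simpa using isBigO_zero (E' := ℂ) (fun ℓ => (sqX ℓ)⁻¹) (strip θ₁ θ₂)

theorem congr (h1 : Near φ₁ φ₂ f c) (h2 : Ev φ₁ φ₂ fun ℓ => f ℓ = g ℓ) : Near φ₁ φ₂ g c :=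
  SO.congr h1 (h2.mono fun ℓ h => by rw [h])

theorem of_eq (h1 : Near φ₁ φ₂ f c) (h2 : c = d) : Near φ₁ φ₂ f d := h2 ▸ h1

theorem mono_sector {ψ₁ ψ₂ : ℝ} (h1 : Near φ₁ φ₂ f c) (ha : φ₁ ≤ ψ₁) (hb : ψ₂ ≤ φ₂) :
    Near ψ₁ ψ₂ f c := SO.mono_sector h1 ha hb

theorem add (h1 : Near φ₁ φ₂ f c) (h2 : Near φ₁ φ₂ g d) :
    Near φ₁ φ₂ (fun ℓ => f ℓ + g ℓ) (c + d) :=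
  (SO.add h1 h2).congr_left fun ℓ => by ring

theorem sub (h1 : Near φ₁ φ₂ f c) (h2 : Near φ₁ φ₂ g d) :
    Near φ₁ φ₂ (fun ℓ => f ℓ - g ℓ) (c - d) :=
  (SO.sub h1 h2).congr_left fun ℓ => by ring

theorem neg (h1 : Near φ₁ φ₂ f c) : Near φ₁ φ₂ (fun ℓ => -f ℓ) (-c) :=
  (SO.neg h1).congr_left fun ℓ => by ring

theorem bounded (h1 : Near φ₁ φ₂ f c) : SO φ₁ φ₂ f fun _ => 1 :=
  ((SO.trans h1 SO.sqX_inv).add (SO.const c)).congr_left fun ℓ => by ring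

theorem of_SO (h1 : SO φ₁ φ₂ f fun ℓ => (sqX ℓ)⁻¹) : Near φ₁ φ₂ f 0 :=
  h1.congr_left fun ℓ => by ring

theorem to_SO (h1 : Near φ₁ φ₂ f 0) : SO φ₁ φ₂ f fun ℓ => (sqX ℓ)⁻¹ :=
  SO.congr_left h1 fun ℓ => by ring

theorem mul (h1 : Near φ₁ φ₂ f c) (h2 : Near φ₁ φ₂ g d) :
    Near φ₁ φ₂ (fun ℓ => f ℓ * g ℓ) (c * d) := by
  have e1 := (SO.mul h1 h2.bounded).congr_right fun ℓ => mul_one _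
  exact (e1.add (SO.const_mul c h2)).congr_left fun ℓ => by ring

theorem const_mul (c : ℂ) (h1 : Near φ₁ φ₂ f d) : Near φ₁ φ₂ (fun ℓ => c * f ℓ) (c * d) :=
  (const c).mul h1

theorem sqX_inv : Near φ₁ φ₂ (fun ℓ => (sqX ℓ)⁻¹) 0 := of_SO (SO.refl _)

theorem div_sqX (h1 : SO φ₁ φ₂ f fun _ => 1) : Near φ₁ φ₂ (fun ℓ => f ℓ / sqX ℓ) 0 :=
  of_SO (((h1.mul (SO.refl fun ℓ => (sqX ℓ)⁻¹)).congr_right fun _ => one_mul _).congr_left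
    fun _ => (div_eq_mul_inv _ _).symm)

theorem tendsto (h1 : Near φ₁ φ₂ f c) {θ₁ θ₂ : ℝ} (a : φ₁ < θ₁) (b : θ₂ < φ₂) :
    Tendsto f (strip θ₁ θ₂) (𝓝 c) := by
  have := (h1 θ₁ θ₂ a b).trans_tendsto (tendsto_sqX_inv θ₁ θ₂)
  simpa using this.add_const c

theorem ne_zero (h1 : Near φ₁ φ₂ f c) (hc : c ≠ 0) : Ev φ₁ φ₂ fun ℓ => f ℓ ≠ 0 :=
  fun _ _ a b => (h1.tendsto a b).eventually_ne hc

theorem inv_bounded (h1 : Near φ₁ φ₂ f c) (hc : c ≠ 0) : SO φ₁ φ₂ (fun ℓ => (f ℓ)⁻¹) fun _ => 1 :=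
  fun _ _ a b => ((h1.tendsto a b).inv₀ hc).isBigO_one ℂ

theorem inv (h1 : Near φ₁ φ₂ f c) (hc : c ≠ 0) : Near φ₁ φ₂ (fun ℓ => (f ℓ)⁻¹) c⁻¹ := by
  have e1 := ((SO.const_mul (-c⁻¹) h1).mul (h1.inv_bounded hc)).congr_right fun ℓ => mul_one _
  refine SO.congr e1 ((h1.ne_zero hc).mono fun ℓ hℓ => ?_)
  field_simp
  ring

theorem div (h1 : Near φ₁ φ₂ f c) (h2 : Near φ₁ φ₂ g d) (hd : d ≠ 0) :
    Near φ₁ φ₂ (fun ℓ => f ℓ / g ℓ) (c / d) := by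
  simpa only [div_eq_mul_inv] using h1.mul (h2.inv hd)

theorem sqX_inv_eq (ℓ : ℂ) : (sqX ℓ)⁻¹ = Complex.exp (-2 * ℓ) := by
  rw [sqX, ← Complex.exp_neg]; congr 1; ring

/-- Cauchy's estimate for f - c. It lets derivatives be discarded in a differential equation, which
then determines the limits of its other terms. -/
theorem deriv {f' : ℂ → ℂ} (h1 : Near φ₁ φ₂ f c) (h2 : Ev φ₁ φ₂ fun ℓ => HasDerivAt f (f' ℓ) ℓ) :
    Near φ₁ φ₂ f' 0 := by
  refine of_SO ((SO.deriv (f := fun ℓ => f ℓ - c) (ν := -2)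
    (SO.congr_right h1 sqX_inv_eq) ?_).congr_right fun ℓ => (sqX_inv_eq ℓ).symm)
  exact h2.mono fun ℓ h => h.sub_const c

end Near

theorem SO.deriv_one {f' : ℂ → ℂ} (h1 : SO φ₁ φ₂ f fun _ => 1)
    (h2 : Ev φ₁ φ₂ fun ℓ => HasDerivAt f (f' ℓ) ℓ) : SO φ₁ φ₂ f' fun _ => 1 :=
  (SO.deriv (ν := 0) (h1.congr_right fun ℓ => by simp) h2).congr_right fun ℓ => by simp

/-! ### Asymptotics of the distinguished solutions -/

/-- The shift a moves the centre of the sector; a = -π/2 and a = π/2 serve `psiM` and `psiP`. -/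
theorem parab_asymp {s : ℂ} (h : NotInt s) (a : ℝ) :
    Near (a - 3 * Real.pi / 4) (a + 3 * Real.pi / 4)
      (fun ℓ => Complex.exp (s * (ℓ - a * Complex.I)) *
        (parab s).1 (Complex.exp (ℓ - a * Complex.I))) (Complex.Gamma s) ∧
    Near (a - 3 * Real.pi / 4) (a + 3 * Real.pi / 4)
      (fun ℓ => Complex.exp ((s + 1) * (ℓ - a * Complex.I)) *
        (parab s).2 (Complex.exp (ℓ - a * Complex.I))) (Complex.Gamma (s + 1)) := by
  have main : ∀ (t G : ℂ) (g : ℂ → ℂ), (∀ θ < 3 * Real.pi / 4,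
      (fun ℓ => g (Complex.exp ℓ) - G * Complex.exp (-t * ℓ))
        =O[strip (-θ) θ] fun ℓ => Complex.exp (-(t + 2) * ℓ)) →
      Near (a - 3 * Real.pi / 4) (a + 3 * Real.pi / 4)
      (fun ℓ => Complex.exp (t * (ℓ - a * Complex.I)) *
        g (Complex.exp (ℓ - a * Complex.I))) G := by
    intro t G g hg θ₁ θ₂ h1 h2
    set θ := max |θ₁ - a| |θ₂ - a|
    by_cases hθθ : θ₁ ≤ θ₂
    swap
    · have : strip θ₁ θ₂ = ⊥ := by
        rw [← empty_mem_iff_bot]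
        exact eventually_strip.2 ⟨0, fun ℓ _ h1 h2 => by exfalso; linarith⟩
      rw [this]
      exact isBigO_bot _ _
    have hθ : θ < 3 * Real.pi / 4 := max_lt (abs_lt.2 ⟨by linarith, by linarith⟩)
      (abs_lt.2 ⟨by linarith, by linarith⟩)
    have hb1 := (abs_le.1 (le_max_left |θ₁ - a| |θ₂ - a|)).1
    have hb2 := (abs_le.1 (le_max_right |θ₁ - a| |θ₂ - a|)).2
    have ht : Tendsto (fun ℓ : ℂ => ℓ - a * Complex.I) (strip θ₁ θ₂) (strip (-θ) θ) := by
      have := tendsto_add_strip θ₁ θ₂ (-a)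
      refine Tendsto.congr (fun ℓ => ?_) (this.mono_right (strip_mono ?_ ?_))
      · push_cast; ring
      · simp only [θ]; linarith
      · simp only [θ]; linarith
    have key := ((isBigO_refl (fun ℓ => Complex.exp (t * ℓ)) _).mul (hg θ hθ)).comp_tendsto ht
    have e : (fun ℓ => Complex.exp (t * (ℓ - a * Complex.I)) *
        Complex.exp (-(t + 2) * (ℓ - a * Complex.I))) =
        fun ℓ => Complex.exp (2 * (a * Complex.I)) * (sqX ℓ)⁻¹ := by
      funext ℓ
      rw [Near.sqX_inv_eq, ← Complex.exp_add, ← Complex.exp_add]; congr 1; ring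
    have key2 : (fun ℓ => Complex.exp (t * (ℓ - a * Complex.I)) *
        (g (Complex.exp (ℓ - a * Complex.I)) - G * Complex.exp (-t * (ℓ - a * Complex.I))))
        =O[strip θ₁ θ₂] fun ℓ => (sqX ℓ)⁻¹ := by
      refine IsBigO.trans key ?_
      show (fun ℓ => Complex.exp (t * (ℓ - a * Complex.I)) *
        Complex.exp (-(t + 2) * (ℓ - a * Complex.I))) =O[strip θ₁ θ₂] _
      rw [e]
      exact isBigO_const_mul_self _ _ _
    refine key2.congr_left fun ℓ => ?_
    rw [mul_sub, mul_left_comm, ← Complex.exp_add]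
    simp
  refine ⟨main _ _ _ h.isParabolic.asymp_left, main _ _ _ fun θ hθ => ?_⟩
  have := h.isParabolic.asymp_right θ hθ
  rwa [show s + 3 = s + 1 + 2 by ring] at this

theorem exp_add_pi_div_two (ℓ : ℂ) :
    Complex.exp (ℓ + Real.pi / 2 * Complex.I) = Complex.I * Complex.exp ℓ := by
  rw [Complex.exp_add, Complex.exp_pi_div_two_mul_I]; ring

theorem exp_sub_pi_div_two (ℓ : ℂ) :
    Complex.exp (ℓ - Real.pi / 2 * Complex.I) = -Complex.I * Complex.exp ℓ := by
  rw [sub_eq_add_neg, ← neg_mul, ← neg_div, Complex.exp_add, Complex.exp_neg_pi_div_two_mul_I]; ring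

theorem NotInt.gamma_add_one {s : ℂ} (h : NotInt s) :
    Complex.Gamma (s + 1) = s * Complex.Gamma s := Complex.Gamma_add_one _ h.ne_zero

/-- The normalisation `phase s / Γ(s)` cancels both i^{-s} and Γ(s) in the asymptotics of the
parabolic cylinder function at iz. -/
theorem near_psiM {s : ℂ} (h : NotInt s) :
    Near (-5 * Real.pi / 4) (Real.pi / 4)
      (fun ℓ => Complex.exp (s * ℓ) * psiM s (Complex.exp ℓ)) 1 ∧
    Near (-5 * Real.pi / 4) (Real.pi / 4)
      (fun ℓ => Complex.exp ((s + 1) * ℓ) * psiM' s (Complex.exp ℓ)) (-s) := by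
  have h0 := parab_asymp h (-(Real.pi / 2))
  have hg := h.gamma_ne_zero
  rw [show -(Real.pi / 2) - 3 * Real.pi / 4 = -5 * Real.pi / 4 by ring,
    show -(Real.pi / 2) + 3 * Real.pi / 4 = Real.pi / 4 by ring] at h0
  have e : ∀ ℓ : ℂ, ℓ - ((-(Real.pi / 2) : ℝ) : ℂ) * Complex.I = ℓ + Real.pi / 2 * Complex.I :=
    fun ℓ => by push_cast; ring
  simp only [e, exp_add_pi_div_two] at h0
  constructor
  · refine ((h0.1.const_mul (Complex.Gamma s)⁻¹).congr (.of_forall fun ℓ => ?_)).of_eq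
      (by field_simp)
    have : Complex.exp (s * (ℓ + Real.pi / 2 * Complex.I)) = Complex.exp (s * ℓ) * phase s := by
      rw [phase, ← Complex.exp_add]; congr 1; ring
    rw [this, psiM]
    ring
  · refine ((h0.2.const_mul (-(Complex.Gamma s)⁻¹)).congr (.of_forall fun ℓ => ?_)).of_eq
      (by rw [h.gamma_add_one]; field_simp)
    have : Complex.exp ((s + 1) * (ℓ + Real.pi / 2 * Complex.I)) =
        Complex.exp ((s + 1) * ℓ) * phase s * Complex.I := by
      rw [show (s + 1) * (ℓ + Real.pi / 2 * Complex.I) = (s + 1) * ℓ +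
        Complex.I * (Real.pi * s / 2) + Real.pi / 2 * Complex.I by ring, Complex.exp_add,
        Complex.exp_add, Complex.exp_pi_div_two_mul_I, phase]
    rw [this, psiM']
    ring

theorem near_psiP {s : ℂ} (h : NotInt s) :
    Near (-Real.pi / 4) (5 * Real.pi / 4)
      (fun ℓ => Complex.exp (s * ℓ) * psiP s (Complex.exp ℓ)) 1 ∧
    Near (-Real.pi / 4) (5 * Real.pi / 4)
      (fun ℓ => Complex.exp ((s + 1) * ℓ) * psiP' s (Complex.exp ℓ)) (-s) := by
  have h0 := parab_asymp h (Real.pi / 2)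
  have hg := h.gamma_ne_zero
  rw [show Real.pi / 2 - 3 * Real.pi / 4 = -Real.pi / 4 by ring,
    show Real.pi / 2 + 3 * Real.pi / 4 = 5 * Real.pi / 4 by ring] at h0
  have e : ∀ ℓ : ℂ, ℓ - ((Real.pi / 2 : ℝ) : ℂ) * Complex.I = ℓ - Real.pi / 2 * Complex.I :=
    fun ℓ => by push_cast; ring
  simp only [e, exp_sub_pi_div_two] at h0
  constructor
  · refine ((h0.1.const_mul (Complex.Gamma s)⁻¹).congr (.of_forall fun ℓ => ?_)).of_eq
      (by field_simp)
    have : Complex.exp (s * (ℓ - Real.pi / 2 * Complex.I)) = Complex.exp (s * ℓ) * phase (-s) := by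
      rw [phase, ← Complex.exp_add]; congr 1; ring
    rw [this, psiP]
    ring
  · refine ((h0.2.const_mul (-(Complex.Gamma s)⁻¹)).congr (.of_forall fun ℓ => ?_)).of_eq
      (by rw [h.gamma_add_one]; field_simp)
    have : Complex.exp ((s + 1) * (ℓ - Real.pi / 2 * Complex.I)) =
        Complex.exp ((s + 1) * ℓ) * phase (-s) * -Complex.I := by
      rw [← Complex.exp_neg_pi_div_two_mul_I, phase, ← Complex.exp_add, ← Complex.exp_add]
      congr 1; ring
    rw [this, psiP']
    ring

/-- By `hat_psiP`, `psi0` is e^{-z²} times a function of iz with algebraic behaviour; the sector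
(-π/4, 5π/4) for arg(iz) is (-3π/4, 3π/4) for arg z. -/
theorem SO_psi0 {s : ℂ} (h : NotInt s) :
    SO (-3 * Real.pi / 4) (3 * Real.pi / 4)
      (fun ℓ => psi0 s (Complex.exp ℓ)) (fun ℓ => Complex.exp ((s - 1) * ℓ - sqX ℓ)) ∧
    SO (-3 * Real.pi / 4) (3 * Real.pi / 4)
      (fun ℓ => psi0' s (Complex.exp ℓ)) (fun ℓ => Complex.exp (s * ℓ - sqX ℓ)) := by
  have hu := cU_ne_zero h
  have hv := cV_ne_zero h
  have hE := phase_ne_zero s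
  have hpi : (Real.pi : ℂ) ≠ 0 := by exact_mod_cast Real.pi_ne_zero
  set r := -(Complex.I * sqrtPi * s * phase s / (Real.pi * cU s * cV s)) with hr
  have hr0 : r ≠ 0 := by
    simp [hr, hu, hv, hE, hpi, h.ne_zero, sqrtPi_ne_zero]
  have hp := near_psiP h.neg
  have shift : ∀ θ₁ θ₂ : ℝ, Tendsto (fun ℓ : ℂ => ℓ + Real.pi / 2 * Complex.I) (strip θ₁ θ₂)
      (strip (θ₁ + Real.pi / 2) (θ₂ + Real.pi / 2)) := fun θ₁ θ₂ => by
    simpa using tendsto_add_strip θ₁ θ₂ (Real.pi / 2)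
  have hsq : ∀ ℓ : ℂ, -(Complex.exp ℓ) ^ 2 = -sqX ℓ := fun ℓ => by
    rw [sqX, ← Complex.exp_nat_mul]; norm_num
  constructor
  · intro θ₁ θ₂ h1 h2
    have b := ((hp.2.bounded _ _ (show -Real.pi / 4 < θ₁ + Real.pi / 2 by linarith)
      (show θ₂ + Real.pi / 2 < 5 * Real.pi / 4 by linarith)).comp_tendsto (shift θ₁ θ₂)).const_mul_left
      (r⁻¹ * Complex.exp (-(-s + 1) * (Real.pi / 2 * Complex.I)))
    have b2 := b.mul (isBigO_refl (fun ℓ => Complex.exp ((s - 1) * ℓ - sqX ℓ)) _)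
    refine (b2.congr_left fun ℓ => ?_).trans (IsBigO.of_bound 1 (by simp))
    have e := (hat_psiP h (Complex.exp ℓ)).1
    rw [← hr, hat, hsq] at e
    have e' : psi0 s (Complex.exp ℓ) =
        r⁻¹ * (Complex.exp (-sqX ℓ) * psiP' (-s) (Complex.I * Complex.exp ℓ)) := by
      rw [e]; field_simp
    rw [e']
    simp only [Function.comp, exp_add_pi_div_two]
    have : Complex.exp (-sqX ℓ) = Complex.exp (-(-s + 1) * (Real.pi / 2 * Complex.I)) *
        Complex.exp ((-s + 1) * (ℓ + Real.pi / 2 * Complex.I)) *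
        Complex.exp ((s - 1) * ℓ - sqX ℓ) := by
      rw [← Complex.exp_add, ← Complex.exp_add]; congr 1; ring
    rw [this]
    ring
  · intro θ₁ θ₂ h1 h2
    have b := ((hp.1.bounded _ _ (show -Real.pi / 4 < θ₁ + Real.pi / 2 by linarith)
      (show θ₂ + Real.pi / 2 < 5 * Real.pi / 4 by linarith)).comp_tendsto (shift θ₁ θ₂)).const_mul_left
      (r⁻¹ * (-2 * Complex.I * (-s)) * Complex.exp (-(-s) * (Real.pi / 2 * Complex.I)))
    have b2 := b.mul (isBigO_refl (fun ℓ => Complex.exp (s * ℓ - sqX ℓ)) _)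
    refine (b2.congr_left fun ℓ => ?_).trans (IsBigO.of_bound 1 (by simp))
    have e := (hat_psiP h (Complex.exp ℓ)).2
    rw [← hr, hat', hsq] at e
    have e' : psi0' s (Complex.exp ℓ) = r⁻¹ * (-2 * Complex.I * (-s) *
        (Complex.exp (-sqX ℓ) * psiP (-s) (Complex.I * Complex.exp ℓ))) := by
      rw [e]; field_simp
    rw [e']
    simp only [Function.comp, exp_add_pi_div_two]
    have : Complex.exp (-sqX ℓ) = Complex.exp (-(-s) * (Real.pi / 2 * Complex.I)) *
        Complex.exp ((-s) * (ℓ + Real.pi / 2 * Complex.I)) *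
        Complex.exp (s * ℓ - sqX ℓ) := by
      rw [← Complex.exp_add, ← Complex.exp_add]; congr 1; ring
    rw [this]
    ring

end PainleveIV

end

noncomputable section

namespace PainleveIV

open Topology Set Asymptotics

/-! ### The first-order system in logarithmic coordinates -/

/-- The exponential `x^κ e^{-x²}` in the coordinate `ℓ = ln x`. -/
def logE (κ ℓ : ℂ) : ℂ := Complex.exp (κ * ℓ - sqX ℓ)

theorem logE_ne_zero (κ ℓ : ℂ) : logE κ ℓ ≠ 0 := Complex.exp_ne_zero _

theorem logE_add_two (κ ℓ : ℂ) : logE (κ + 2) ℓ = sqX ℓ * logE κ ℓ := by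
  rw [logE, logE, sqX, ← Complex.exp_add]; congr 1; ring

theorem hasDerivAt_logE (κ ℓ : ℂ) : HasDerivAt (logE κ) ((κ - 2 * sqX ℓ) * logE κ ℓ) ℓ := by
  refine ((((hasDerivAt_id ℓ).const_mul κ).sub (hasDerivAt_sqX ℓ)).cexp).congr_deriv ?_
  simp [logE]
  ring

/-- A solution of the first-order system in the coordinate `ℓ` with algebraic behaviour. -/
structure Loc (Y P : ℂ) (φ₁ φ₂ : ℝ) (a b : ℂ → ℂ) : Prop where
  ode_a : Ev φ₁ φ₂ fun ℓ =>
    HasDerivAt a (a ℓ * (1 + 2 * b ℓ + a ℓ + 2 * sqX ℓ) - Y * sqX ℓ) ℓ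
  ode_b : Ev φ₁ φ₂ fun ℓ =>
    HasDerivAt b (b ℓ * (1 - 2 * sqX ℓ - 2 * a ℓ - b ℓ) - P * sqX ℓ) ℓ
  near_a : Near φ₁ φ₂ a (Y / 2)
  near_b : Near φ₁ φ₂ b (-P / 2)

/-- The difference of two solutions is exponentially small with the multiplier `μ`. -/
structure LDiff (κ μ : ℂ) (φ₁ φ₂ : ℝ) (a b a₀ b₀ : ℂ → ℂ) : Prop where
  near_b : Near φ₁ φ₂ (fun ℓ => (b ℓ - b₀ ℓ) / logE κ ℓ) μ
  near_a : Near φ₁ φ₂ (fun ℓ => (a ℓ - a₀ ℓ) / logE κ ℓ) 0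

variable {Y P : ℂ} {φ₁ φ₂ : ℝ} {a b a' b' a₀ b₀ a₀' b₀' : ℂ → ℂ} {κ μ : ℂ}

namespace Loc

theorem b_ne_zero (h : Loc Y P φ₁ φ₂ a b) (hP : P ≠ 0) : Ev φ₁ φ₂ fun ℓ => b ℓ ≠ 0 :=
  h.near_b.ne_zero (by simpa using hP)

/-- The logarithmic derivative of `b` is `O(x⁻²)`. -/
theorem near_logDeriv (h : Loc Y P φ₁ φ₂ a b) (hP : P ≠ 0) :
    Near φ₁ φ₂ (fun ℓ => 1 - 2 * sqX ℓ - 2 * a ℓ - b ℓ - P * sqX ℓ / b ℓ) 0 := by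
  have h1 := (h.near_b.deriv h.ode_b).div h.near_b (by simpa using hP)
  refine (h1.congr ((h.b_ne_zero hP).mono fun ℓ hb => ?_)).of_eq (zero_div _)
  field_simp

theorem near_den_even (h : Loc Y P φ₁ φ₂ a b) (hP : P ≠ 0) :
    Near φ₁ φ₂ (fun ℓ => (a ℓ + P * sqX ℓ / b ℓ) / sqX ℓ) (-2) := by
  have h1 := (Near.div_sqX h.near_a.bounded).add ((h.near_b.inv (by simpa using hP)).const_mul P)
  refine (h1.congr ((h.b_ne_zero hP).mono fun ℓ hb => ?_)).of_eq (by field_simp; norm_num)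
  have := sqX_ne_zero ℓ
  field_simp

/-- With X = e^{2ℓ}, the new b is a difference of terms of size X. The estimate b'/b = O(X⁻¹) of
`near_logDeriv` reads -2X - (a + PX/b) = a + b - 1 + O(X⁻¹), so the large terms cancel without a
second-order expansion. -/
theorem step_even (h : Loc Y P φ₁ φ₂ a b) (hP : P ≠ 0)
    (ha : Ev φ₁ φ₂ fun ℓ => a' ℓ = b ℓ - (Y + P) * sqX ℓ / (a ℓ + P * sqX ℓ / b ℓ))
    (hb : Ev φ₁ φ₂ fun ℓ => b' ℓ = -2 * sqX ℓ - a' ℓ - (a ℓ + P * sqX ℓ / b ℓ)) :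
    Near φ₁ φ₂ a' (Y / 2) ∧ Near φ₁ φ₂ b' (-(P + 2) / 2) := by
  have hd := h.near_den_even hP
  have h1 : Near φ₁ φ₂ a' (Y / 2) := by
    have := h.near_b.sub ((hd.inv (by norm_num)).const_mul (Y + P))
    refine (this.congr (ha.mono fun ℓ e => ?_)).of_eq (by ring)
    rw [e, inv_div]
    ring
  refine ⟨h1, ?_⟩
  have h2 := (((h.near_a.add h.near_b).sub (Near.const 1)).add (h.near_logDeriv hP)).sub h1
  refine (h2.congr (hb.mono fun ℓ e => ?_)).of_eq (by ring)
  rw [e]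
  ring

theorem near_a_odd (h : Loc Y P φ₁ φ₂ a b) (hP : P ≠ 0)
    (ha : Ev φ₁ φ₂ fun ℓ => a' ℓ = -2 * sqX ℓ - a ℓ - b ℓ - P * sqX ℓ / b ℓ) :
    Near φ₁ φ₂ a' ((Y - 2) / 2) := by
  have h2 := (h.near_a.sub (Near.const 1)).add (h.near_logDeriv hP)
  refine (h2.congr (ha.mono fun ℓ e => ?_)).of_eq (by ring)
  rw [e]
  ring

/-- As the new a tends to (Y - 2)/2 ≠ 0, the term (2 - Y)X/a cancels -2X up to a bounded remainder.
The new b is then bounded, and so is its derivative; dividing its own equation by X gives the limit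
-(P + 2)/2. -/
theorem step_odd (h : Loc Y P φ₁ φ₂ a b) (hP : P ≠ 0) (hY : Y ≠ 2)
    (ha : Ev φ₁ φ₂ fun ℓ => a' ℓ = -2 * sqX ℓ - a ℓ - b ℓ - P * sqX ℓ / b ℓ)
    (hb : Ev φ₁ φ₂ fun ℓ => b' ℓ = -2 * sqX ℓ - a' ℓ - (b ℓ + (2 - Y) * sqX ℓ / a' ℓ))
    (hode : Ev φ₁ φ₂ fun ℓ =>
      HasDerivAt b' (b' ℓ * (1 - 2 * sqX ℓ - 2 * a' ℓ - b' ℓ) - (P + 2) * sqX ℓ) ℓ) :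
    Near φ₁ φ₂ a' ((Y - 2) / 2) ∧ Near φ₁ φ₂ b' (-(P + 2) / 2) := by
  have h1 := h.near_a_odd hP ha
  have hY2 : (Y - 2) / 2 ≠ 0 := div_ne_zero (sub_ne_zero.2 hY) two_ne_zero
  refine ⟨h1, ?_⟩
  have hbd : SO φ₁ φ₂ b' fun _ => 1 := by
    have e1 : SO φ₁ φ₂ (fun ℓ => (a' ℓ - (Y - 2) / 2) * sqX ℓ) fun _ => 1 :=
      (SO.mul h1 (SO.refl sqX)).congr_right fun ℓ => inv_mul_cancel₀ (sqX_ne_zero ℓ)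
    have e2 := ((e1.mul (h1.inv_bounded hY2)).congr_right fun ℓ => mul_one _).const_mul (-2)
    have e3 := (e2.sub h1.bounded).sub h.near_b.bounded
    refine e3.congr ((hb.and (h1.ne_zero hY2)).mono fun ℓ e => ?_)
    rw [e.1]
    have := e.2
    field_simp
    ring
  have hd := hbd.deriv_one hode
  have e1 := ((((SO.const 1).sub (h1.bounded.const_mul 2)).sub hbd).mul hbd).congr_right
    fun _ => mul_one _
  have e2 := ((e1.sub hd).const_mul (1 / 2)).mul (SO.refl fun ℓ => (sqX ℓ)⁻¹)
  refine ((e2.congr_right fun _ => one_mul _).congr_left fun ℓ => ?_)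
  have := sqX_ne_zero ℓ
  field_simp
  ring

end Loc

namespace LDiff

/-- Linearisation at b = -P/2: PX/b changes by -(4μ/P)XE, which dominates the change of the
denominator. Since the denominator is about -2X, the new a changes by an order X less, and the new b
inherits the opposite of the change of the denominator. -/
theorem step_even (hd : LDiff κ μ φ₁ φ₂ a b a₀ b₀) (h : Loc Y P φ₁ φ₂ a b)
    (h₀ : Loc Y P φ₁ φ₂ a₀ b₀) (hP : P ≠ 0)
    (ha : Ev φ₁ φ₂ fun ℓ => a' ℓ = b ℓ - (Y + P) * sqX ℓ / (a ℓ + P * sqX ℓ / b ℓ))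
    (hb : Ev φ₁ φ₂ fun ℓ => b' ℓ = -2 * sqX ℓ - a' ℓ - (a ℓ + P * sqX ℓ / b ℓ))
    (ha₀ : Ev φ₁ φ₂ fun ℓ => a₀' ℓ = b₀ ℓ - (Y + P) * sqX ℓ / (a₀ ℓ + P * sqX ℓ / b₀ ℓ))
    (hb₀ : Ev φ₁ φ₂ fun ℓ => b₀' ℓ = -2 * sqX ℓ - a₀' ℓ - (a₀ ℓ + P * sqX ℓ / b₀ ℓ)) :
    LDiff (κ + 2) (4 * μ / P) φ₁ φ₂ a' b' a₀' b₀' := by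
  have hP2 : -P / 2 ≠ 0 := by simpa using hP
  have hc : Near φ₁ φ₂ (fun ℓ => ((a ℓ + P * sqX ℓ / b ℓ) - (a₀ ℓ + P * sqX ℓ / b₀ ℓ))
      / logE (κ + 2) ℓ) (-(4 * μ / P)) := by
    have h1 := (Near.div_sqX hd.near_a.bounded).sub ((hd.near_b.mul
      ((h.near_b.inv hP2).mul (h₀.near_b.inv hP2))).const_mul P)
    refine (h1.congr (((h.b_ne_zero hP).and (h₀.b_ne_zero hP)).mono fun ℓ e => ?_)).of_eq
      (by field_simp; norm_num)
    rw [logE_add_two]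
    have := sqX_ne_zero ℓ
    have := logE_ne_zero κ ℓ
    have := e.1
    have := e.2
    field_simp
    ring
  have hda := h.near_den_even hP
  have hda₀ := h₀.near_den_even hP
  have hA : Near φ₁ φ₂ (fun ℓ => (a' ℓ - a₀' ℓ) / logE (κ + 2) ℓ) 0 := by
    have h2 := Near.div_sqX (hd.near_b.add ((hc.mul ((hda.inv (by norm_num)).mul
      (hda₀.inv (by norm_num)))).const_mul (Y + P))).bounded
    refine h2.congr ((((ha.and ha₀).and (hda.ne_zero (by norm_num))).and
      (hda₀.ne_zero (by norm_num))).mono fun ℓ e => ?_)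
    obtain ⟨⟨⟨e1, e2⟩, e3⟩, e4⟩ := e
    rw [e1, e2, logE_add_two]
    have := sqX_ne_zero ℓ
    have := logE_ne_zero κ ℓ
    generalize a ℓ + P * sqX ℓ / b ℓ = d at *
    generalize a₀ ℓ + P * sqX ℓ / b₀ ℓ = d₀ at *
    have e3' : d ≠ 0 := fun e => e3 (by simp [e])
    have e4' : d₀ ≠ 0 := fun e => e4 (by simp [e])
    field_simp
    ring
  refine ⟨?_, hA⟩
  have h3 := (hA.add hc).neg
  refine (h3.congr ((hb.and hb₀).mono fun ℓ e => ?_)).of_eq (by ring)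
  rw [e.1, e.2]
  ring

/-- Two reciprocals in succession: the new a changes by (4μ/P)XE, and (2 - Y)X/a, linearised at a =
(Y - 2)/2, turns this into -(16μ/((2 - Y)P))X²E. -/
theorem step_odd (hd : LDiff κ μ φ₁ φ₂ a b a₀ b₀) (h : Loc Y P φ₁ φ₂ a b)
    (h₀ : Loc Y P φ₁ φ₂ a₀ b₀) (hP : P ≠ 0) (hY : Y ≠ 2)
    (ha : Ev φ₁ φ₂ fun ℓ => a' ℓ = -2 * sqX ℓ - a ℓ - b ℓ - P * sqX ℓ / b ℓ)
    (hb : Ev φ₁ φ₂ fun ℓ => b' ℓ = -2 * sqX ℓ - a' ℓ - (b ℓ + (2 - Y) * sqX ℓ / a' ℓ))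
    (ha₀ : Ev φ₁ φ₂ fun ℓ => a₀' ℓ = -2 * sqX ℓ - a₀ ℓ - b₀ ℓ - P * sqX ℓ / b₀ ℓ)
    (hb₀ : Ev φ₁ φ₂ fun ℓ => b₀' ℓ = -2 * sqX ℓ - a₀' ℓ - (b₀ ℓ + (2 - Y) * sqX ℓ / a₀' ℓ)) :
    LDiff (κ + 4) (16 * μ / ((2 - Y) * P)) φ₁ φ₂ a' b' a₀' b₀' := by
  have hP2 : -P / 2 ≠ 0 := by simpa using hP
  have hY2 : (Y - 2) / 2 ≠ 0 := div_ne_zero (sub_ne_zero.2 hY) two_ne_zero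
  have hE : ∀ ℓ, logE (κ + 4) ℓ = sqX ℓ * (sqX ℓ * logE κ ℓ) := fun ℓ => by
    rw [← logE_add_two, ← logE_add_two]; congr 1; ring
  have hA1 : Near φ₁ φ₂ (fun ℓ => (a' ℓ - a₀' ℓ) / (sqX ℓ * logE κ ℓ)) (4 * μ / P) := by
    have h1 := ((hd.near_b.mul
      ((h.near_b.inv hP2).mul (h₀.near_b.inv hP2))).const_mul P).sub
      (Near.div_sqX (hd.near_a.add hd.near_b).bounded)
    refine (h1.congr ((((h.b_ne_zero hP).and (h₀.b_ne_zero hP)).and (ha.and ha₀)).mono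
      fun ℓ e => ?_)).of_eq (by field_simp; norm_num)
    obtain ⟨⟨e1, e2⟩, e3, e4⟩ := e
    rw [e3, e4]
    have := sqX_ne_zero ℓ
    have := logE_ne_zero κ ℓ
    field_simp
    ring
  have na := h.near_a_odd hP ha
  have na₀ := h₀.near_a_odd hP ha₀
  have hA : Near φ₁ φ₂ (fun ℓ => (a' ℓ - a₀' ℓ) / logE (κ + 4) ℓ) 0 := by
    refine (Near.div_sqX hA1.bounded).congr (.of_forall fun ℓ => ?_)
    rw [hE, div_div, mul_comm (sqX ℓ) (sqX ℓ * _)]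
  have hc : Near φ₁ φ₂ (fun ℓ => ((b ℓ + (2 - Y) * sqX ℓ / a' ℓ) -
      (b₀ ℓ + (2 - Y) * sqX ℓ / a₀' ℓ)) / logE (κ + 4) ℓ) (-(16 * μ / ((2 - Y) * P))) := by
    have h1 := (Near.div_sqX (Near.div_sqX hd.near_b.bounded).bounded).sub
      ((hA1.mul ((na.inv hY2).mul (na₀.inv hY2))).const_mul (2 - Y))
    refine (h1.congr (((na.ne_zero hY2).and (na₀.ne_zero hY2)).mono fun ℓ e => ?_)).of_eq ?_
    · obtain ⟨e1, e2⟩ := e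
      rw [hE]
      have := sqX_ne_zero ℓ
      have := logE_ne_zero κ ℓ
      field_simp
      ring
    · have h1 : Y - 2 ≠ 0 := sub_ne_zero.2 hY
      have h2 : 2 - Y ≠ 0 := sub_ne_zero.2 hY.symm
      field_simp
      ring
  refine ⟨?_, hA⟩
  have h3 := (hA.add hc).neg
  refine (h3.congr ((hb.and hb₀).mono fun ℓ e => ?_)).of_eq (by ring)
  rw [e.1, e.2]
  ring

/-- The leading term of the exponentially small part of `a`. -/
theorem near_mul_a (hd : LDiff κ μ φ₁ φ₂ a b a₀ b₀) (h : Loc Y P φ₁ φ₂ a b)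
    (h₀ : Loc Y P φ₁ φ₂ a₀ b₀) :
    Near φ₁ φ₂ (fun ℓ => sqX ℓ * ((a ℓ - a₀ ℓ) / logE κ ℓ)) (-(Y * μ / 4)) := by
  have hder : Ev φ₁ φ₂ fun ℓ => HasDerivAt (fun ℓ => (a ℓ - a₀ ℓ) / logE κ ℓ)
      (((a ℓ - a₀ ℓ) / logE κ ℓ) * (1 + 2 * b ℓ + a ℓ + a₀ ℓ - κ) +
        2 * a₀ ℓ * ((b ℓ - b₀ ℓ) / logE κ ℓ) + 4 * sqX ℓ * ((a ℓ - a₀ ℓ) / logE κ ℓ)) ℓ := by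
    refine (h.ode_a.and h₀.ode_a).mono fun ℓ e => ?_
    have hE := logE_ne_zero κ ℓ
    refine ((e.1.sub e.2).div (hasDerivAt_logE κ ℓ) hE).congr_deriv ?_
    simp only [Pi.sub_apply]
    field_simp
    ring
  -- The quotient is O(X⁻¹), hence so is its derivative. In its equation the term 4X times the
  -- quotient, half of which comes from dividing by E, must therefore balance 2a₀ times the quotient
  -- for b, whose limit is Yμ.
  have n1 := hd.near_a.deriv hder
  have n2 := hd.near_a.mul (((((Near.const 1).add (h.near_b.const_mul 2)).add h.near_a).add
    h₀.near_a).sub (Near.const κ))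
  have n3 := ((h₀.near_a.const_mul 2).mul hd.near_b)
  have n4 := ((n1.sub n2).sub n3).const_mul (1 / 4)
  refine (n4.congr (.of_forall fun ℓ => ?_)).of_eq (by ring)
  ring

end LDiff

end PainleveIV

end

noncomputable section

namespace PainleveIV

open Topology Set Asymptotics

variable {φ₁ φ₂ : ℝ}

/-! ### Second differences -/

theorem SO.one_pow (k : ℕ) : SO φ₁ φ₂ (fun _ => 1) fun ℓ => sqX ℓ ^ k := by
  induction k with
  | zero => simpa using SO.const 1
  | succ k ih =>
    have h1 : SO φ₁ φ₂ (fun _ => 1) sqX :=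
      (((SO.sqX_inv).mul (SO.refl sqX)).congr_left fun ℓ => inv_mul_cancel₀
        (sqX_ne_zero ℓ)).congr_right fun ℓ => one_mul _
    exact ((ih.mul h1).congr_left fun _ => one_mul _).congr_right fun ℓ => (pow_succ _ _).symm

theorem SO.pow_mono {N M : ℕ} (h : N ≤ M) :
    SO φ₁ φ₂ (fun ℓ => sqX ℓ ^ N) fun ℓ => sqX ℓ ^ M := by
  obtain ⟨k, rfl⟩ := Nat.exists_eq_add_of_le h
  exact (((SO.refl fun ℓ => sqX ℓ ^ N).mul (SO.one_pow k)).congr_left fun _ => mul_one _).congr_right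
    fun ℓ => (pow_add _ _ _).symm

/-- Three functions whose first differences are `O(E x^{2N})` and whose second difference is
`O(E² x^{2N})`. -/
structure Jet (E : ℂ → ℂ) (φ₁ φ₂ : ℝ) (N : ℕ) (f₁ f₂ g : ℂ → ℂ) : Prop where
  left : SO φ₁ φ₂ (fun ℓ => f₁ ℓ - g ℓ) fun ℓ => E ℓ * sqX ℓ ^ N
  right : SO φ₁ φ₂ (fun ℓ => f₂ ℓ - g ℓ) fun ℓ => E ℓ * sqX ℓ ^ N
  second : SO φ₁ φ₂ (fun ℓ => f₁ ℓ + f₂ ℓ - 2 * g ℓ) fun ℓ => E ℓ ^ 2 * sqX ℓ ^ N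
  size : SO φ₁ φ₂ g fun ℓ => sqX ℓ ^ N

/-- `Jet` for some exponent. -/
def HasJet (E : ℂ → ℂ) (φ₁ φ₂ : ℝ) (f₁ f₂ g : ℂ → ℂ) : Prop := ∃ N, Jet E φ₁ φ₂ N f₁ f₂ g

variable {E f₁ f₂ g h₁ h₂ k : ℂ → ℂ}

theorem Jet.mono {N M : ℕ} (h : Jet E φ₁ φ₂ N f₁ f₂ g) (hNM : N ≤ M) : Jet E φ₁ φ₂ M f₁ f₂ g :=
  ⟨h.left.trans ((SO.refl E).mul (SO.pow_mono hNM)), h.right.trans ((SO.refl E).mul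
    (SO.pow_mono hNM)), h.second.trans ((SO.refl _).mul (SO.pow_mono hNM)),
    h.size.trans (SO.pow_mono hNM)⟩

namespace HasJet

theorem common (h : HasJet E φ₁ φ₂ f₁ f₂ g) (h' : HasJet E φ₁ φ₂ h₁ h₂ k) :
    ∃ N, Jet E φ₁ φ₂ N f₁ f₂ g ∧ Jet E φ₁ φ₂ N h₁ h₂ k := by
  obtain ⟨N, h⟩ := h
  obtain ⟨M, h'⟩ := h'
  exact ⟨max N M, h.mono (le_max_left _ _), h'.mono (le_max_right _ _)⟩

theorem congr (h : HasJet E φ₁ φ₂ f₁ f₂ g) (e₁ : Ev φ₁ φ₂ fun ℓ => f₁ ℓ = h₁ ℓ)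
    (e₂ : Ev φ₁ φ₂ fun ℓ => f₂ ℓ = h₂ ℓ) (e₃ : Ev φ₁ φ₂ fun ℓ => g ℓ = k ℓ) :
    HasJet E φ₁ φ₂ h₁ h₂ k := by
  obtain ⟨N, h⟩ := h
  exact ⟨N, h.left.congr ((e₁.and e₃).mono fun ℓ e => by rw [e.1, e.2]),
    h.right.congr ((e₂.and e₃).mono fun ℓ e => by rw [e.1, e.2]),
    h.second.congr ((e₁.and (e₂.and e₃)).mono fun ℓ e => by rw [e.1, e.2.1, e.2.2]),
    h.size.congr e₃⟩

theorem of_size {N : ℕ} (h : SO φ₁ φ₂ f₁ fun ℓ => sqX ℓ ^ N) : HasJet E φ₁ φ₂ f₁ f₁ f₁ := by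
  have zero : ∀ G : ℂ → ℂ, SO φ₁ φ₂ (fun _ => 0) G := fun G _ _ _ _ => isBigO_zero _ _
  exact ⟨N, (zero _).congr_left fun ℓ => by ring, (zero _).congr_left fun ℓ => by ring,
    (zero _).congr_left fun ℓ => by ring, h⟩

theorem const (c : ℂ) : HasJet E φ₁ φ₂ (fun _ => c) (fun _ => c) fun _ => c :=
  of_size (N := 0) (by simpa using SO.const c)

theorem sqX : HasJet E φ₁ φ₂ sqX sqX sqX :=
  of_size (N := 1) (by simpa using SO.refl PainleveIV.sqX)

theorem add (h : HasJet E φ₁ φ₂ f₁ f₂ g) (h' : HasJet E φ₁ φ₂ h₁ h₂ k) :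
    HasJet E φ₁ φ₂ (fun ℓ => f₁ ℓ + h₁ ℓ) (fun ℓ => f₂ ℓ + h₂ ℓ) fun ℓ => g ℓ + k ℓ := by
  obtain ⟨N, h, h'⟩ := h.common h'
  exact ⟨N, (h.left.add h'.left).congr_left fun ℓ => by ring,
    (h.right.add h'.right).congr_left fun ℓ => by ring,
    (h.second.add h'.second).congr_left fun ℓ => by ring, h.size.add h'.size⟩

/-- Discrete Leibniz rule: the second difference of a product consists of each second difference
times the other base function, plus two products of first differences. Boundedness of E absorbs the
quadratic term in the first differences. -/
theorem mul (hE : SO φ₁ φ₂ E fun _ => 1) (h : HasJet E φ₁ φ₂ f₁ f₂ g)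
    (h' : HasJet E φ₁ φ₂ h₁ h₂ k) :
    HasJet E φ₁ φ₂ (fun ℓ => f₁ ℓ * h₁ ℓ) (fun ℓ => f₂ ℓ * h₂ ℓ) fun ℓ => g ℓ * k ℓ := by
  obtain ⟨N, h, h'⟩ := h.common h'
  have key : ∀ {u v : ℂ → ℂ}, SO φ₁ φ₂ (fun ℓ => u ℓ - g ℓ) (fun ℓ => E ℓ * PainleveIV.sqX ℓ ^ N) →
      SO φ₁ φ₂ (fun ℓ => v ℓ - k ℓ) (fun ℓ => E ℓ * PainleveIV.sqX ℓ ^ N) →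
      SO φ₁ φ₂ (fun ℓ => u ℓ * v ℓ - g ℓ * k ℓ) fun ℓ => E ℓ * PainleveIV.sqX ℓ ^ (N + N) := by
    intro u v hu hv
    have t1 := (hu.mul h'.size).congr_right (h := fun ℓ => E ℓ * PainleveIV.sqX ℓ ^ (N + N))
      fun ℓ => by ring
    have t2 := (h.size.mul hv).congr_right (h := fun ℓ => E ℓ * PainleveIV.sqX ℓ ^ (N + N))
      fun ℓ => by ring
    have t3 : SO φ₁ φ₂ (fun ℓ => (u ℓ - g ℓ) * (v ℓ - k ℓ))
        fun ℓ => E ℓ * PainleveIV.sqX ℓ ^ (N + N) := by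
      refine (hu.mul hv).trans ?_
      exact ((hE.mul (SO.refl fun ℓ => E ℓ * PainleveIV.sqX ℓ ^ (N + N))).congr_left
        fun ℓ => by ring).congr_right fun ℓ => one_mul _
    exact ((t1.add t2).add t3).congr_left fun ℓ => by ring
  refine ⟨N + N, key h.left h'.left, key h.right h'.right, ?_, ?_⟩
  · have t1 := (h.second.mul h'.size).congr_right
      (h := fun ℓ => E ℓ ^ 2 * PainleveIV.sqX ℓ ^ (N + N)) fun ℓ => by ring
    have t2 := (h.size.mul h'.second).congr_right
      (h := fun ℓ => E ℓ ^ 2 * PainleveIV.sqX ℓ ^ (N + N)) fun ℓ => by ring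
    have t3 := (h.left.mul h'.left).congr_right
      (h := fun ℓ => E ℓ ^ 2 * PainleveIV.sqX ℓ ^ (N + N)) fun ℓ => by ring
    have t4 := (h.right.mul h'.right).congr_right
      (h := fun ℓ => E ℓ ^ 2 * PainleveIV.sqX ℓ ^ (N + N)) fun ℓ => by ring
    exact (((t1.add t2).add t3).add t4).congr_left fun ℓ => by ring
  · exact (h.size.mul h'.size).congr_right fun ℓ => (pow_add _ _ _).symm

theorem const_mul (hE : SO φ₁ φ₂ E fun _ => 1) (c : ℂ) (h : HasJet E φ₁ φ₂ f₁ f₂ g) :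
    HasJet E φ₁ φ₂ (fun ℓ => c * f₁ ℓ) (fun ℓ => c * f₂ ℓ) fun ℓ => c * g ℓ :=
  mul hE (const c) h

/-- The identity used is 1/f₁ + 1/f₂ - 2/g = -(f₁ + f₂ - 2g)/(f₁f₂) - 2(f₁ - g)(f₂ - g)/(f₁f₂g). -/
theorem inv (h : HasJet E φ₁ φ₂ f₁ f₂ g) (n : Ev φ₁ φ₂ fun ℓ => f₁ ℓ ≠ 0 ∧ f₂ ℓ ≠ 0 ∧ g ℓ ≠ 0)
    (i₁ : SO φ₁ φ₂ (fun ℓ => (f₁ ℓ)⁻¹) fun _ => 1) (i₂ : SO φ₁ φ₂ (fun ℓ => (f₂ ℓ)⁻¹) fun _ => 1)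
    (i₃ : SO φ₁ φ₂ (fun ℓ => (g ℓ)⁻¹) fun _ => 1) :
    HasJet E φ₁ φ₂ (fun ℓ => (f₁ ℓ)⁻¹) (fun ℓ => (f₂ ℓ)⁻¹) fun ℓ => (g ℓ)⁻¹ := by
  obtain ⟨N, h⟩ := h
  have hN : N ≤ N + N := Nat.le_add_left N N
  have h2 := h.mono hN
  refine ⟨N + N, ?_, ?_, ?_, i₃.trans (SO.one_pow _)⟩
  · refine (((h2.left.mul i₁).mul i₃).neg.congr (n.mono fun ℓ e => ?_)).congr_right fun ℓ => by ring
    obtain ⟨e1, e2, e3⟩ := e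
    field_simp
    ring
  · refine (((h2.right.mul i₂).mul i₃).neg.congr (n.mono fun ℓ e => ?_)).congr_right
      fun ℓ => by ring
    obtain ⟨e1, e2, e3⟩ := e
    field_simp
    ring
  · have t1 := ((h2.second.mul i₁).mul i₂).congr_right
      (h := fun ℓ => E ℓ ^ 2 * PainleveIV.sqX ℓ ^ (N + N)) fun ℓ => by ring
    have t2 := ((((h.left.mul h.right).mul i₁).mul i₂).mul i₃).congr_right
      (h := fun ℓ => E ℓ ^ 2 * PainleveIV.sqX ℓ ^ (N + N)) fun ℓ => by ring
    refine (t1.neg.sub (t2.const_mul 2)).congr (n.mono fun ℓ e => ?_)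
    obtain ⟨e1, e2, e3⟩ := e
    field_simp
    ring

theorem inv_of_near {c₁ c₂ c₃ : ℂ} (h : HasJet E φ₁ φ₂ f₁ f₂ g) (n₁ : Near φ₁ φ₂ f₁ c₁)
    (n₂ : Near φ₁ φ₂ f₂ c₂) (n₃ : Near φ₁ φ₂ g c₃) (z₁ : c₁ ≠ 0) (z₂ : c₂ ≠ 0) (z₃ : c₃ ≠ 0) :
    HasJet E φ₁ φ₂ (fun ℓ => (f₁ ℓ)⁻¹) (fun ℓ => (f₂ ℓ)⁻¹) fun ℓ => (g ℓ)⁻¹ :=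
  h.inv ((n₁.ne_zero z₁).and ((n₂.ne_zero z₂).and (n₃.ne_zero z₃))) (n₁.inv_bounded z₁)
    (n₂.inv_bounded z₂) (n₃.inv_bounded z₃)

theorem sqX_inv : HasJet E φ₁ φ₂ (fun ℓ => (PainleveIV.sqX ℓ)⁻¹)
    (fun ℓ => (PainleveIV.sqX ℓ)⁻¹) fun ℓ => (PainleveIV.sqX ℓ)⁻¹ :=
  of_size (N := 0) (by simpa using SO.sqX_inv)

end HasJet

/-- The second difference of `b`, relative to the square of the exponential, is governed by the
differential equation; this removes the loss of powers in a crude bound. -/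
theorem second_difference {Y P κ μ : ℂ} {a b a₁ b₁ a₂ b₂ : ℂ → ℂ} (h : Loc Y P φ₁ φ₂ a b)
    (l₁ : Loc Y P φ₁ φ₂ a₁ b₁) (l₂ : Loc Y P φ₁ φ₂ a₂ b₂) (d₁ : LDiff κ μ φ₁ φ₂ a₁ b₁ a b)
    (d₂ : LDiff κ (-μ) φ₁ φ₂ a₂ b₂ a b) {N : ℕ}
    (ca : SO φ₁ φ₂ (fun ℓ => (a₁ ℓ + a₂ ℓ - 2 * a ℓ) / logE κ ℓ ^ 2) fun ℓ => sqX ℓ ^ N)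
    (cb : SO φ₁ φ₂ (fun ℓ => (b₁ ℓ + b₂ ℓ - 2 * b ℓ) / logE κ ℓ ^ 2) fun ℓ => sqX ℓ ^ N) :
    SO φ₁ φ₂ (fun ℓ => (a₁ ℓ + a₂ ℓ - 2 * a ℓ) / logE κ ℓ ^ 2) (fun ℓ => (sqX ℓ)⁻¹ ^ 3) ∧
    SO φ₁ φ₂ (fun ℓ => (b₁ ℓ + b₂ ℓ - 2 * b ℓ) / logE κ ℓ ^ 2) (fun ℓ => (sqX ℓ)⁻¹) := by
  set ga : ℂ → ℂ := fun ℓ => (a₁ ℓ + a₂ ℓ - 2 * a ℓ) / logE κ ℓ ^ 2 with hga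
  set gb : ℂ → ℂ := fun ℓ => (b₁ ℓ + b₂ ℓ - 2 * b ℓ) / logE κ ℓ ^ 2 with hgb
  set u₁ : ℂ → ℂ := fun ℓ => (b₁ ℓ - b ℓ) / logE κ ℓ with hu₁
  set u₂ : ℂ → ℂ := fun ℓ => (b₂ ℓ - b ℓ) / logE κ ℓ with hu₂
  set w₁ : ℂ → ℂ := fun ℓ => (a₁ ℓ - a ℓ) / logE κ ℓ with hw₁
  set w₂ : ℂ → ℂ := fun ℓ => (a₂ ℓ - a ℓ) / logE κ ℓ with hw₂
  set S : ℂ → ℂ := fun ℓ => u₁ ℓ * (2 * w₁ ℓ + u₁ ℓ) + u₂ ℓ * (2 * w₂ ℓ + u₂ ℓ) with hS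
  set T : ℂ → ℂ := fun ℓ => w₁ ℓ * (2 * u₁ ℓ + w₁ ℓ) + w₂ ℓ * (2 * u₂ ℓ + w₂ ℓ) with hT
  -- Division by E² adds 4X to the linear coefficients 2X and -2X of the two equations. The results
  -- 6X and 2X are nonzero, so X·ga and X·gb can be solved for.
  set ga' : ℂ → ℂ := fun ℓ => ga ℓ * (1 + 2 * b ℓ + 2 * a ℓ - 2 * κ) + 2 * a ℓ * gb ℓ + T ℓ
    + 6 * (sqX ℓ * ga ℓ) with hga'
  set gb' : ℂ → ℂ := fun ℓ => gb ℓ * (1 - 2 * a ℓ - 2 * b ℓ - 2 * κ) - 2 * b ℓ * ga ℓ - S ℓ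
    + 2 * (sqX ℓ * gb ℓ) with hgb'
  have hE2 : ∀ ℓ, HasDerivAt (fun ℓ => logE κ ℓ ^ 2)
      (2 * (κ - 2 * sqX ℓ) * logE κ ℓ ^ 2) ℓ := fun ℓ =>
    ((hasDerivAt_logE κ ℓ).pow 2).congr_deriv (by ring)
  have da : Ev φ₁ φ₂ fun ℓ => HasDerivAt ga (ga' ℓ) ℓ := by
    refine ((h.ode_a.and l₁.ode_a).and l₂.ode_a).mono fun ℓ e => ?_
    have hE := logE_ne_zero κ ℓ
    refine (((e.1.2.add e.2).sub (e.1.1.const_mul 2)).div (hE2 ℓ) (pow_ne_zero 2 hE)).congr_deriv ?_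
    simp only [hga', hga, hgb, hT, hu₁, hu₂, hw₁, hw₂, Pi.sub_apply, Pi.add_apply]
    field_simp
    ring
  have db : Ev φ₁ φ₂ fun ℓ => HasDerivAt gb (gb' ℓ) ℓ := by
    refine ((h.ode_b.and l₁.ode_b).and l₂.ode_b).mono fun ℓ e => ?_
    have hE := logE_ne_zero κ ℓ
    refine (((e.1.2.add e.2).sub (e.1.1.const_mul 2)).div (hE2 ℓ) (pow_ne_zero 2 hE)).congr_deriv ?_
    simp only [hgb', hga, hgb, hS, hu₁, hu₂, hw₁, hw₂, Pi.sub_apply, Pi.add_apply]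
    field_simp
    ring
  have nS : Near φ₁ φ₂ S (2 * μ ^ 2) :=
    ((d₁.near_b.mul ((d₁.near_a.const_mul 2).add d₁.near_b)).add
      (d₂.near_b.mul ((d₂.near_a.const_mul 2).add d₂.near_b))).of_eq (by ring)
  have nXT : Near φ₁ φ₂ (fun ℓ => sqX ℓ * T ℓ) (-(Y * μ ^ 2)) := by
    have m₁ := (d₁.near_mul_a l₁ h).mul ((d₁.near_b.const_mul 2).add d₁.near_a)
    have m₂ := (d₂.near_mul_a l₂ h).mul ((d₂.near_b.const_mul 2).add d₂.near_a)
    refine ((m₁.add m₂).congr (.of_forall fun ℓ => ?_)).of_eq (by ring)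
    simp only [hT, hw₁, hw₂, hu₁, hu₂]
    ring
  have nT : Near φ₁ φ₂ T 0 :=
    (nXT.mul Near.sqX_inv).congr (.of_forall fun ℓ => by
      have := sqX_ne_zero ℓ
      field_simp) |>.of_eq (by ring)
  have ba : SO φ₁ φ₂ (fun ℓ => 1 + 2 * b ℓ + 2 * a ℓ - 2 * κ) fun _ => 1 :=
    ((((Near.const 1).add (h.near_b.const_mul 2)).add (h.near_a.const_mul 2)).sub
      (Near.const (2 * κ))).bounded
  have bb : SO φ₁ φ₂ (fun ℓ => 1 - 2 * a ℓ - 2 * b ℓ - 2 * κ) fun _ => 1 :=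
    ((((Near.const 1).sub (h.near_a.const_mul 2)).sub (h.near_b.const_mul 2)).sub
      (Near.const (2 * κ))).bounded
  -- A bound for the functions also holds for their derivatives by Cauchy's estimate, hence for X·ga
  -- and X·gb: one power of X is gained per round, until the inhomogeneous terms S and T take over.
  have gain : ∀ G : ℂ → ℂ, SO φ₁ φ₂ ga G → SO φ₁ φ₂ gb G → SO φ₁ φ₂ ga' G → SO φ₁ φ₂ gb' G →
      SO φ₁ φ₂ (fun _ => 1) G →
      SO φ₁ φ₂ (fun ℓ => sqX ℓ * ga ℓ) G ∧ SO φ₁ φ₂ (fun ℓ => sqX ℓ * gb ℓ) G := by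
    intro G hA hB hA' hB' h1
    have r1 : ∀ {f g : ℂ → ℂ}, SO φ₁ φ₂ f (fun _ => 1) → SO φ₁ φ₂ g G →
        SO φ₁ φ₂ (fun ℓ => f ℓ * g ℓ) G := fun hf hg =>
      (hf.mul hg).congr_right fun ℓ => one_mul _
    constructor
    · have := ((hA'.sub (r1 ba hA)).sub ((r1 h.near_a.bounded hB).const_mul 2)).sub
        (nT.bounded.trans h1)
      refine (this.const_mul (1 / 6)).congr_left fun ℓ => ?_
      simp only [hga']
      ring
    · have := ((hB'.sub (r1 bb hB)).add ((r1 h.near_b.bounded hA).const_mul 2)).add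
        (nS.bounded.trans h1)
      refine (this.const_mul (1 / 2)).congr_left fun ℓ => ?_
      simp only [hgb']
      ring
  have powexp : ∀ (M : ℕ) (ℓ : ℂ), sqX ℓ ^ M = Complex.exp ((2 * M : ℂ) * ℓ) := fun M ℓ => by
    rw [sqX, ← Complex.exp_nat_mul]; congr 1; ring
  have dpow : ∀ (M : ℕ) {f f' : ℂ → ℂ}, SO φ₁ φ₂ f (fun ℓ => sqX ℓ ^ M) →
      (Ev φ₁ φ₂ fun ℓ => HasDerivAt f (f' ℓ) ℓ) → SO φ₁ φ₂ f' fun ℓ => sqX ℓ ^ M :=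
    fun M f f' hf hd => (SO.deriv (hf.congr_right (powexp M)) hd).congr_right
      fun ℓ => (powexp M ℓ).symm
  have cancel : ∀ {f G : ℂ → ℂ}, SO φ₁ φ₂ (fun ℓ => sqX ℓ * f ℓ) G →
      SO φ₁ φ₂ f fun ℓ => (sqX ℓ)⁻¹ * G ℓ := fun {f G} hf =>
    ((SO.refl fun ℓ => (sqX ℓ)⁻¹).mul hf).congr_left fun ℓ => inv_mul_cancel_left₀ (sqX_ne_zero ℓ) _
  have crude : ∀ M : ℕ, SO φ₁ φ₂ ga (fun ℓ => sqX ℓ ^ M) → SO φ₁ φ₂ gb (fun ℓ => sqX ℓ ^ M) →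
      SO φ₁ φ₂ ga (fun _ => 1) ∧ SO φ₁ φ₂ gb fun _ => 1 := by
    intro M
    induction M with
    | zero => intro hA hB; exact ⟨by simpa using hA, by simpa using hB⟩
    | succ M ih =>
      intro hA hB
      obtain ⟨g1, g2⟩ := gain _ hA hB (dpow _ hA da) (dpow _ hB db) (SO.one_pow _)
      have e : ∀ ℓ, (sqX ℓ)⁻¹ * sqX ℓ ^ (M + 1) = sqX ℓ ^ M := fun ℓ => by
        rw [pow_succ', inv_mul_cancel_left₀ (sqX_ne_zero ℓ)]
      exact ih ((cancel g1).congr_right e) ((cancel g2).congr_right e)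
  obtain ⟨a0, b0⟩ := crude N ca cb
  obtain ⟨a1, b1⟩ := gain _ a0 b0 (a0.deriv_one da) (b0.deriv_one db) (SO.refl _)
  have a2 : Near φ₁ φ₂ ga 0 := Near.of_SO ((cancel a1).congr_right fun ℓ => mul_one _)
  have b2 : Near φ₁ φ₂ gb 0 := Near.of_SO ((cancel b1).congr_right fun ℓ => mul_one _)
  have b3 : Near φ₁ φ₂ (fun ℓ => sqX ℓ * gb ℓ) (μ ^ 2) := by
    have nb := ((((Near.const 1).sub (h.near_a.const_mul 2)).sub (h.near_b.const_mul 2)).sub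
      (Near.const (2 * κ)))
    have := ((((b2.deriv db).sub (b2.mul nb)).add ((h.near_b.mul a2).const_mul 2)).add
      nS).const_mul (1 / 2)
    refine (this.congr (.of_forall fun ℓ => ?_)).of_eq (by ring)
    simp only [hgb']
    ring
  have na := ((((Near.const 1).add (h.near_b.const_mul 2)).add (h.near_a.const_mul 2)).sub
      (Near.const (2 * κ)))
  have a3 : Near φ₁ φ₂ (fun ℓ => sqX ℓ * ga ℓ) 0 := by
    have := ((((a2.deriv da).sub (a2.mul na)).sub ((h.near_a.mul b2).const_mul 2)).sub
      nT).const_mul (1 / 6)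
    refine (this.congr (.of_forall fun ℓ => ?_)).of_eq (by ring)
    simp only [hga']
    ring
  have dXa : Near φ₁ φ₂ (fun ℓ => sqX ℓ * ga' ℓ) 0 := by
    have hd : Ev φ₁ φ₂ fun ℓ => HasDerivAt (fun ℓ => sqX ℓ * ga ℓ)
        (2 * sqX ℓ * ga ℓ + sqX ℓ * ga' ℓ) ℓ := da.mono fun ℓ e => (hasDerivAt_sqX ℓ).mul e
    refine (((a3.deriv hd).sub (a3.const_mul 2)).congr (.of_forall fun ℓ => ?_)).of_eq (by ring)
    ring
  -- The limit Yμ² of 2a·X·gb and the limit -Yμ² of X·T cancel. This cancellation is what brings ga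
  -- down to O(X⁻³).
  have a4 : Near φ₁ φ₂ (fun ℓ => sqX ℓ * (sqX ℓ * ga ℓ)) 0 := by
    have := (((dXa.sub (a3.mul na)).sub ((h.near_a.mul b3).const_mul 2)).sub
      nXT).const_mul (1 / 6)
    refine (this.congr (.of_forall fun ℓ => ?_)).of_eq (by ring)
    simp only [hga']
    ring
  refine ⟨?_, b2.to_SO⟩
  exact (cancel (cancel a4.to_SO)).congr_right fun ℓ => by ring

end PainleveIV

end

noncomputable section

namespace PainleveIV

open Topology Set Asymptotics

/-! ### Rotated frames -/

/-- The point with the logarithm `ℓ + iθ`. -/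
def rot (θ : ℝ) (ℓ : ℂ) : ℂ := Complex.exp (ℓ + θ * Complex.I)

theorem rot_ne_zero (θ : ℝ) (ℓ : ℂ) : rot θ ℓ ≠ 0 := Complex.exp_ne_zero _

theorem hasDerivAt_rot (θ : ℝ) (ℓ : ℂ) : HasDerivAt (rot θ) (rot θ ℓ) ℓ := by
  refine (((hasDerivAt_id ℓ).add_const (θ * Complex.I)).cexp).congr_deriv ?_
  simp [rot]

theorem rot_sq (θ : ℝ) (ℓ : ℂ) : rot θ ℓ ^ 2 = Complex.exp (θ * Complex.I) ^ 2 * sqX ℓ := by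
  rw [rot, sqX, Complex.exp_add, mul_pow, ← Complex.exp_nat_mul ℓ]
  push_cast
  ring

theorem rot_eq (θ : ℝ) (ℓ : ℂ) : rot θ ℓ = Complex.exp (θ * Complex.I) * Complex.exp ℓ := by
  rw [rot, Complex.exp_add, mul_comm]

/-- Where y and p are analytic both sides of the equations are continuous, so the exceptional
discrete set plays no role there. -/
theorem IsTriple.ode_at {Y P : ℂ} {y p : ℂ → ℂ} (h : IsTriple Y P y p) {x : ℂ}
    (hy : AnalyticAt ℂ y x) (hp : AnalyticAt ℂ p x) :
    HasDerivAt y (y x * (y x + 2 * p x + 2 * x) - Y) x ∧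
      HasDerivAt p (p x * (-2 * x - 2 * y x - p x) - P) x := by
  have hx : AnalyticAt ℂ (fun z : ℂ => z) x := analyticAt_id
  constructor
  · have e := AnalyticAt.eq_of_codiscrete (f := deriv y)
      (g := fun x => y x * (y x + 2 * p x + 2 * x) - Y) hy.deriv (by fun_prop)
      (h.ode.mono fun z hz => hz.1.deriv)
    exact e ▸ hy.differentiableAt.hasDerivAt
  · have e := AnalyticAt.eq_of_codiscrete (f := deriv p)
      (g := fun x => p x * (-2 * x - 2 * y x - p x) - P) hp.deriv (by fun_prop)
      (h.ode.mono fun z hz => hz.2.deriv)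
    exact e ▸ hp.differentiableAt.hasDerivAt

/-- The first local unknown in a frame with `x² = e^{2ℓ}`. -/
def evenA (θ : ℝ) (y : ℂ → ℂ) (ℓ : ℂ) : ℂ := rot θ ℓ * y (rot θ ℓ)

/-- The first local unknown in a frame with `x² = -e^{2ℓ}`. -/
def oddA (θ : ℝ) (y p : ℂ → ℂ) (ℓ : ℂ) : ℂ :=
  rot θ ℓ * (2 * rot θ ℓ + y (rot θ ℓ) + p (rot θ ℓ))

/-- The second local unknown in a frame with `x² = -e^{2ℓ}`. -/
def oddB (θ : ℝ) (p : ℂ → ℂ) (ℓ : ℂ) : ℂ := -(rot θ ℓ * p (rot θ ℓ))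

/-- Algebraic behaviour with `y ~ Y / (2x)` in a sector around `arg x = θ`, `x² > 0`. -/
structure EvenFrame (Y P : ℂ) (θ φ₁ φ₂ : ℝ) (y p : ℂ → ℂ) : Prop where
  angle : Complex.exp (θ * Complex.I) ^ 2 = 1
  triple : IsTriple Y P y p
  regular : Ev φ₁ φ₂ fun ℓ => AnalyticAt ℂ y (rot θ ℓ) ∧ AnalyticAt ℂ p (rot θ ℓ)
  near_a : Near φ₁ φ₂ (evenA θ y) (Y / 2)
  near_b : Near φ₁ φ₂ (evenA θ p) (-P / 2)

/-- Algebraic behaviour with `y ~ -2x` in a sector around `arg x = θ`, `x² < 0`. -/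
structure OddFrame (Y P : ℂ) (θ φ₁ φ₂ : ℝ) (y p : ℂ → ℂ) : Prop where
  angle : Complex.exp (θ * Complex.I) ^ 2 = -1
  triple : IsTriple Y P y p
  regular : Ev φ₁ φ₂ fun ℓ => AnalyticAt ℂ y (rot θ ℓ) ∧ AnalyticAt ℂ p (rot θ ℓ)
  near_a : Near φ₁ φ₂ (oddA θ y p) ((2 - Y - P) / 2)
  near_b : Near φ₁ φ₂ (oddB θ p) (-P / 2)

variable {Y P : ℂ} {θ φ₁ φ₂ : ℝ} {y p y₀ p₀ y₁ p₁ y₂ p₂ : ℂ → ℂ}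

open IsTriple in
theorem IsTriple.step_regular (h : IsTriple Y P y p) {x : ℂ} (hy : AnalyticAt ℂ y x)
    (hp : AnalyticAt ℂ p x) (hp0 : p x ≠ 0) (hd : stepDen P y p x ≠ 0) :
    (AnalyticAt ℂ (nf (stepY Y P y p)) x ∧ AnalyticAt ℂ (nf (stepP Y P y p)) x) ∧
      nf (stepY Y P y p) x = stepY Y P y p x ∧ nf (stepP Y P y p) x = stepP Y P y p x := by
  have a1 : AnalyticAt ℂ (stepDen P y p) x := hy.add (analyticAt_const.div hp hp0)
  have a2 : AnalyticAt ℂ (stepY Y P y p) x := hp.sub (analyticAt_const.div a1 hd)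
  have a3 : AnalyticAt ℂ (stepP Y P y p) x :=
    ((analyticAt_const.mul analyticAt_id).sub a2).sub a1
  exact ⟨⟨nf_analyticAt h.meromorphic_stepY a2, nf_analyticAt h.meromorphic_stepP a3⟩,
    (nf_eventuallyEq h.meromorphic_stepY a2).self_of_nhds,
    (nf_eventuallyEq h.meromorphic_stepP a3).self_of_nhds⟩

namespace EvenFrame

theorem rot_sq (h : EvenFrame Y P θ φ₁ φ₂ y p) (ℓ : ℂ) : rot θ ℓ ^ 2 = sqX ℓ := by
  rw [PainleveIV.rot_sq, h.angle, one_mul]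

theorem loc (h : EvenFrame Y P θ φ₁ φ₂ y p) : Loc Y P φ₁ φ₂ (evenA θ y) (evenA θ p) := by
  refine ⟨h.regular.mono fun ℓ e => ?_, h.regular.mono fun ℓ e => ?_, h.near_a, h.near_b⟩
  · have hx := h.rot_sq ℓ
    refine ((hasDerivAt_rot θ ℓ).mul
      ((h.triple.ode_at e.1 e.2).1.comp ℓ (hasDerivAt_rot θ ℓ))).congr_deriv ?_
    simp only [evenA, Function.comp, ← hx]
    ring
  · have hx := h.rot_sq ℓ
    refine ((hasDerivAt_rot θ ℓ).mul
      ((h.triple.ode_at e.1 e.2).2.comp ℓ (hasDerivAt_rot θ ℓ))).congr_deriv ?_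
    simp only [evenA, Function.comp, ← hx]
    ring

open IsTriple in
theorem step_regular (h : EvenFrame Y P θ φ₁ φ₂ y p) (hP : P ≠ 0) :
    Ev φ₁ φ₂ fun ℓ => (AnalyticAt ℂ (nf (stepY Y P y p)) (rot θ ℓ) ∧
      AnalyticAt ℂ (nf (stepP Y P y p)) (rot θ ℓ)) ∧
      evenA θ (nf (stepY Y P y p)) ℓ = evenA θ p ℓ - (Y + P) * sqX ℓ /
        (evenA θ y ℓ + P * sqX ℓ / evenA θ p ℓ) ∧
      evenA θ (nf (stepP Y P y p)) ℓ = -2 * sqX ℓ - evenA θ (nf (stepY Y P y p)) ℓ -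
        (evenA θ y ℓ + P * sqX ℓ / evenA θ p ℓ) := by
  refine ((h.regular.and (h.loc.b_ne_zero hP)).and
    ((h.loc.near_den_even hP).ne_zero (by norm_num))).mono fun ℓ e => ?_
  obtain ⟨⟨⟨e1, e2⟩, e3⟩, e4⟩ := e
  have hx := h.rot_sq ℓ
  have hx0 := rot_ne_zero θ ℓ
  have hp0 : p (rot θ ℓ) ≠ 0 := fun h0 => e3 (by simp [evenA, h0])
  have hden : rot θ ℓ * stepDen P y p (rot θ ℓ) = evenA θ y ℓ + P * sqX ℓ / evenA θ p ℓ := by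
    simp only [stepDen, evenA, ← hx]
    field_simp
  have hd : stepDen P y p (rot θ ℓ) ≠ 0 := fun h0 => e4 (by rw [← hden, h0]; simp)
  obtain ⟨r1, r2, r3⟩ := h.triple.step_regular e1 e2 hp0 hd
  refine ⟨r1, ?_, ?_⟩
  · rw [← hden, ← hx, evenA, r2, stepY, evenA]
    field_simp
  · rw [← hden, evenA, evenA, r3, r2, stepP, ← hx]
    ring

open IsTriple in
theorem step (h : EvenFrame Y P θ φ₁ φ₂ y p) (hP : P ≠ 0) (hYP : Y + P ≠ 0) :
    EvenFrame Y (P + 2) θ φ₁ φ₂ (nf (stepY Y P y p)) (nf (stepP Y P y p)) := by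
  have hr := h.step_regular hP
  obtain ⟨n1, n2⟩ := h.loc.step_even hP (hr.mono fun _ e => e.2.1) (hr.mono fun _ e => e.2.2)
  exact ⟨h.angle, h.triple.step hP hYP, hr.mono fun _ e => e.1, n1, n2⟩

open IsTriple in
theorem lDiff_step {κ μ : ℂ} (h : EvenFrame Y P θ φ₁ φ₂ y p) (h₀ : EvenFrame Y P θ φ₁ φ₂ y₀ p₀)
    (hP : P ≠ 0) (d : LDiff κ μ φ₁ φ₂ (evenA θ y) (evenA θ p) (evenA θ y₀) (evenA θ p₀)) :
    LDiff (κ + 2) (4 * μ / P) φ₁ φ₂ (evenA θ (nf (stepY Y P y p)))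
      (evenA θ (nf (stepP Y P y p))) (evenA θ (nf (stepY Y P y₀ p₀)))
      (evenA θ (nf (stepP Y P y₀ p₀))) :=
  d.step_even h.loc h₀.loc hP ((h.step_regular hP).mono fun _ e => e.2.1)
    ((h.step_regular hP).mono fun _ e => e.2.2) ((h₀.step_regular hP).mono fun _ e => e.2.1)
    ((h₀.step_regular hP).mono fun _ e => e.2.2)

open IsTriple in
theorem hasJet_step {E : ℂ → ℂ} (hE : SO φ₁ φ₂ E fun _ => 1) (h : EvenFrame Y P θ φ₁ φ₂ y p)
    (h₁ : EvenFrame Y P θ φ₁ φ₂ y₁ p₁) (h₂ : EvenFrame Y P θ φ₁ φ₂ y₂ p₂) (hP : P ≠ 0)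
    (ja : HasJet E φ₁ φ₂ (evenA θ y₁) (evenA θ y₂) (evenA θ y))
    (jb : HasJet E φ₁ φ₂ (evenA θ p₁) (evenA θ p₂) (evenA θ p)) :
    HasJet E φ₁ φ₂ (evenA θ (nf (stepY Y P y₁ p₁))) (evenA θ (nf (stepY Y P y₂ p₂)))
      (evenA θ (nf (stepY Y P y p))) ∧
    HasJet E φ₁ φ₂ (evenA θ (nf (stepP Y P y₁ p₁))) (evenA θ (nf (stepP Y P y₂ p₂)))
      (evenA θ (nf (stepP Y P y p))) := by
  have hP2 : -P / 2 ≠ 0 := by simpa using hP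
  have jd := ja.add ((HasJet.sqX.const_mul hE P).mul hE
    (jb.inv_of_near h₁.near_b h₂.near_b h.near_b hP2 hP2 hP2))
  -- The denominator grows like -2X; dividing by X first gives it the nonzero limit that inversion
  -- needs.
  have jd' := (jd.mul hE HasJet.sqX_inv).inv_of_near (h₁.loc.near_den_even hP)
    (h₂.loc.near_den_even hP) (h.loc.near_den_even hP) (by norm_num) (by norm_num) (by norm_num)
  have hr := h.step_regular hP
  have hr₁ := h₁.step_regular hP
  have hr₂ := h₂.step_regular hP
  have key : ∀ b c X : ℂ, b + -(Y + P) * (c * X⁻¹)⁻¹ = b - (Y + P) * X / c := fun b c X => by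
    rw [mul_inv, inv_inv]; ring
  have jA := (jb.add (jd'.const_mul hE (-(Y + P)))).congr
    (h₁ := evenA θ (nf (stepY Y P y₁ p₁))) (h₂ := evenA θ (nf (stepY Y P y₂ p₂)))
    (k := evenA θ (nf (stepY Y P y p)))
    (hr₁.mono fun ℓ e => by rw [e.2.1]; exact key _ _ _)
    (hr₂.mono fun ℓ e => by rw [e.2.1]; exact key _ _ _)
    (hr.mono fun ℓ e => by rw [e.2.1]; exact key _ _ _)
  refine ⟨jA, ((HasJet.sqX.const_mul hE (-2)).add ((jA.add jd).const_mul hE (-1))).congr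
    (hr₁.mono fun ℓ e => ?_) (hr₂.mono fun ℓ e => ?_) (hr.mono fun ℓ e => ?_)⟩
  all_goals rw [e.2.2, div_eq_mul_inv _ (evenA θ _ ℓ)]; ring

end EvenFrame

namespace OddFrame

theorem rot_sq (h : OddFrame Y P θ φ₁ φ₂ y p) (ℓ : ℂ) : rot θ ℓ ^ 2 = -sqX ℓ := by
  rw [PainleveIV.rot_sq, h.angle, neg_one_mul]

theorem hasDerivAt_oddB (h : IsTriple Y P y p) (hx : rot θ ℓ ^ 2 = -sqX ℓ)
    (e : AnalyticAt ℂ y (rot θ ℓ) ∧ AnalyticAt ℂ p (rot θ ℓ)) :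
    HasDerivAt (oddB θ p) (oddB θ p ℓ * (1 - 2 * sqX ℓ - 2 * oddA θ y p ℓ - oddB θ p ℓ)
      - P * sqX ℓ) ℓ := by
  refine ((hasDerivAt_rot θ ℓ).mul
    ((h.ode_at e.1 e.2).2.comp ℓ (hasDerivAt_rot θ ℓ))).neg.congr_deriv ?_
  have hx' : sqX ℓ = -rot θ ℓ ^ 2 := by rw [hx, neg_neg]
  simp only [oddA, oddB, Function.comp, hx']
  ring

/-- In the unknowns x(2x + y + p) and -xp, with e^{2ℓ} = -x², the system reproduces itself with 2 -
Y - P for Y. The case y ~ -2x is thereby reduced to that of bounded unknowns in `Loc`. -/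
theorem loc (h : OddFrame Y P θ φ₁ φ₂ y p) :
    Loc (2 - Y - P) P φ₁ φ₂ (oddA θ y p) (oddB θ p) := by
  refine ⟨h.regular.mono fun ℓ e => ?_, h.regular.mono fun ℓ e =>
    hasDerivAt_oddB h.triple (h.rot_sq ℓ) e, h.near_a, h.near_b⟩
  have hx' : sqX ℓ = -rot θ ℓ ^ 2 := by rw [h.rot_sq, neg_neg]
  have ho := h.triple.ode_at e.1 e.2
  have hr := hasDerivAt_rot θ ℓ
  refine (hr.mul (((hr.const_mul 2).add (ho.1.comp ℓ hr)).add
    (ho.2.comp ℓ hr))).congr_deriv ?_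
  simp only [oddA, oddB, Function.comp, hx', Pi.add_apply]
  ring

open IsTriple in
theorem step_regular (h : OddFrame Y P θ φ₁ φ₂ y p) (hP : P ≠ 0) (hYP : Y + P ≠ 0) :
    Ev φ₁ φ₂ fun ℓ => (AnalyticAt ℂ (nf (stepY Y P y p)) (rot θ ℓ) ∧
      AnalyticAt ℂ (nf (stepP Y P y p)) (rot θ ℓ)) ∧
      oddA θ (nf (stepY Y P y p)) (nf (stepP Y P y p)) ℓ = -2 * sqX ℓ - oddA θ y p ℓ -
        oddB θ p ℓ - P * sqX ℓ / oddB θ p ℓ ∧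
      oddB θ (nf (stepP Y P y p)) ℓ = -2 * sqX ℓ -
        oddA θ (nf (stepY Y P y p)) (nf (stepP Y P y p)) ℓ -
        (oddB θ p ℓ + (2 - (2 - Y - P)) * sqX ℓ /
          oddA θ (nf (stepY Y P y p)) (nf (stepP Y P y p)) ℓ) := by
  have hn := (h.loc.near_a_odd (a' := fun ℓ => -2 * sqX ℓ - oddA θ y p ℓ - oddB θ p ℓ -
    P * sqX ℓ / oddB θ p ℓ) hP (.of_forall fun _ => rfl)).ne_zero
    (fun e => hYP (by linear_combination -2 * e))
  refine ((h.regular.and (h.loc.b_ne_zero hP)).and hn).mono fun ℓ e => ?_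
  obtain ⟨⟨⟨e1, e2⟩, e3⟩, e4⟩ := e
  have hx' : sqX ℓ = -rot θ ℓ ^ 2 := by rw [h.rot_sq, neg_neg]
  have hx0 := rot_ne_zero θ ℓ
  have hp0 : p (rot θ ℓ) ≠ 0 := fun h0 => e3 (by simp [oddB, h0])
  have hden : -(rot θ ℓ * stepDen P y p (rot θ ℓ)) =
      -2 * sqX ℓ - oddA θ y p ℓ - oddB θ p ℓ - P * sqX ℓ / oddB θ p ℓ := by
    simp only [stepDen, oddA, oddB, hx']
    field_simp
    ring
  have hd : stepDen P y p (rot θ ℓ) ≠ 0 := fun h0 => e4 (by rw [← hden, h0]; simp)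
  obtain ⟨r1, r2, r3⟩ := h.triple.step_regular e1 e2 hp0 hd
  -- By the definition of `stepP`, the sum of 2x and the new y and p is minus the denominator, so
  -- the new first unknown is -x times the denominator.
  have hA : oddA θ (nf (stepY Y P y p)) (nf (stepP Y P y p)) ℓ =
      -(rot θ ℓ * stepDen P y p (rot θ ℓ)) := by
    rw [oddA, r2, r3, stepP]
    ring
  refine ⟨r1, hA.trans hden, ?_⟩
  rw [hA, oddB, r3, stepP, stepY, oddB, hx']
  field_simp
  ring

open IsTriple in
theorem step (h : OddFrame Y P θ φ₁ φ₂ y p) (hP : P ≠ 0) (hYP : Y + P ≠ 0) :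
    OddFrame Y (P + 2) θ φ₁ φ₂ (nf (stepY Y P y p)) (nf (stepP Y P y p)) := by
  have hr := h.step_regular hP hYP
  have ht := h.triple.step hP hYP
  obtain ⟨n1, n2⟩ := h.loc.step_odd hP
    (fun e => hYP (by linear_combination -e)) (hr.mono fun _ e => e.2.1)
    (hr.mono fun _ e => e.2.2) (hr.mono fun ℓ e => hasDerivAt_oddB ht (h.rot_sq ℓ) e.1)
  exact ⟨h.angle, ht, hr.mono fun _ e => e.1, n1.of_eq (by ring), n2⟩

open IsTriple in
theorem lDiff_step {κ μ : ℂ} (h : OddFrame Y P θ φ₁ φ₂ y p) (h₀ : OddFrame Y P θ φ₁ φ₂ y₀ p₀)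
    (hP : P ≠ 0) (hYP : Y + P ≠ 0)
    (d : LDiff κ μ φ₁ φ₂ (oddA θ y p) (oddB θ p) (oddA θ y₀ p₀) (oddB θ p₀)) :
    LDiff (κ + 4) (16 * μ / ((Y + P) * P)) φ₁ φ₂
      (oddA θ (nf (stepY Y P y p)) (nf (stepP Y P y p))) (oddB θ (nf (stepP Y P y p)))
      (oddA θ (nf (stepY Y P y₀ p₀)) (nf (stepP Y P y₀ p₀))) (oddB θ (nf (stepP Y P y₀ p₀))) := by
  have := d.step_odd h.loc h₀.loc hP (fun e => hYP (by linear_combination -e))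
    ((h.step_regular hP hYP).mono fun _ e => e.2.1)
    ((h.step_regular hP hYP).mono fun _ e => e.2.2)
    ((h₀.step_regular hP hYP).mono fun _ e => e.2.1)
    ((h₀.step_regular hP hYP).mono fun _ e => e.2.2)
  rwa [show 2 - (2 - Y - P) = Y + P by ring] at this

open IsTriple in
theorem hasJet_step {E : ℂ → ℂ} (hE : SO φ₁ φ₂ E fun _ => 1) (h : OddFrame Y P θ φ₁ φ₂ y p)
    (h₁ : OddFrame Y P θ φ₁ φ₂ y₁ p₁) (h₂ : OddFrame Y P θ φ₁ φ₂ y₂ p₂) (hP : P ≠ 0)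
    (hYP : Y + P ≠ 0)
    (ja : HasJet E φ₁ φ₂ (oddA θ y₁ p₁) (oddA θ y₂ p₂) (oddA θ y p))
    (jb : HasJet E φ₁ φ₂ (oddB θ p₁) (oddB θ p₂) (oddB θ p)) :
    HasJet E φ₁ φ₂ (oddA θ (nf (stepY Y P y₁ p₁)) (nf (stepP Y P y₁ p₁)))
      (oddA θ (nf (stepY Y P y₂ p₂)) (nf (stepP Y P y₂ p₂)))
      (oddA θ (nf (stepY Y P y p)) (nf (stepP Y P y p))) ∧
    HasJet E φ₁ φ₂ (oddB θ (nf (stepP Y P y₁ p₁))) (oddB θ (nf (stepP Y P y₂ p₂)))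
      (oddB θ (nf (stepP Y P y p))) := by
  have hP2 : -P / 2 ≠ 0 := by simpa using hP
  have hr := h.step_regular hP hYP
  have hr₁ := h₁.step_regular hP hYP
  have hr₂ := h₂.step_regular hP hYP
  have jX : HasJet E φ₁ φ₂ sqX sqX sqX := HasJet.sqX
  have jA := ((jX.const_mul hE (-2)).add (((ja.add jb).add ((jX.const_mul hE P).mul hE
    (jb.inv_of_near h₁.near_b h₂.near_b h.near_b hP2 hP2 hP2))).const_mul hE (-1))).congr
    (h₁ := oddA θ (nf (stepY Y P y₁ p₁)) (nf (stepP Y P y₁ p₁)))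
    (h₂ := oddA θ (nf (stepY Y P y₂ p₂)) (nf (stepP Y P y₂ p₂)))
    (k := oddA θ (nf (stepY Y P y p)) (nf (stepP Y P y p)))
    (hr₁.mono fun ℓ e => by rw [e.2.1, div_eq_mul_inv]; ring)
    (hr₂.mono fun ℓ e => by rw [e.2.1, div_eq_mul_inv]; ring)
    (hr.mono fun ℓ e => by rw [e.2.1, div_eq_mul_inv]; ring)
  have hn : (2 - Y - (P + 2)) / 2 ≠ 0 := fun e => hYP (by linear_combination -2 * e)
  have jA' := jA.inv_of_near (h₁.step hP hYP).near_a (h₂.step hP hYP).near_a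
    (h.step hP hYP).near_a hn hn hn
  refine ⟨jA, ((jX.const_mul hE (-2)).add ((jA.add (jb.add ((jX.const_mul hE
    (2 - (2 - Y - P))).mul hE jA'))).const_mul hE (-1))).congr
    (hr₁.mono fun ℓ e => ?_) (hr₂.mono fun ℓ e => ?_) (hr.mono fun ℓ e => ?_)⟩
  all_goals rw [e.2.2, div_eq_mul_inv _ (oddA θ _ _ ℓ)]; ring

end OddFrame

/-! ### Induction along the hierarchy -/

section Level

variable {w w' w₀ w₀' w₁ w₁' w₂ w₂' : ℂ → ℂ}

theorem two_mul_add_two_ne_zero (n : ℕ) : (2 * n + 2 : ℂ) ≠ 0 := by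
  exact_mod_cast (by omega : 2 * n + 2 ≠ 0)

theorem cast_two_mul_succ (n : ℕ) : (2 * ((n + 1 : ℕ) : ℂ) + 2) = 2 * n + 2 + 2 := by
  push_cast; ring

theorem add_two_mul_add_two_ne_zero (hY : ∀ m : ℕ, Y + 2 * m ≠ 0) (n : ℕ) :
    Y + (2 * n + 2) ≠ 0 := fun e => hY (n + 1) (by push_cast; linear_combination e)

theorem EvenFrame.level (hY : ∀ m : ℕ, Y + 2 * m ≠ 0)
    (h : EvenFrame Y 2 θ φ₁ φ₂ (level Y w w' 0).1 (level Y w w' 0).2) (n : ℕ) :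
    EvenFrame Y (2 * n + 2) θ φ₁ φ₂ (level Y w w' n).1 (level Y w w' n).2 := by
  induction n with
  | zero => simpa using h
  | succ n ih =>
    rw [cast_two_mul_succ]
    exact ih.step (two_mul_add_two_ne_zero n) (add_two_mul_add_two_ne_zero hY n)

theorem OddFrame.level (hY : ∀ m : ℕ, Y + 2 * m ≠ 0)
    (h : OddFrame Y 2 θ φ₁ φ₂ (level Y w w' 0).1 (level Y w w' 0).2) (n : ℕ) :
    OddFrame Y (2 * n + 2) θ φ₁ φ₂ (level Y w w' n).1 (level Y w w' n).2 := by
  induction n with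
  | zero => simpa using h
  | succ n ih =>
    rw [cast_two_mul_succ]
    exact ih.step (two_mul_add_two_ne_zero n) (add_two_mul_add_two_ne_zero hY n)

/-- The product of the factors 4/P over P = 2, 4, …, 2n is 2^n/n!. -/
theorem EvenFrame.lDiff_level {κ μ : ℂ} (hY : ∀ m : ℕ, Y + 2 * m ≠ 0)
    (h : EvenFrame Y 2 θ φ₁ φ₂ (PainleveIV.level Y w w' 0).1 (PainleveIV.level Y w w' 0).2)
    (h₀ : EvenFrame Y 2 θ φ₁ φ₂ (PainleveIV.level Y w₀ w₀' 0).1 (PainleveIV.level Y w₀ w₀' 0).2)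
    (d : LDiff κ μ φ₁ φ₂ (evenA θ (PainleveIV.level Y w w' 0).1)
      (evenA θ (PainleveIV.level Y w w' 0).2) (evenA θ (PainleveIV.level Y w₀ w₀' 0).1)
      (evenA θ (PainleveIV.level Y w₀ w₀' 0).2)) (n : ℕ) :
    LDiff (κ + 2 * n) (μ * 2 ^ n / n.factorial) φ₁ φ₂ (evenA θ (PainleveIV.level Y w w' n).1)
      (evenA θ (PainleveIV.level Y w w' n).2) (evenA θ (PainleveIV.level Y w₀ w₀' n).1)
      (evenA θ (PainleveIV.level Y w₀ w₀' n).2) := by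
  induction n with
  | zero => simpa using d
  | succ n ih =>
    have h1 := (h.level hY n).lDiff_step (h₀.level hY n) (two_mul_add_two_ne_zero n) ih
    convert h1 using 1
    · push_cast; ring
    · have h2 : (n.factorial : ℂ) ≠ 0 := by exact_mod_cast n.factorial_ne_zero
      have h3 : (n + 1 : ℂ) ≠ 0 := by exact_mod_cast n.succ_ne_zero
      rw [Nat.factorial_succ, show (2 * n + 2 : ℂ) = 2 * (n + 1) by ring]
      push_cast
      field_simp
      ring
    all_goals rfl

/-- The factors are 16/((Y + P)P) for P = 2k, that is 4/((Y/2 + k)k), with k = 1, …, n; the first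
linear factor accounts for the quotient of Gamma functions. -/
theorem OddFrame.lDiff_level {κ μ : ℂ} (hY : ∀ m : ℕ, Y + 2 * m ≠ 0)
    (h : OddFrame Y 2 θ φ₁ φ₂ (PainleveIV.level Y w w' 0).1 (PainleveIV.level Y w w' 0).2)
    (h₀ : OddFrame Y 2 θ φ₁ φ₂ (PainleveIV.level Y w₀ w₀' 0).1 (PainleveIV.level Y w₀ w₀' 0).2)
    (d : LDiff κ μ φ₁ φ₂
      (oddA θ (PainleveIV.level Y w w' 0).1 (PainleveIV.level Y w w' 0).2)
      (oddB θ (PainleveIV.level Y w w' 0).2)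
      (oddA θ (PainleveIV.level Y w₀ w₀' 0).1 (PainleveIV.level Y w₀ w₀' 0).2)
      (oddB θ (PainleveIV.level Y w₀ w₀' 0).2)) (n : ℕ) :
    LDiff (κ + 4 * n) (μ * (4 ^ n * Complex.Gamma (1 + Y / 2) /
        (n.factorial * Complex.Gamma (n + 1 + Y / 2)))) φ₁ φ₂
      (oddA θ (PainleveIV.level Y w w' n).1 (PainleveIV.level Y w w' n).2)
      (oddB θ (PainleveIV.level Y w w' n).2)
      (oddA θ (PainleveIV.level Y w₀ w₀' n).1 (PainleveIV.level Y w₀ w₀' n).2)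
      (oddB θ (PainleveIV.level Y w₀ w₀' n).2) := by
  have hg : ∀ n : ℕ, Complex.Gamma (n + 1 + Y / 2) ≠ 0 := fun n =>
    Complex.Gamma_ne_zero fun m hm => hY (n + 1 + m) (by
      push_cast; linear_combination 2 * hm)
  induction n with
  | zero =>
    have := hg 0
    simp only [CharP.cast_eq_zero, zero_add] at this
    simpa [this] using d
  | succ n ih =>
    have h1 := (h.level hY n).lDiff_step (h₀.level hY n) (two_mul_add_two_ne_zero n)
      (add_two_mul_add_two_ne_zero hY n) ih
    convert h1 using 1
    · push_cast; ring
    · have h2 : (n.factorial : ℂ) ≠ 0 := by exact_mod_cast n.factorial_ne_zero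
      have h3 : (n + 1 : ℂ) ≠ 0 := by exact_mod_cast n.succ_ne_zero
      have h4 : (n + 1 + Y / 2 : ℂ) ≠ 0 := fun e => hY (n + 1) (by
        push_cast; linear_combination 2 * e)
      have h5 := hg n
      rw [Nat.factorial_succ, show (2 * n + 2 : ℂ) = 2 * (n + 1) by ring,
        show Y + 2 * (n + 1 : ℂ) = 2 * (n + 1 + Y / 2) by ring,
        show ((n + 1 : ℕ) + 1 + Y / 2 : ℂ) = n + 1 + Y / 2 + 1 by push_cast; ring,
        Complex.Gamma_add_one _ h4]
      push_cast
      generalize (n + 1 + Y / 2 : ℂ) = t at *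
      field_simp
      ring
    all_goals rfl

theorem EvenFrame.hasJet_level {E : ℂ → ℂ} (hE : SO φ₁ φ₂ E fun _ => 1)
    (hY : ∀ m : ℕ, Y + 2 * m ≠ 0)
    (h : EvenFrame Y 2 θ φ₁ φ₂ (PainleveIV.level Y w w' 0).1 (PainleveIV.level Y w w' 0).2)
    (h₁ : EvenFrame Y 2 θ φ₁ φ₂ (PainleveIV.level Y w₁ w₁' 0).1 (PainleveIV.level Y w₁ w₁' 0).2)
    (h₂ : EvenFrame Y 2 θ φ₁ φ₂ (PainleveIV.level Y w₂ w₂' 0).1 (PainleveIV.level Y w₂ w₂' 0).2)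
    (ja : HasJet E φ₁ φ₂ (evenA θ (PainleveIV.level Y w₁ w₁' 0).1)
      (evenA θ (PainleveIV.level Y w₂ w₂' 0).1) (evenA θ (PainleveIV.level Y w w' 0).1))
    (jb : HasJet E φ₁ φ₂ (evenA θ (PainleveIV.level Y w₁ w₁' 0).2)
      (evenA θ (PainleveIV.level Y w₂ w₂' 0).2) (evenA θ (PainleveIV.level Y w w' 0).2)) (n : ℕ) :
    HasJet E φ₁ φ₂ (evenA θ (PainleveIV.level Y w₁ w₁' n).1)
      (evenA θ (PainleveIV.level Y w₂ w₂' n).1) (evenA θ (PainleveIV.level Y w w' n).1) ∧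
    HasJet E φ₁ φ₂ (evenA θ (PainleveIV.level Y w₁ w₁' n).2)
      (evenA θ (PainleveIV.level Y w₂ w₂' n).2) (evenA θ (PainleveIV.level Y w w' n).2) := by
  induction n with
  | zero => exact ⟨ja, jb⟩
  | succ n ih =>
    exact EvenFrame.hasJet_step hE (h.level hY n) (h₁.level hY n) (h₂.level hY n)
      (two_mul_add_two_ne_zero n) ih.1 ih.2

theorem OddFrame.hasJet_level {E : ℂ → ℂ} (hE : SO φ₁ φ₂ E fun _ => 1)
    (hY : ∀ m : ℕ, Y + 2 * m ≠ 0)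
    (h : OddFrame Y 2 θ φ₁ φ₂ (PainleveIV.level Y w w' 0).1 (PainleveIV.level Y w w' 0).2)
    (h₁ : OddFrame Y 2 θ φ₁ φ₂ (PainleveIV.level Y w₁ w₁' 0).1 (PainleveIV.level Y w₁ w₁' 0).2)
    (h₂ : OddFrame Y 2 θ φ₁ φ₂ (PainleveIV.level Y w₂ w₂' 0).1 (PainleveIV.level Y w₂ w₂' 0).2)
    (ja : HasJet E φ₁ φ₂
      (oddA θ (PainleveIV.level Y w₁ w₁' 0).1 (PainleveIV.level Y w₁ w₁' 0).2)
      (oddA θ (PainleveIV.level Y w₂ w₂' 0).1 (PainleveIV.level Y w₂ w₂' 0).2)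
      (oddA θ (PainleveIV.level Y w w' 0).1 (PainleveIV.level Y w w' 0).2))
    (jb : HasJet E φ₁ φ₂ (oddB θ (PainleveIV.level Y w₁ w₁' 0).2)
      (oddB θ (PainleveIV.level Y w₂ w₂' 0).2) (oddB θ (PainleveIV.level Y w w' 0).2)) (n : ℕ) :
    HasJet E φ₁ φ₂ (oddA θ (PainleveIV.level Y w₁ w₁' n).1 (PainleveIV.level Y w₁ w₁' n).2)
      (oddA θ (PainleveIV.level Y w₂ w₂' n).1 (PainleveIV.level Y w₂ w₂' n).2)
      (oddA θ (PainleveIV.level Y w w' n).1 (PainleveIV.level Y w w' n).2) ∧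
    HasJet E φ₁ φ₂ (oddB θ (PainleveIV.level Y w₁ w₁' n).2)
      (oddB θ (PainleveIV.level Y w₂ w₂' n).2) (oddB θ (PainleveIV.level Y w w' n).2) := by
  induction n with
  | zero => exact ⟨ja, jb⟩
  | succ n ih =>
    exact OddFrame.hasJet_step hE (h.level hY n) (h₁.level hY n) (h₂.level hY n)
      (two_mul_add_two_ne_zero n) (add_two_mul_add_two_ne_zero hY n) ih.1 ih.2

end Level

end PainleveIV

end

noncomputable section

namespace PainleveIV

open Topology Set Asymptotics

variable {φ₁ φ₂ θ : ℝ} {s A A₀ A₁ A₂ C k Y : ℂ} {ω ω' ω₀ ω₀' ω₁ ω₁' ω₂ ω₂' w w' : ℂ → ℂ}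

/-! ### Solutions of the Weber equation with algebraic behaviour -/

/-- `ω ~ A z^{-s}`, together with its derivative. -/
structure Dominant (s A : ℂ) (φ₁ φ₂ : ℝ) (ω ω' : ℂ → ℂ) : Prop where
  left : Near φ₁ φ₂ (fun ℓ => Complex.exp (s * ℓ) * ω (Complex.exp ℓ)) A
  right : Near φ₁ φ₂ (fun ℓ => Complex.exp ((s + 1) * ℓ) * ω' (Complex.exp ℓ)) (-s * A)

/-- The logarithmic derivative of `ω` with respect to `ℓ`. -/
def locA (ω ω' : ℂ → ℂ) (ℓ : ℂ) : ℂ := Complex.exp ℓ * ω' (Complex.exp ℓ) / ω (Complex.exp ℓ)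

/-- The companion of `locA`. -/
def locB (Y : ℂ) (ω ω' : ℂ → ℂ) (ℓ : ℂ) : ℂ :=
  -2 * sqX ℓ - locA ω ω' ℓ + Y * sqX ℓ / locA ω ω' ℓ

theorem exp_sq (ℓ : ℂ) : Complex.exp ℓ ^ 2 = sqX ℓ := by
  rw [sqX, ← Complex.exp_nat_mul]; norm_num

theorem SO_logE (κ : ℂ) : SO (-Real.pi / 4) (Real.pi / 4) (logE κ) fun _ => 1 :=
  fun _ _ h1 h2 => isBigO_exp_sub_sqX κ (by linarith) h2

theorem near_logE (κ : ℂ) : Near (-Real.pi / 4) (Real.pi / 4) (logE κ) 0 := by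
  refine Near.of_SO ((((SO_logE (κ + 2)).mul (SO.refl fun ℓ => (sqX ℓ)⁻¹)).congr_left
    fun ℓ => ?_).congr_right fun ℓ => one_mul _)
  rw [logE_add_two, mul_comm, inv_mul_cancel_left₀ (sqX_ne_zero ℓ)]

theorem SO_exp_psi0 (h : NotInt s) :
    SO (-3 * Real.pi / 4) (3 * Real.pi / 4)
      (fun ℓ => Complex.exp (s * ℓ) * psi0 s (Complex.exp ℓ)) (logE (2 * s - 1)) ∧
    SO (-3 * Real.pi / 4) (3 * Real.pi / 4)
      (fun ℓ => Complex.exp ((s + 1) * ℓ) * psi0' s (Complex.exp ℓ)) (logE (2 * s + 1)) := by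
  constructor
  · refine ((SO.refl fun ℓ => Complex.exp (s * ℓ)).mul (SO_psi0 h).1).congr_right fun ℓ => ?_
    rw [logE, ← Complex.exp_add]; congr 1; ring
  · refine ((SO.refl fun ℓ => Complex.exp ((s + 1) * ℓ)).mul (SO_psi0 h).2).congr_right fun ℓ => ?_
    rw [logE, ← Complex.exp_add]; congr 1; ring

theorem dominant_psi (h : NotInt s) (A C : ℂ) :
    Dominant s A (-Real.pi / 4) (Real.pi / 4) (psi s A C) (psi' s A C) := by
  have hpi := Real.pi_pos
  obtain ⟨m1, m2⟩ := near_psiM h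
  obtain ⟨z1, z2⟩ := SO_exp_psi0 h
  have n0 : ∀ {f : ℂ → ℂ} {κ : ℂ}, SO (-3 * Real.pi / 4) (3 * Real.pi / 4) f (logE κ) →
      Near (-Real.pi / 4) (Real.pi / 4) f 0 := fun hf =>
    Near.of_SO ((hf.mono_sector (by linarith) (by linarith)).trans (near_logE _).to_SO)
  constructor
  · refine ((((m1.mono_sector (by linarith) le_rfl).const_mul A).add
      ((n0 z1).const_mul C)).congr (.of_forall fun ℓ => ?_)).of_eq (by ring)
    rw [psi]; ring
  · refine ((((m2.mono_sector (by linarith) le_rfl).const_mul A).add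
      ((n0 z2).const_mul C)).congr (.of_forall fun ℓ => ?_)).of_eq (by ring)
    rw [psi']; ring

/-- Without a `psi0` component the algebraic behaviour persists in the whole sector of `psiM`;
`dominant_psi_right` is the counterpart for `psiP`. These wide sectors single out the backgrounds.
-/
theorem dominant_psi_left (h : NotInt s) (A : ℂ) :
    Dominant s A (-5 * Real.pi / 4) (Real.pi / 4) (psi s A 0) (psi' s A 0) := by
  obtain ⟨m1, m2⟩ := near_psiM h
  constructor
  · refine ((m1.const_mul A).congr (.of_forall fun ℓ => ?_)).of_eq (by ring)
    rw [psi]; ring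
  · refine ((m2.const_mul A).congr (.of_forall fun ℓ => ?_)).of_eq (by ring)
    rw [psi']; ring

theorem dominant_psi_right (h : NotInt s) (hC : C + iSqrtPi * A = 0) :
    Dominant s A (-Real.pi / 4) (5 * Real.pi / 4) (psi s A C) (psi' s A C) := by
  obtain ⟨m1, m2⟩ := near_psiP h
  constructor
  · refine ((m1.const_mul A).congr (.of_forall fun ℓ => ?_)).of_eq (by ring)
    rw [(psi_eq_psiP s A C _).1, hC]; ring
  · refine ((m2.const_mul A).congr (.of_forall fun ℓ => ?_)).of_eq (by ring)
    rw [(psi_eq_psiP s A C _).2, hC]; ring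

theorem wronskian_psi (h : NotInt s) (A C A₀ C₀ : ℂ) :
    psi s A C 0 * psi' s A₀ C₀ 0 - psi' s A C 0 * psi s A₀ C₀ 0 =
      (A * C₀ - C * A₀) * (-2 * 2 ^ s / Complex.Gamma s) := by
  rw [← wronskian_psiM_psi0 h]
  simp only [psi, psi']
  ring

theorem psi_initial_ne_zero (h : NotInt s) (hAC : A ≠ 0 ∨ C ≠ 0) :
    psi s A C 0 ≠ 0 ∨ psi' s A C 0 ≠ 0 := by
  by_contra! hh
  have hW := wronskian_psiM_psi0_ne_zero h
  rw [wronskian_psiM_psi0 h] at hW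
  have e1 := wronskian_psi h A C 0 1
  have e2 := wronskian_psi h A C 1 0
  rw [hh.1, hh.2] at e1 e2
  simp only [zero_mul, sub_zero, mul_one, mul_zero, zero_sub] at e1 e2
  rcases hAC with h0 | h0
  · exact mul_ne_zero h0 hW e1.symm
  · exact mul_ne_zero (neg_ne_zero.2 h0) hW e2.symm

namespace Dominant

theorem ev_ne_zero (d : Dominant s A φ₁ φ₂ ω ω') (hs : s ≠ 0) (hA : A ≠ 0) :
    Ev φ₁ φ₂ fun ℓ => ω (Complex.exp ℓ) ≠ 0 ∧ ω' (Complex.exp ℓ) ≠ 0 := by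
  refine ((d.left.ne_zero hA).and (d.right.ne_zero (mul_ne_zero (neg_ne_zero.2 hs) hA))).mono
    fun ℓ e => ⟨fun h => e.1 (by simp [h]), fun h => e.2 (by simp [h])⟩

theorem near_locA (d : Dominant s A φ₁ φ₂ ω ω') (hA : A ≠ 0) : Near φ₁ φ₂ (locA ω ω') (-s) := by
  refine ((d.right.div d.left hA).congr (.of_forall fun ℓ => ?_)).of_eq (by field_simp)
  rw [locA, add_mul, Complex.exp_add, one_mul, mul_assoc, mul_div_mul_left _ _ (Complex.exp_ne_zero _)]

theorem locA_ne_zero (d : Dominant s A φ₁ φ₂ ω ω') (hs : s ≠ 0) (hA : A ≠ 0) :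
    Ev φ₁ φ₂ fun ℓ => locA ω ω' ℓ ≠ 0 := (d.near_locA hA).ne_zero (neg_ne_zero.2 hs)

/-- `locB` is a difference of terms of size X, but the derivative of `locA` equals `locA`·(1 +
`locB`) and is O(X⁻¹), while `locA` tends to -s ≠ 0. -/
theorem near_locB (d : Dominant s A φ₁ φ₂ ω ω') (hw : IsWeber (-2 * s) ω ω') (hs : s ≠ 0)
    (hA : A ≠ 0) : Near φ₁ φ₂ (locB (-2 * s) ω ω') (-1) := by
  have hder : Ev φ₁ φ₂ fun ℓ => HasDerivAt (locA ω ω')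
      (locA ω ω' ℓ * (1 + locB (-2 * s) ω ω' ℓ)) ℓ := by
    refine ((d.ev_ne_zero hs hA).and (d.locA_ne_zero hs hA)).mono fun ℓ e => ?_
    obtain ⟨⟨e1, e2⟩, e3⟩ := e
    have he := Complex.hasDerivAt_exp ℓ
    refine (((he.mul ((hw.right _).comp ℓ he)).div ((hw.left _).comp ℓ he) e1)).congr_deriv ?_
    have h0 := Complex.exp_ne_zero ℓ
    simp only [locB, locA, Function.comp, ← exp_sq, Pi.mul_apply]
    field_simp
    ring
  have n1 := d.near_locA hA
  refine ((((n1.deriv hder).div n1 (neg_ne_zero.2 hs)).sub (Near.const 1)).congr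
    ((d.locA_ne_zero hs hA).mono fun ℓ e => ?_)).of_eq (by simp)
  field_simp
  ring

/-- The difference of the local unknowns of two solutions. -/
theorem lDiff (d : Dominant s A φ₁ φ₂ ω ω') (d₀ : Dominant s A₀ φ₁ φ₂ ω₀ ω₀')
    (hw : IsWeber (-2 * s) ω ω') (hw₀ : IsWeber (-2 * s) ω₀ ω₀') (hs : s ≠ 0) (hA : A ≠ 0)
    (hA₀ : A₀ ≠ 0) :
    LDiff (3 + 2 * s) (-2 * (ω 0 * ω₀' 0 - ω' 0 * ω₀ 0) / (s * A * A₀)) φ₁ φ₂ (locA ω ω')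
      (locB (-2 * s) ω ω') (locA ω₀ ω₀') (locB (-2 * s) ω₀ ω₀') := by
  set W := ω 0 * ω₀' 0 - ω' 0 * ω₀ 0 with hW
  have hE : ∀ ℓ, logE (3 + 2 * s) ℓ = sqX ℓ * logE (1 + 2 * s) ℓ := fun ℓ => by
    rw [← logE_add_two]; congr 1; ring
  -- The Wronskian makes this difference explicit: it is -zWe^{-z²}/(ωω₀). The difference of `locB`
  -- is larger by z², whence 3 + 2s instead of 1 + 2s.
  have nu : Near φ₁ φ₂ (fun ℓ => (locA ω ω' ℓ - locA ω₀ ω₀' ℓ) / logE (1 + 2 * s) ℓ)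
      (-W / (A * A₀)) := by
    refine (((Near.const (-W)).div (d.left.mul d₀.left) (mul_ne_zero hA hA₀)).congr
      (((d.ev_ne_zero hs hA).and (d₀.ev_ne_zero hs hA₀)).mono fun ℓ e => ?_))
    obtain ⟨⟨e1, -⟩, e2, -⟩ := e
    have hwr := hw.wronskian hw₀ (Complex.exp ℓ)
    rw [← hW, exp_sq] at hwr
    have hl : logE (1 + 2 * s) ℓ = Complex.exp ℓ * Complex.exp (s * ℓ) ^ 2 *
        Complex.exp (-sqX ℓ) := by
      rw [logE, ← Complex.exp_nat_mul, ← Complex.exp_add, ← Complex.exp_add]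
      congr 1; push_cast; ring
    have h0 := Complex.exp_ne_zero ℓ
    have h1 := Complex.exp_ne_zero (s * ℓ)
    have h2 := Complex.exp_ne_zero (-sqX ℓ)
    rw [hl]
    simp only [locA]
    field_simp
    linear_combination hwr
  have na := d.near_locA hA
  have na₀ := d₀.near_locA hA₀
  have hs' := neg_ne_zero.2 hs
  refine ⟨?_, (Near.div_sqX nu.bounded).congr (.of_forall fun ℓ => ?_)⟩
  · have n2 := (Near.div_sqX nu.bounded).neg.add
      (((nu.mul ((na.inv hs').mul (na₀.inv hs')))).const_mul (2 * s))
    refine (n2.congr (((d.locA_ne_zero hs hA).and (d₀.locA_ne_zero hs hA₀)).mono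
      fun ℓ e => ?_)).of_eq (by field_simp; ring)
    obtain ⟨e1, e2⟩ := e
    rw [hE]
    simp only [locB]
    have := sqX_ne_zero ℓ
    have := logE_ne_zero (1 + 2 * s) ℓ
    field_simp
    ring
  · rw [hE, div_div, mul_comm]

theorem hasJet {E : ℂ → ℂ} (hE : SO φ₁ φ₂ E fun _ => 1) (d : Dominant s A φ₁ φ₂ ω ω')
    (d₁ : Dominant s A₁ φ₁ φ₂ ω₁ ω₁') (d₂ : Dominant s A₂ φ₁ φ₂ ω₂ ω₂') (hs : s ≠ 0)
    (hA : A ≠ 0) (hA₁ : A₁ ≠ 0) (hA₂ : A₂ ≠ 0)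
    (j : HasJet E φ₁ φ₂ (fun ℓ => Complex.exp (s * ℓ) * ω₁ (Complex.exp ℓ))
      (fun ℓ => Complex.exp (s * ℓ) * ω₂ (Complex.exp ℓ))
      fun ℓ => Complex.exp (s * ℓ) * ω (Complex.exp ℓ))
    (j' : HasJet E φ₁ φ₂ (fun ℓ => Complex.exp ((s + 1) * ℓ) * ω₁' (Complex.exp ℓ))
      (fun ℓ => Complex.exp ((s + 1) * ℓ) * ω₂' (Complex.exp ℓ))
      fun ℓ => Complex.exp ((s + 1) * ℓ) * ω' (Complex.exp ℓ)) :
    HasJet E φ₁ φ₂ (locA ω₁ ω₁') (locA ω₂ ω₂') (locA ω ω') ∧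
    HasJet E φ₁ φ₂ (locB (-2 * s) ω₁ ω₁') (locB (-2 * s) ω₂ ω₂') (locB (-2 * s) ω ω') := by
  have hs' := neg_ne_zero.2 hs
  have key : ∀ (u v : ℂ → ℂ) (ℓ : ℂ), Complex.exp ((s + 1) * ℓ) * v (Complex.exp ℓ) *
      (Complex.exp (s * ℓ) * u (Complex.exp ℓ))⁻¹ = locA u v ℓ := fun u v ℓ => by
    rw [locA, add_mul, Complex.exp_add, one_mul, mul_assoc (Complex.exp _), ← div_eq_mul_inv,
      mul_div_mul_left _ _ (Complex.exp_ne_zero _)]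
  have jA := (j'.mul hE (j.inv_of_near d₁.left d₂.left d.left hA₁ hA₂ hA)).congr
    (.of_forall (key ω₁ ω₁')) (.of_forall (key ω₂ ω₂')) (.of_forall (key ω ω'))
  have jA' := jA.inv_of_near (d₁.near_locA hA₁) (d₂.near_locA hA₂) (d.near_locA hA) hs' hs' hs'
  have jX : HasJet E φ₁ φ₂ sqX sqX sqX := HasJet.sqX
  refine ⟨jA, (((jX.const_mul hE (-2)).add (jA.const_mul hE (-1))).add
    ((jX.const_mul hE (-2 * s)).mul hE jA')).congr (.of_forall fun ℓ => ?_)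
    (.of_forall fun ℓ => ?_) (.of_forall fun ℓ => ?_)⟩
  all_goals simp only [locB, div_eq_mul_inv]; ring

end Dominant

/-! ### Frames for the first member of the hierarchy -/

/-- `w` is `ω` in an even frame with the rotation factor `ε`, up to a factor. -/
def EvenRel (ε : ℂ) (w w' ω ω' : ℂ → ℂ) : Prop :=
  ∃ k : ℂ, k ≠ 0 ∧ ∀ z, w (ε * z) = k * ω z ∧ ε * w' (ε * z) = k * ω' z

/-- `w` is `ω` in an odd frame with the rotation factor `ε`, up to a factor. -/
def OddRel (Y ε : ℂ) (w w' ω ω' : ℂ → ℂ) : Prop :=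
  ∃ k : ℂ, k ≠ 0 ∧ ∀ z, Complex.exp (-z ^ 2) * w' (ε * z) = k * ω z ∧
    ε * Y * (Complex.exp (-z ^ 2) * w (ε * z)) = k * ω' z

/-- A quarter turn of the frame, with the coordinates transformed by `hat_psi`; `OddRel.rotate` is
the quarter turn that follows it. -/
theorem EvenRel.rotate (hs : NotInt s) {ε : ℂ} (hε : ε ^ 2 = 1)
    (h : EvenRel ε w w' (psi s A C) (psi' s A C)) :
    OddRel (-2 * s) (ε * Complex.I) w w'
      (psi (-s) ((1 - phase s ^ 4) * (C + iSqrtPi * A)) (Real.pi * A))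
      (psi' (-s) ((1 - phase s ^ 4) * (C + iSqrtPi * A)) (Real.pi * A)) := by
  obtain ⟨k, hk, h⟩ := h
  obtain ⟨c, hc, hh⟩ := hat_psi hs A C
  have hε0 : ε ≠ 0 := fun e => by simp [e] at hε
  refine ⟨ε * k * c, by simp [hε0, hk, hc], fun z => ?_⟩
  obtain ⟨h1, h2⟩ := h (Complex.I * z)
  obtain ⟨g1, g2⟩ := hh z
  rw [← mul_assoc] at h1 h2
  simp only [hat, hat'] at g1 g2
  have e1 : w' (ε * Complex.I * z) = ε * (k * psi' s A C (Complex.I * z)) := by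
    rw [← h2]; linear_combination -w' (ε * Complex.I * z) * hε
  constructor
  · linear_combination Complex.exp (-z ^ 2) * e1 + ε * k * g1
  · linear_combination ε * Complex.I * (-2 * s) * Complex.exp (-z ^ 2) * h1 + ε * k * g2

theorem OddRel.rotate (hs : NotInt s) {ε : ℂ} (hε : ε ^ 2 = -1)
    (h : OddRel (2 * s) ε w w' (psi s A C) (psi' s A C)) :
    EvenRel (ε * Complex.I) w w'
      (psi (-s) ((1 - phase s ^ 4) * (C + iSqrtPi * A)) (Real.pi * A))
      (psi' (-s) ((1 - phase s ^ 4) * (C + iSqrtPi * A)) (Real.pi * A)) := by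
  obtain ⟨k, hk, h⟩ := h
  obtain ⟨c, hc, hh⟩ := hat_psi hs A C
  have hε0 : ε ≠ 0 := fun e => by simp [e] at hε
  have hs0 := hs.ne_zero
  refine ⟨k * c / (ε * (2 * s)), by simp [hε0, hk, hc, hs0], fun z => ?_⟩
  obtain ⟨h1, h2⟩ := h (Complex.I * z)
  obtain ⟨g1, g2⟩ := hh z
  have he : -(Complex.I * z) ^ 2 = z ^ 2 := by linear_combination -z ^ 2 * Complex.I_sq
  have hz : Complex.exp (-z ^ 2) * Complex.exp (z ^ 2) = 1 := by
    rw [← Complex.exp_add]; simp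
  rw [← mul_assoc ε Complex.I, he] at h1 h2
  simp only [hat, hat'] at g1 g2
  have e1 : w' (ε * Complex.I * z) = Complex.exp (-z ^ 2) * (k * psi s A C (Complex.I * z)) := by
    rw [← h1, ← mul_assoc, hz, one_mul]
  have h2s : ε * (2 * s) ≠ 0 := by simp [hε0, hs0]
  constructor
  · rw [div_mul_eq_mul_div, eq_div_iff h2s]
    linear_combination Complex.exp (-z ^ 2) * h2 - ε * (2 * s) * w (ε * Complex.I * z) * hz + k * g1
  · rw [div_mul_eq_mul_div, eq_div_iff h2s]
    linear_combination ε ^ 2 * 2 * Complex.I * s * e1 + k * g2 +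
      2 * Complex.I * s * k * Complex.exp (-z ^ 2) * psi s A C (Complex.I * z) * hε

theorem ev_even (hw : IsWeber Y w w') (hθ : Complex.exp (θ * Complex.I) ^ 2 = 1)
    (h : EvenRel (Complex.exp (θ * Complex.I)) w w' ω ω')
    (h0 : Ev φ₁ φ₂ fun ℓ => ω (Complex.exp ℓ) ≠ 0 ∧ ω' (Complex.exp ℓ) ≠ 0) :
    Ev φ₁ φ₂ fun ℓ => (AnalyticAt ℂ (level Y w w' 0).1 (rot θ ℓ) ∧
      AnalyticAt ℂ (level Y w w' 0).2 (rot θ ℓ)) ∧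
      evenA θ (level Y w w' 0).1 ℓ = locA ω ω' ℓ ∧
      evenA θ (level Y w w' 0).2 ℓ = locB Y ω ω' ℓ := by
  refine h0.mono fun ℓ e => ?_
  obtain ⟨k, hk, h⟩ := h
  obtain ⟨h1, h2⟩ := h (Complex.exp ℓ)
  rw [← rot_eq] at h1 h2
  have hx0 := rot_ne_zero θ ℓ
  have hε := Complex.exp_ne_zero (θ * Complex.I)
  have he0 := Complex.exp_ne_zero ℓ
  have e1 : w (rot θ ℓ) ≠ 0 := by rw [h1]; exact mul_ne_zero hk e.1
  have e2 : w' (rot θ ℓ) ≠ 0 := fun h' => mul_ne_zero hk e.2 (by rw [← h2, h', mul_zero])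
  have a1 : AnalyticAt ℂ (baseY w w') (rot θ ℓ) := (hw.analyticAt_right _).div
    (hw.analyticAt_left _) e1
  have a2 : AnalyticAt ℂ (baseP Y w w') (rot θ ℓ) := ((analyticAt_const.mul analyticAt_id).sub
    ((hw.analyticAt_right _).div (hw.analyticAt_left _) e1)).add
    (analyticAt_const.mul ((hw.analyticAt_left _).div (hw.analyticAt_right _) e2))
  have v1 : (level Y w w' 0).1 = nf (baseY w w') := rfl
  have v2 : (level Y w w' 0).2 = nf (baseP Y w w') := rfl
  have hA : rot θ ℓ * (w' (rot θ ℓ) / w (rot θ ℓ)) = locA ω ω' ℓ := by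
    rw [locA, ← mul_div_mul_left (Complex.exp ℓ * ω' _) _ hk, mul_left_comm, ← h1, ← h2, rot_eq]
    ring
  have hA' : locA ω ω' ℓ ≠ 0 := by
    rw [← hA]; exact mul_ne_zero hx0 (div_ne_zero e2 e1)
  rw [v1, v2]
  refine ⟨⟨nf_analyticAt hw.meromorphic_baseY a1, nf_analyticAt hw.meromorphic_baseP a2⟩, ?_, ?_⟩
  · rw [evenA, (nf_eventuallyEq hw.meromorphic_baseY a1).self_of_nhds, baseY, hA]
  · rw [evenA, (nf_eventuallyEq hw.meromorphic_baseP a2).self_of_nhds, baseP, locB, ← hA]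
    have : sqX ℓ = rot θ ℓ ^ 2 := by rw [rot_sq, hθ, one_mul]
    rw [this]
    field_simp

/-- At the base level 2x + y + p = Yw/w', which up to rotation is the logarithmic derivative of
e^{-z²}w'; hence the first odd unknown is a `locA` again. -/
theorem ev_odd (hw : IsWeber Y w w') (hY : Y ≠ 0) (hθ : Complex.exp (θ * Complex.I) ^ 2 = -1)
    (h : OddRel Y (Complex.exp (θ * Complex.I)) w w' ω ω')
    (h0 : Ev φ₁ φ₂ fun ℓ => ω (Complex.exp ℓ) ≠ 0 ∧ ω' (Complex.exp ℓ) ≠ 0) :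
    Ev φ₁ φ₂ fun ℓ => (AnalyticAt ℂ (level Y w w' 0).1 (rot θ ℓ) ∧
      AnalyticAt ℂ (level Y w w' 0).2 (rot θ ℓ)) ∧
      oddA θ (level Y w w' 0).1 (level Y w w' 0).2 ℓ = locA ω ω' ℓ ∧
      oddB θ (level Y w w' 0).2 ℓ = locB (-Y) ω ω' ℓ := by
  refine h0.mono fun ℓ e => ?_
  obtain ⟨k, hk, h⟩ := h
  obtain ⟨h1, h2⟩ := h (Complex.exp ℓ)
  rw [← rot_eq] at h1 h2
  have hx0 := rot_ne_zero θ ℓ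
  have hε := Complex.exp_ne_zero (θ * Complex.I)
  have he0 := Complex.exp_ne_zero ℓ
  have he1 := Complex.exp_ne_zero (-Complex.exp ℓ ^ 2)
  have e2 : w' (rot θ ℓ) ≠ 0 := fun h' => mul_ne_zero hk e.1 (by rw [← h1, h', mul_zero])
  have e1 : w (rot θ ℓ) ≠ 0 := fun h' => mul_ne_zero hk e.2 (by rw [← h2, h']; simp)
  have a1 : AnalyticAt ℂ (baseY w w') (rot θ ℓ) := (hw.analyticAt_right _).div
    (hw.analyticAt_left _) e1
  have a2 : AnalyticAt ℂ (baseP Y w w') (rot θ ℓ) := ((analyticAt_const.mul analyticAt_id).sub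
    ((hw.analyticAt_right _).div (hw.analyticAt_left _) e1)).add
    (analyticAt_const.mul ((hw.analyticAt_left _).div (hw.analyticAt_right _) e2))
  have v1 : (level Y w w' 0).1 = nf (baseY w w') := rfl
  have v2 : (level Y w w' 0).2 = nf (baseP Y w w') := rfl
  have hA : rot θ ℓ * Y * (w (rot θ ℓ) / w' (rot θ ℓ)) = locA ω ω' ℓ := by
    rw [locA, ← mul_div_mul_left (Complex.exp ℓ * ω' _) _ hk, mul_left_comm, ← h1, ← h2]
    nth_rewrite 1 [rot_eq]
    field_simp
  rw [v1, v2]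
  refine ⟨⟨nf_analyticAt hw.meromorphic_baseY a1, nf_analyticAt hw.meromorphic_baseP a2⟩, ?_, ?_⟩
  · rw [oddA, (nf_eventuallyEq hw.meromorphic_baseY a1).self_of_nhds,
      (nf_eventuallyEq hw.meromorphic_baseP a2).self_of_nhds, baseY, baseP, ← hA]
    ring
  · rw [oddB, (nf_eventuallyEq hw.meromorphic_baseP a2).self_of_nhds, baseP, locB, ← hA]
    have : sqX ℓ = -rot θ ℓ ^ 2 := by rw [rot_sq, hθ]; ring
    rw [this]
    field_simp
    ring

end PainleveIV

end

noncomputable section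

namespace PainleveIV

open Topology Set Asymptotics

variable {φ₁ φ₂ θ : ℝ} {s A C c c₀ c₁ c₂ k Y κ μ : ℂ}
  {w w' w₀ w₀' w₁ w₁' w₂ w₂' ω ω' a b a₀ b₀ a' b' a₀' b₀' f₁ f₂ g : ℂ → ℂ}

/-! ### The hierarchy in the frames -/

theorem LDiff.congr (h : LDiff κ μ φ₁ φ₂ a b a₀ b₀)
    (e : Ev φ₁ φ₂ fun ℓ => a' ℓ = a ℓ ∧ b' ℓ = b ℓ)
    (e₀ : Ev φ₁ φ₂ fun ℓ => a₀' ℓ = a₀ ℓ ∧ b₀' ℓ = b₀ ℓ) : LDiff κ μ φ₁ φ₂ a' b' a₀' b₀' :=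
  ⟨h.near_b.congr ((e.and e₀).mono fun ℓ e => by rw [e.1.2, e.2.2]),
    h.near_a.congr ((e.and e₀).mono fun ℓ e => by rw [e.1.1, e.2.1])⟩

theorem SO.rot_inv (θ : ℝ) : SO φ₁ φ₂ (fun ℓ => (rot θ ℓ)⁻¹) fun _ => 1 := by
  intro θ₁ θ₂ _ _
  refine IsBigO.of_bound 1 (eventually_strip.2 ⟨0, fun ℓ h _ _ => ?_⟩)
  rw [rot, norm_inv, Complex.norm_exp]
  simpa using inv_le_one_of_one_le₀ (Real.one_le_exp h)

/-- The jet is measured with the exponential of the Weber level. Passing to the larger exponential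
of a higher level only divides by powers of X. -/
theorem HasJet.crude {m : ℕ} (h : HasJet (logE κ) φ₁ φ₂ f₁ f₂ g) :
    ∃ N : ℕ, SO φ₁ φ₂ (fun ℓ => (f₁ ℓ + f₂ ℓ - 2 * g ℓ) / logE (κ + 2 * m) ℓ ^ 2)
      fun ℓ => PainleveIV.sqX ℓ ^ N := by
  obtain ⟨N, h⟩ := h
  have hE : ∀ (m : ℕ) (ℓ : ℂ), logE (κ + 2 * m) ℓ = PainleveIV.sqX ℓ ^ m * logE κ ℓ := by
    intro m ℓ
    rw [logE, logE, PainleveIV.sqX, ← Complex.exp_nat_mul, ← Complex.exp_add]; congr 1; ring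
  have h1 : SO φ₁ φ₂ (fun ℓ => (PainleveIV.sqX ℓ ^ m)⁻¹) fun _ => 1 :=
    (((SO.one_pow m).mul (SO.refl fun ℓ => (PainleveIV.sqX ℓ ^ m)⁻¹)).congr_left fun ℓ => one_mul _).congr_right
      fun ℓ => mul_inv_cancel₀ (pow_ne_zero _ (sqX_ne_zero ℓ))
  refine ⟨N, ((((h.second.mul h1).mul h1).mul (SO.refl fun ℓ => (logE κ ℓ ^ 2)⁻¹)).congr_left
    fun ℓ => ?_).congr_right fun ℓ => ?_⟩
  · have := pow_ne_zero m (sqX_ne_zero ℓ)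
    have := logE_ne_zero κ ℓ
    rw [hE]
    field_simp
  · have := logE_ne_zero κ ℓ
    field_simp

/-- `psi s 1 c` is affine in c, so its second difference at the midpoint is exactly zero; terms of
order E² arise only from the quotients. -/
theorem hasJet_psi (h : NotInt s) (hc : c₁ + c₂ = 2 * c) :
    HasJet (logE (2 * s - 1)) (-Real.pi / 4) (Real.pi / 4) (locA (psi s 1 c₁) (psi' s 1 c₁))
      (locA (psi s 1 c₂) (psi' s 1 c₂)) (locA (psi s 1 c) (psi' s 1 c)) ∧
    HasJet (logE (2 * s - 1)) (-Real.pi / 4) (Real.pi / 4)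
      (locB (-2 * s) (psi s 1 c₁) (psi' s 1 c₁)) (locB (-2 * s) (psi s 1 c₂) (psi' s 1 c₂))
      (locB (-2 * s) (psi s 1 c) (psi' s 1 c)) := by
  have hpi := Real.pi_pos
  obtain ⟨z1, z2⟩ := SO_exp_psi0 h
  have z1 := z1.mono_sector (ψ₁ := -Real.pi / 4) (ψ₂ := Real.pi / 4) (by linarith) (by linarith)
  have z2 := z2.mono_sector (ψ₁ := -Real.pi / 4) (ψ₂ := Real.pi / 4) (by linarith) (by linarith)
  have hd := fun c => dominant_psi h 1 c
  have zero : ∀ G : ℂ → ℂ, SO (-Real.pi / 4) (Real.pi / 4) (fun _ => 0) G :=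
    fun G _ _ _ _ => isBigO_zero _ _
  have hE : ∀ ℓ, logE (2 * s + 1) ℓ = logE (2 * s - 1) ℓ * sqX ℓ ^ 1 := fun ℓ => by
    rw [pow_one, mul_comm (logE _ _), ← logE_add_two]; congr 1; ring
  have z1' : SO (-Real.pi / 4) (Real.pi / 4) (fun ℓ => Complex.exp (s * ℓ) * psi0 s (Complex.exp ℓ))
      fun ℓ => logE (2 * s - 1) ℓ * sqX ℓ ^ 1 :=
    ((z1.mul (SO.one_pow 1)).congr_left fun ℓ => mul_one _)
  have z2' := z2.congr_right hE
  refine Dominant.hasJet (SO_logE _) (hd c) (hd c₁) (hd c₂) h.ne_zero one_ne_zero one_ne_zero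
    one_ne_zero ⟨1, ?_, ?_, ?_, ?_⟩ ⟨1, ?_, ?_, ?_, ?_⟩
  · refine (z1'.const_mul (c₁ - c)).congr_left fun ℓ => ?_
    simp only [psi]; ring
  · refine (z1'.const_mul (c₂ - c)).congr_left fun ℓ => ?_
    simp only [psi]; ring
  · refine (zero _).congr_left fun ℓ => ?_
    simp only [psi]
    linear_combination -Complex.exp (s * ℓ) * psi0 s (Complex.exp ℓ) * hc
  · exact (hd c).left.bounded.trans (SO.one_pow 1)
  · refine (z2'.const_mul (c₁ - c)).congr_left fun ℓ => ?_
    simp only [psi']; ring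
  · refine (z2'.const_mul (c₂ - c)).congr_left fun ℓ => ?_
    simp only [psi']; ring
  · refine (zero _).congr_left fun ℓ => ?_
    simp only [psi']
    linear_combination -Complex.exp ((s + 1) * ℓ) * psi0' s (Complex.exp ℓ) * hc
  · exact (hd c).right.bounded.trans (SO.one_pow 1)

theorem EvenRel.initial_ne_zero {ε : ℂ} (h : EvenRel ε w w' ω ω') (h0 : ω 0 ≠ 0 ∨ ω' 0 ≠ 0) :
    w 0 ≠ 0 ∨ w' 0 ≠ 0 := by
  obtain ⟨k, hk, h⟩ := h
  obtain ⟨h1, h2⟩ := h 0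
  rw [mul_zero] at h1 h2
  refine h0.imp (fun e e' => mul_ne_zero hk e (by rw [← h1, e'])) fun e e' =>
    mul_ne_zero hk e (by rw [← h2, e', mul_zero])

theorem OddRel.initial_ne_zero {ε : ℂ} (h : OddRel Y ε w w' ω ω') (h0 : ω 0 ≠ 0 ∨ ω' 0 ≠ 0) :
    w 0 ≠ 0 ∨ w' 0 ≠ 0 := by
  obtain ⟨k, hk, h⟩ := h
  obtain ⟨h1, h2⟩ := h 0
  rw [mul_zero] at h1 h2
  refine h0.symm.imp (fun e e' => mul_ne_zero hk e (by rw [← h2, e']; simp)) fun e e' =>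
    mul_ne_zero hk e (by rw [← h1, e', mul_zero])

theorem EvenRel.normalize {ε : ℂ} (h : EvenRel ε w w' (psi s A C) (psi' s A C)) (hA : A ≠ 0)
    (hc : C = c * A) : EvenRel ε w w' (psi s 1 c) (psi' s 1 c) := by
  obtain ⟨k, hk, h⟩ := h
  refine ⟨k * A, mul_ne_zero hk hA, fun z => ?_⟩
  rw [(h z).1, (h z).2, psi, psi, psi', psi', hc]
  constructor <;> ring

theorem OddRel.normalize {ε : ℂ} (h : OddRel Y ε w w' (psi s A C) (psi' s A C)) (hA : A ≠ 0)
    (hc : C = c * A) : OddRel Y ε w w' (psi s 1 c) (psi' s 1 c) := by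
  obtain ⟨k, hk, h⟩ := h
  refine ⟨k * A, mul_ne_zero hk hA, fun z => ?_⟩
  rw [(h z).1, (h z).2, psi, psi, psi', psi', hc]
  constructor <;> ring

theorem NotInt.hierarchy_neg (h : NotInt s) (m : ℕ) : -2 * s + 2 * m ≠ 0 := fun e => h m (by
  push_cast; linear_combination (-1 / 2) * e)

theorem NotInt.hierarchy (h : NotInt s) (m : ℕ) : 2 * s + 2 * m ≠ 0 := fun e => h (-m) (by
  push_cast; linear_combination (1 / 2) * e)

theorem evenFrame_base (h : NotInt s) (hw : IsWeber (-2 * s) w w')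
    (hθ : Complex.exp (θ * Complex.I) ^ 2 = 1)
    (hr : EvenRel (Complex.exp (θ * Complex.I)) w w' (psi s 1 c) (psi' s 1 c))
    (d : Dominant s 1 φ₁ φ₂ (psi s 1 c) (psi' s 1 c)) :
    EvenFrame (-2 * s) 2 θ φ₁ φ₂ (level (-2 * s) w w' 0).1 (level (-2 * s) w w' 0).2 := by
  have hs := h.ne_zero
  have he := ev_even hw hθ hr (d.ev_ne_zero hs one_ne_zero)
  refine ⟨hθ, hw.isTriple_base (mul_ne_zero (by norm_num) hs) (hr.initial_ne_zero
    (psi_initial_ne_zero h (.inl one_ne_zero))), he.mono fun _ e => e.1, ?_, ?_⟩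
  · exact ((d.near_locA one_ne_zero).congr (he.mono fun _ e => e.2.1.symm)).of_eq (by ring)
  · exact ((d.near_locB (h.isWeber_psi 1 c) hs one_ne_zero).congr
      (he.mono fun _ e => e.2.2.symm)).of_eq (by norm_num)

theorem oddFrame_base (h : NotInt s) (hw : IsWeber (2 * s) w w')
    (hθ : Complex.exp (θ * Complex.I) ^ 2 = -1)
    (hr : OddRel (2 * s) (Complex.exp (θ * Complex.I)) w w' (psi s 1 c) (psi' s 1 c))
    (d : Dominant s 1 φ₁ φ₂ (psi s 1 c) (psi' s 1 c)) :
    OddFrame (2 * s) 2 θ φ₁ φ₂ (level (2 * s) w w' 0).1 (level (2 * s) w w' 0).2 := by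
  have hs := h.ne_zero
  have hY : 2 * s ≠ 0 := mul_ne_zero two_ne_zero hs
  have he := ev_odd hw hY hθ hr (d.ev_ne_zero hs one_ne_zero)
  rw [← neg_mul] at he
  refine ⟨hθ, hw.isTriple_base hY (hr.initial_ne_zero
    (psi_initial_ne_zero h (.inl one_ne_zero))), he.mono fun _ e => e.1, ?_, ?_⟩
  · exact ((d.near_locA one_ne_zero).congr (he.mono fun _ e => e.2.1.symm)).of_eq (by ring)
  · exact ((d.near_locB (h.isWeber_psi 1 c) hs one_ne_zero).congr
      (he.mono fun _ e => e.2.2.symm)).of_eq (by norm_num)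

/-- The Wronskian of the two members is (c₀ - c) times that of `psiM` and `psi0`, and sΓ(s) = Γ(s +
1). -/
theorem lDiff_psi (h : NotInt s) (c c₀ : ℂ) :
    LDiff (3 + 2 * s) (4 * (c₀ - c) * 2 ^ s / Complex.Gamma (s + 1)) (-Real.pi / 4) (Real.pi / 4)
      (locA (psi s 1 c) (psi' s 1 c)) (locB (-2 * s) (psi s 1 c) (psi' s 1 c))
      (locA (psi s 1 c₀) (psi' s 1 c₀)) (locB (-2 * s) (psi s 1 c₀) (psi' s 1 c₀)) := by
  have hd := (dominant_psi h 1 c).lDiff (dominant_psi h 1 c₀) (h.isWeber_psi 1 c)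
    (h.isWeber_psi 1 c₀) h.ne_zero one_ne_zero one_ne_zero
  convert hd using 1
  have := h.ne_zero
  have := h.gamma_ne_zero
  rw [wronskian_psi h, h.gamma_add_one]
  field_simp
  ring

theorem two_cpow_add_nat (s : ℂ) (n : ℕ) : (2 : ℂ) ^ (s + n) = 2 ^ s * 2 ^ n := by
  rw [Complex.cpow_add _ _ two_ne_zero, Complex.cpow_natCast]

theorem evenFrame_level (h : NotInt s) (hθ : Complex.exp (θ * Complex.I) ^ 2 = 1)
    (hw : IsWeber (-2 * s) w w')
    (hr : EvenRel (Complex.exp (θ * Complex.I)) w w' (psi s 1 c) (psi' s 1 c))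
    (d : Dominant s 1 φ₁ φ₂ (psi s 1 c) (psi' s 1 c)) (n : ℕ) :
    EvenFrame (-2 * s) (2 * n + 2) θ φ₁ φ₂ (level (-2 * s) w w' n).1 (level (-2 * s) w w' n).2 :=
  (evenFrame_base h hw hθ hr d).level h.hierarchy_neg n

theorem lDiff_even_level (h : NotInt s) (hθ : Complex.exp (θ * Complex.I) ^ 2 = 1)
    (hw : IsWeber (-2 * s) w w') (hw₀ : IsWeber (-2 * s) w₀ w₀')
    (hr : EvenRel (Complex.exp (θ * Complex.I)) w w' (psi s 1 c) (psi' s 1 c))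
    (hr₀ : EvenRel (Complex.exp (θ * Complex.I)) w₀ w₀' (psi s 1 c₀) (psi' s 1 c₀)) (n : ℕ) :
    LDiff (3 + 2 * s + 2 * n)
      (4 * (c₀ - c) * 2 ^ s / Complex.Gamma (s + 1) * 2 ^ n / n.factorial) (-Real.pi / 4)
      (Real.pi / 4) (evenA θ (level (-2 * s) w w' n).1) (evenA θ (level (-2 * s) w w' n).2)
      (evenA θ (level (-2 * s) w₀ w₀' n).1) (evenA θ (level (-2 * s) w₀ w₀' n).2) := by
  have hs := h.ne_zero
  have d := dominant_psi h 1 c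
  have d₀ := dominant_psi h 1 c₀
  exact EvenFrame.lDiff_level h.hierarchy_neg (evenFrame_base h hw hθ hr d)
    (evenFrame_base h hw₀ hθ hr₀ d₀) ((lDiff_psi h c c₀).congr
      ((ev_even hw hθ hr (d.ev_ne_zero hs one_ne_zero)).mono fun _ e => e.2)
      ((ev_even hw₀ hθ hr₀ (d₀.ev_ne_zero hs one_ne_zero)).mono fun _ e => e.2)) n

/-- The exponentially small difference of two solutions in an even frame. -/
theorem near_even_level (h : NotInt s) (hθ : Complex.exp (θ * Complex.I) ^ 2 = 1)
    (hw : IsWeber (-2 * s) w w') (hw₀ : IsWeber (-2 * s) w₀ w₀')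
    (hr : EvenRel (Complex.exp (θ * Complex.I)) w w' (psi s 1 c) (psi' s 1 c))
    (hr₀ : EvenRel (Complex.exp (θ * Complex.I)) w₀ w₀' (psi s 1 c₀) (psi' s 1 c₀)) (n : ℕ) :
    Near (-Real.pi / 4) (Real.pi / 4) (fun ℓ => ((level (-2 * s) w w' n).1 (rot θ ℓ) -
        (level (-2 * s) w₀ w₀' n).1 (rot θ ℓ)) / logE (2 * s + 2 * n) ℓ)
      (Complex.exp (θ * Complex.I) *
        (2 * (c₀ - c) * 2 ^ (s + n) / (n.factorial * Complex.Gamma s))) := by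
  -- Here y = a/x, and the difference of a is an order X below that of b, so its refined leading
  -- term is needed. Its factor -Y/4 = s/2 turns Γ(s + 1) into Γ(s).
  have hd := (lDiff_even_level h hθ hw hw₀ hr hr₀ n).near_mul_a
    (evenFrame_level h hθ hw hr (dominant_psi h 1 c) n).loc
    (evenFrame_level h hθ hw₀ hr₀ (dominant_psi h 1 c₀) n).loc
  refine ((hd.const_mul (Complex.exp (θ * Complex.I))).congr (.of_forall fun ℓ => ?_)).of_eq ?_
  · have hE : logE (3 + 2 * s + 2 * n) ℓ = Complex.exp ℓ * sqX ℓ * logE (2 * s + 2 * n) ℓ := by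
      rw [logE, logE, sqX, ← Complex.exp_add, ← Complex.exp_add]; congr 1; ring
    have h1 := Complex.exp_ne_zero ℓ
    have h2 := sqX_ne_zero ℓ
    have h3 := logE_ne_zero (2 * s + 2 * n) ℓ
    rw [hE, evenA, evenA]
    generalize (level (-2 * s) w w' n).1 (rot θ ℓ) = y
    generalize (level (-2 * s) w₀ w₀' n).1 (rot θ ℓ) = y₀
    generalize logE (2 * s + 2 * n) ℓ = E at *
    rw [rot_eq]
    field_simp
    linear_combination (y - y₀) * hθ
  · have := h.ne_zero
    have := h.gamma_ne_zero
    have h2 : (n.factorial : ℂ) ≠ 0 := by exact_mod_cast n.factorial_ne_zero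
    rw [h.gamma_add_one, two_cpow_add_nat]
    field_simp

/-- The second difference of three solutions in an even frame. -/
theorem second_even_level (h : NotInt s) (hθ : Complex.exp (θ * Complex.I) ^ 2 = 1)
    (hw : IsWeber (-2 * s) w w') (hw₁ : IsWeber (-2 * s) w₁ w₁')
    (hw₂ : IsWeber (-2 * s) w₂ w₂')
    (hr : EvenRel (Complex.exp (θ * Complex.I)) w w' (psi s 1 c) (psi' s 1 c))
    (hr₁ : EvenRel (Complex.exp (θ * Complex.I)) w₁ w₁' (psi s 1 c₁) (psi' s 1 c₁))
    (hr₂ : EvenRel (Complex.exp (θ * Complex.I)) w₂ w₂' (psi s 1 c₂) (psi' s 1 c₂))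
    (hc : c₁ + c₂ = 2 * c) (n : ℕ) :
    SO (-Real.pi / 4) (Real.pi / 4) (fun ℓ => ((level (-2 * s) w₁ w₁' n).1 (rot θ ℓ) +
        (level (-2 * s) w₂ w₂' n).1 (rot θ ℓ) - 2 * (level (-2 * s) w w' n).1 (rot θ ℓ)) /
          logE (2 * s + 2 * n) ℓ ^ 2) fun _ => 1 := by
  have hs := h.ne_zero
  have hd := fun c => dominant_psi h 1 c
  have e := ev_even hw hθ hr ((hd c).ev_ne_zero hs one_ne_zero)
  have e₁ := ev_even hw₁ hθ hr₁ ((hd c₁).ev_ne_zero hs one_ne_zero)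
  have e₂ := ev_even hw₂ hθ hr₂ ((hd c₂).ev_ne_zero hs one_ne_zero)
  obtain ⟨ja, jb⟩ := hasJet_psi h hc
  obtain ⟨ja, jb⟩ := EvenFrame.hasJet_level (SO_logE _) h.hierarchy_neg
    (evenFrame_base h hw hθ hr (hd c)) (evenFrame_base h hw₁ hθ hr₁ (hd c₁))
    (evenFrame_base h hw₂ hθ hr₂ (hd c₂))
    (ja.congr (e₁.mono fun _ e => e.2.1.symm) (e₂.mono fun _ e => e.2.1.symm)
      (e.mono fun _ e => e.2.1.symm))
    (jb.congr (e₁.mono fun _ e => e.2.2.symm) (e₂.mono fun _ e => e.2.2.symm)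
      (e.mono fun _ e => e.2.2.symm)) n
  -- The shift raises the exponent 2s - 1 of `psi0` to the exponent 3 + 2s + 2n of the differences
  -- at level n.
  obtain ⟨N, ca⟩ := ja.crude (m := n + 2)
  obtain ⟨M, cb⟩ := jb.crude (m := n + 2)
  have hκ : 2 * s - 1 + 2 * ((n + 2 : ℕ) : ℂ) = 3 + 2 * s + 2 * n := by push_cast; ring
  rw [hκ] at ca cb
  -- Since c is the midpoint of c₁ and c₂, the two multipliers are opposite, as `second_difference`
  -- requires.
  have d₂ := lDiff_even_level h hθ hw₂ hw hr₂ hr n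
  rw [show c - c₂ = -(c - c₁) by linear_combination -hc] at d₂
  have hsd := (second_difference (evenFrame_level h hθ hw hr (hd c) n).loc
    (evenFrame_level h hθ hw₁ hr₁ (hd c₁) n).loc (evenFrame_level h hθ hw₂ hr₂ (hd c₂) n).loc
    (lDiff_even_level h hθ hw₁ hw hr₁ hr n) (by convert d₂ using 1; ring)
    (ca.trans (SO.pow_mono (le_max_left N M))) (cb.trans (SO.pow_mono (le_max_right N M)))).1
  refine ((((hsd.mul (SO.refl fun ℓ => sqX ℓ ^ 3)).mul (SO.rot_inv θ)).congr_left
    fun ℓ => ?_).congr_right fun ℓ => ?_)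
  · have hE : logE (3 + 2 * s + 2 * n) ℓ ^ 2 = sqX ℓ ^ 3 * logE (2 * s + 2 * n) ℓ ^ 2 := by
      simp only [logE, sqX, ← Complex.exp_nat_mul, ← Complex.exp_add]; congr 1; push_cast; ring
    have h1 := rot_ne_zero θ ℓ
    have h2 := sqX_ne_zero ℓ
    have h3 := logE_ne_zero (2 * s + 2 * n) ℓ
    rw [hE, evenA, evenA, evenA]
    field_simp
  · have h2 := sqX_ne_zero ℓ
    field_simp

theorem oddFrame_level (h : NotInt s) (hθ : Complex.exp (θ * Complex.I) ^ 2 = -1)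
    (hw : IsWeber (2 * s) w w')
    (hr : OddRel (2 * s) (Complex.exp (θ * Complex.I)) w w' (psi s 1 c) (psi' s 1 c))
    (d : Dominant s 1 φ₁ φ₂ (psi s 1 c) (psi' s 1 c)) (n : ℕ) :
    OddFrame (2 * s) (2 * n + 2) θ φ₁ φ₂ (level (2 * s) w w' n).1 (level (2 * s) w w' n).2 :=
  (oddFrame_base h hw hθ hr d).level h.hierarchy n

theorem lDiff_odd_level (h : NotInt s) (hθ : Complex.exp (θ * Complex.I) ^ 2 = -1)
    (hw : IsWeber (2 * s) w w') (hw₀ : IsWeber (2 * s) w₀ w₀')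
    (hr : OddRel (2 * s) (Complex.exp (θ * Complex.I)) w w' (psi s 1 c) (psi' s 1 c))
    (hr₀ : OddRel (2 * s) (Complex.exp (θ * Complex.I)) w₀ w₀' (psi s 1 c₀) (psi' s 1 c₀))
    (n : ℕ) :
    LDiff (3 + 2 * s + 4 * n)
      (4 * (c₀ - c) * 2 ^ s * 4 ^ n / (n.factorial * Complex.Gamma (n + 1 + s))) (-Real.pi / 4)
      (Real.pi / 4)
      (oddA θ (level (2 * s) w w' n).1 (level (2 * s) w w' n).2) (oddB θ (level (2 * s) w w' n).2)
      (oddA θ (level (2 * s) w₀ w₀' n).1 (level (2 * s) w₀ w₀' n).2)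
      (oddB θ (level (2 * s) w₀ w₀' n).2) := by
  have hs := h.ne_zero
  have d := dominant_psi h 1 c
  have d₀ := dominant_psi h 1 c₀
  have hY : 2 * s ≠ 0 := mul_ne_zero two_ne_zero hs
  have e := ev_odd hw hY hθ hr (d.ev_ne_zero hs one_ne_zero)
  have e₀ := ev_odd hw₀ hY hθ hr₀ (d₀.ev_ne_zero hs one_ne_zero)
  rw [← neg_mul] at e e₀
  have := OddFrame.lDiff_level h.hierarchy (oddFrame_base h hw hθ hr d)
    (oddFrame_base h hw₀ hθ hr₀ d₀) ((lDiff_psi h c c₀).congr (e.mono fun _ e => e.2)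
      (e₀.mono fun _ e => e.2)) n
  convert this using 1
  have h1 : Complex.Gamma (s + 1) ≠ 0 := by
    rw [h.gamma_add_one]; exact mul_ne_zero hs h.gamma_ne_zero
  rw [mul_div_cancel_left₀ s two_ne_zero, add_comm 1 s]
  field_simp

/-- The exponentially small difference of two solutions in an odd frame. -/
theorem near_odd_level (h : NotInt s) (hθ : Complex.exp (θ * Complex.I) ^ 2 = -1)
    (hw : IsWeber (2 * s) w w') (hw₀ : IsWeber (2 * s) w₀ w₀')
    (hr : OddRel (2 * s) (Complex.exp (θ * Complex.I)) w w' (psi s 1 c) (psi' s 1 c))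
    (hr₀ : OddRel (2 * s) (Complex.exp (θ * Complex.I)) w₀ w₀' (psi s 1 c₀) (psi' s 1 c₀))
    (n : ℕ) :
    Near (-Real.pi / 4) (Real.pi / 4) (fun ℓ => ((level (2 * s) w w' n).1 (rot θ ℓ) -
        (level (2 * s) w₀ w₀' n).1 (rot θ ℓ)) / logE (2 + 2 * s + 4 * n) ℓ)
      (-Complex.exp (θ * Complex.I) *
        (2 * (c₀ - c) * 2 ^ (1 + 2 * n + s) / (n.factorial * Complex.Gamma (n + 1 + s)))) := by
  have hd := lDiff_odd_level h hθ hw hw₀ hr hr₀ n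
  -- In an odd frame y = (a + b)/x - 2x, so the difference of b enters directly and dominates.
  refine (((hd.near_a.add hd.near_b).const_mul (-Complex.exp (θ * Complex.I))).congr
    (.of_forall fun ℓ => ?_)).of_eq ?_
  · have hE : logE (3 + 2 * s + 4 * n) ℓ = Complex.exp ℓ * logE (2 + 2 * s + 4 * n) ℓ := by
      rw [logE, logE, ← Complex.exp_add]; congr 1; ring
    have h1 := Complex.exp_ne_zero ℓ
    have h3 := logE_ne_zero (2 + 2 * s + 4 * n) ℓ
    rw [hE]
    simp only [oddA, oddB]
    generalize (level (2 * s) w w' n).1 (rot θ ℓ) = y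
    generalize (level (2 * s) w₀ w₀' n).1 (rot θ ℓ) = y₀
    generalize (level (2 * s) w w' n).2 (rot θ ℓ) = p
    generalize (level (2 * s) w₀ w₀' n).2 (rot θ ℓ) = p₀
    generalize logE (2 + 2 * s + 4 * n) ℓ = E at *
    rw [rot_eq]
    field_simp
    linear_combination -(y - y₀) * hθ
  · have e : (2 : ℂ) ^ (1 + 2 * n + s) = 2 * (2 ^ s * 4 ^ n) := by
      rw [show (1 + 2 * n + s : ℂ) = s + (2 * n + 1 : ℕ) by push_cast; ring, two_cpow_add_nat,
        pow_succ, pow_mul]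
      norm_num
      ring
    rw [e]
    ring

/-- The second difference of three solutions in an odd frame. -/
theorem second_odd_level (h : NotInt s) (hθ : Complex.exp (θ * Complex.I) ^ 2 = -1)
    (hw : IsWeber (2 * s) w w') (hw₁ : IsWeber (2 * s) w₁ w₁')
    (hw₂ : IsWeber (2 * s) w₂ w₂')
    (hr : OddRel (2 * s) (Complex.exp (θ * Complex.I)) w w' (psi s 1 c) (psi' s 1 c))
    (hr₁ : OddRel (2 * s) (Complex.exp (θ * Complex.I)) w₁ w₁' (psi s 1 c₁) (psi' s 1 c₁))
    (hr₂ : OddRel (2 * s) (Complex.exp (θ * Complex.I)) w₂ w₂' (psi s 1 c₂) (psi' s 1 c₂))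
    (hc : c₁ + c₂ = 2 * c) (n : ℕ) :
    SO (-Real.pi / 4) (Real.pi / 4) (fun ℓ => ((level (2 * s) w₁ w₁' n).1 (rot θ ℓ) +
        (level (2 * s) w₂ w₂' n).1 (rot θ ℓ) - 2 * (level (2 * s) w w' n).1 (rot θ ℓ)) /
          logE (2 + 2 * s + 4 * n) ℓ ^ 2) fun _ => 1 := by
  have hs := h.ne_zero
  have hY : 2 * s ≠ 0 := mul_ne_zero two_ne_zero hs
  have hd := fun c => dominant_psi h 1 c
  have e := ev_odd hw hY hθ hr ((hd c).ev_ne_zero hs one_ne_zero)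
  have e₁ := ev_odd hw₁ hY hθ hr₁ ((hd c₁).ev_ne_zero hs one_ne_zero)
  have e₂ := ev_odd hw₂ hY hθ hr₂ ((hd c₂).ev_ne_zero hs one_ne_zero)
  rw [← neg_mul] at e e₁ e₂
  obtain ⟨ja, jb⟩ := hasJet_psi h hc
  obtain ⟨ja, jb⟩ := OddFrame.hasJet_level (SO_logE _) h.hierarchy
    (oddFrame_base h hw hθ hr (hd c)) (oddFrame_base h hw₁ hθ hr₁ (hd c₁))
    (oddFrame_base h hw₂ hθ hr₂ (hd c₂))
    (ja.congr (e₁.mono fun _ e => e.2.1.symm) (e₂.mono fun _ e => e.2.1.symm)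
      (e.mono fun _ e => e.2.1.symm))
    (jb.congr (e₁.mono fun _ e => e.2.2.symm) (e₂.mono fun _ e => e.2.2.symm)
      (e.mono fun _ e => e.2.2.symm)) n
  obtain ⟨N, ca⟩ := ja.crude (m := 2 * n + 2)
  obtain ⟨M, cb⟩ := jb.crude (m := 2 * n + 2)
  have hκ : 2 * s - 1 + 2 * ((2 * n + 2 : ℕ) : ℂ) = 3 + 2 * s + 4 * n := by push_cast; ring
  rw [hκ] at ca cb
  have d₂ := lDiff_odd_level h hθ hw₂ hw hr₂ hr n
  rw [show c - c₂ = -(c - c₁) by linear_combination -hc] at d₂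
  have hsd := second_difference (oddFrame_level h hθ hw hr (hd c) n).loc
    (oddFrame_level h hθ hw₁ hr₁ (hd c₁) n).loc (oddFrame_level h hθ hw₂ hr₂ (hd c₂) n).loc
    (lDiff_odd_level h hθ hw₁ hw hr₁ hr n) (by convert d₂ using 1; ring)
    (ca.trans (SO.pow_mono (le_max_left N M))) (cb.trans (SO.pow_mono (le_max_right N M)))
  have hX2 := (SO.sqX_inv (φ₁ := -Real.pi / 4) (φ₂ := Real.pi / 4)).mul SO.sqX_inv
  have ha := (hsd.1.congr_right (h := fun ℓ => (sqX ℓ)⁻¹ * ((sqX ℓ)⁻¹ * (sqX ℓ)⁻¹))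
    fun ℓ => by ring).trans ((SO.refl _).mul hX2)
  have hab := (ha.congr_right (h := fun ℓ => (sqX ℓ)⁻¹) fun ℓ => by ring).add hsd.2
  refine ((((hab.mul (SO.refl sqX)).mul (SO.rot_inv θ)).congr_left
    fun ℓ => ?_).congr_right fun ℓ => ?_)
  · have hE : logE (3 + 2 * s + 4 * n) ℓ ^ 2 = sqX ℓ * logE (2 + 2 * s + 4 * n) ℓ ^ 2 := by
      simp only [logE, sqX, ← Complex.exp_nat_mul, ← Complex.exp_add]; congr 1; push_cast; ring
    have h1 := rot_ne_zero θ ℓ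
    have h2 := sqX_ne_zero ℓ
    have h3 := logE_ne_zero (2 + 2 * s + 4 * n) ℓ
    rw [hE]
    simp only [oddA, oddB]
    field_simp
    ring
  · have h2 := sqX_ne_zero ℓ
    field_simp

end PainleveIV

end

noncomputable section

namespace PainleveIV

open Topology Set Asymptotics

variable {φ₁ φ₂ θ : ℝ} {s c k Y α β : ℂ} {n : ℕ} {μ : ℝ → ℂ}
  {w w' v v' w₁ w₁' w₂ w₂' f g y B : ℂ → ℂ}

/-! ### From the coordinate `ℓ` to polar coordinates -/

theorem SO.shift (h : SO φ₁ φ₂ f g) (θ : ℝ) :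
    SO (φ₁ + θ) (φ₂ + θ) (fun L => f (L - θ * Complex.I)) fun L => g (L - θ * Complex.I) := by
  intro θ₁ θ₂ h1 h2
  have ht : Tendsto (fun L : ℂ => L - θ * Complex.I) (strip θ₁ θ₂) (strip (θ₁ - θ) (θ₂ - θ)) := by
    have := tendsto_add_strip θ₁ θ₂ (-θ)
    simpa [sub_eq_add_neg] using this
  exact (h (θ₁ - θ) (θ₂ - θ) (by linarith) (by linarith)).comp_tendsto ht

theorem Near.shift (h : Near φ₁ φ₂ f k) (θ : ℝ) :
    Near (φ₁ + θ) (φ₂ + θ) (fun L => f (L - θ * Complex.I)) k := by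
  refine SO.trans (SO.shift h θ) (((SO.refl fun L => (sqX L)⁻¹).const_mul
    (Complex.exp (2 * (θ * Complex.I)))).congr_left fun L => ?_)
  rw [Near.sqX_inv_eq, Near.sqX_inv_eq, ← Complex.exp_add]; congr 1; ring

theorem rot_sub (θ : ℝ) (L : ℂ) : rot θ (L - θ * Complex.I) = Complex.exp L := by
  rw [rot, sub_add_cancel]

/-- The logarithm of `r e^{iφ}`. -/
def logPt (r φ : ℝ) : ℂ := (Real.log r : ℂ) + (φ : ℂ) * Complex.I

theorem pt_eq {r : ℝ} (hr : 0 < r) (φ : ℝ) : pt r φ = Complex.exp (logPt r φ) := by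
  rw [pt, logPt, Complex.exp_add, ← Complex.ofReal_exp, Real.exp_log hr]

theorem norm_pt {r : ℝ} (hr : 0 < r) (φ : ℝ) : ‖pt r φ‖ = r := by
  rw [pt, norm_mul, Complex.norm_exp_ofReal_mul_I, mul_one, Complex.norm_real, Real.norm_eq_abs,
    abs_of_pos hr]

theorem norm_sqX_logPt_inv {r : ℝ} (hr : 0 < r) (φ : ℝ) : ‖(sqX (logPt r φ))⁻¹‖ = r⁻¹ ^ 2 := by
  rw [← exp_sq, ← pt_eq hr, norm_inv, norm_pow, norm_pt hr, inv_pow]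

theorem SO.exists_bound (h : SO φ₁ φ₂ f g) {θ₁ θ₂ : ℝ} (h1 : φ₁ < θ₁) (h2 : θ₂ < φ₂) :
    ∃ C R : ℝ, 0 ≤ C ∧ 0 < R ∧ ∀ r φ : ℝ, R ≤ r → θ₁ ≤ φ → φ ≤ θ₂ →
      ‖f (logPt r φ)‖ ≤ C * ‖g (logPt r φ)‖ := by
  obtain ⟨C, hC, hb⟩ := (h θ₁ θ₂ h1 h2).exists_nonneg
  obtain ⟨R, hR⟩ := eventually_strip.1 hb.bound
  refine ⟨C, Real.exp R, hC, Real.exp_pos _, fun r φ hr e1 e2 => hR _ ?_ ?_ ?_⟩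
  · simpa [logPt] using (Real.le_log_iff_exp_le ((Real.exp_pos R).trans_le hr)).2 hr
  · simpa [logPt] using e1
  · simpa [logPt] using e2

theorem Near.exists_bound (h : Near φ₁ φ₂ f k) {θ₁ θ₂ : ℝ} (h1 : φ₁ < θ₁) (h2 : θ₂ < φ₂) :
    ∃ C R : ℝ, 0 ≤ C ∧ 0 < R ∧ ∀ r φ : ℝ, R ≤ r → θ₁ ≤ φ → φ ≤ θ₂ →
      ‖f (logPt r φ) - k‖ ≤ C * r⁻¹ ^ 2 := by
  obtain ⟨C, R, hC, hR, hb⟩ := SO.exists_bound h h1 h2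
  refine ⟨C, R, hC, hR, fun r φ hr e1 e2 => ?_⟩
  rw [← norm_sqX_logPt_inv (hR.trans_le hr) φ]
  exact hb r φ hr e1 e2

theorem AsympIn.mono_sector {A : ℂ → ℂ} {ψ₁ ψ₂ : ℝ} (h : AsympIn f A φ₁ φ₂) (h1 : φ₁ ≤ ψ₁)
    (h2 : ψ₂ ≤ φ₂) : AsympIn f A ψ₁ ψ₂ := fun θ₁ θ₂ e1 e2 =>
  h θ₁ θ₂ (h1.trans_lt e1) (e2.trans_le h2)

theorem asympIn_leadSmall (hβ : β ≠ 0)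
    (h : Near φ₁ φ₂ (fun L => Complex.exp L * y (Complex.exp L)) (β / 2)) :
    AsympIn y (leadSmall β) φ₁ φ₂ := by
  intro θ₁ θ₂ h1 h2
  obtain ⟨C, R, hC, hR, hb⟩ := h.exists_bound h1 h2
  refine ⟨C * ‖β / 2‖⁻¹, R, hR, fun r φ hr e1 e2 => ?_⟩
  have h0 := hR.trans_le hr
  have hx : pt r φ ≠ 0 := by rw [pt_eq h0]; exact Complex.exp_ne_zero _
  have hb := hb r φ hr e1 e2
  rw [← pt_eq h0] at hb
  have hβ' : ‖β / 2‖ ≠ 0 := by simpa using hβ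
  have k1 : y (pt r φ) - leadSmall β (pt r φ) = (pt r φ * y (pt r φ) - β / 2) * (pt r φ)⁻¹ := by
    rw [leadSmall]; field_simp
  have k2 : leadSmall β (pt r φ) = β / 2 * (pt r φ)⁻¹ := by rw [leadSmall]; field_simp
  rw [k1, k2, norm_mul, norm_mul]
  calc _ ≤ C * r⁻¹ ^ 2 * ‖(pt r φ)⁻¹‖ := by gcongr
    _ = _ := by field_simp

theorem asympIn_leadLarge
    (h : Near φ₁ φ₂ (fun L => y (Complex.exp L) / Complex.exp L) (-2)) :
    AsympIn y leadLarge φ₁ φ₂ := by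
  intro θ₁ θ₂ h1 h2
  obtain ⟨C, R, hC, hR, hb⟩ := h.exists_bound h1 h2
  refine ⟨C * 2⁻¹, R, hR, fun r φ hr e1 e2 => ?_⟩
  have h0 := hR.trans_le hr
  have hx : pt r φ ≠ 0 := by rw [pt_eq h0]; exact Complex.exp_ne_zero _
  have hb := hb r φ hr e1 e2
  rw [← pt_eq h0] at hb
  have k1 : y (pt r φ) - leadLarge (pt r φ) = (y (pt r φ) / pt r φ - -2) * pt r φ := by
    rw [leadLarge]; field_simp
  rw [k1, leadLarge, norm_mul, norm_mul]
  calc _ ≤ C * r⁻¹ ^ 2 * ‖pt r φ‖ := by gcongr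
    _ = _ := by norm_num; ring

/-- Off the ray a vanishing multiplier leaves no room for an error, so y must then equal the
background; hence `zm` and `zp`. On the ray the two one-sided estimates are averaged, `lin`
supplying the mean multiplier. If that vanishes, only the E² allowance remains, and the second
difference `zs` provides it. -/
theorem expCorrected_of_near {Bm Bp e : ℂ → ℂ} {E : ℝ → ℝ → ℂ}
    (hE : ∀ r φ, 0 < r → E r φ = e (logPt r φ)) (he : ∀ L, e L ≠ 0)
    (hm : Near (θ - Real.pi / 4) (θ + Real.pi / 4)
      (fun L => (y (Complex.exp L) - Bm (Complex.exp L)) / e L) (μ 0))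
    (hp : Near (θ - Real.pi / 4) (θ + Real.pi / 4)
      (fun L => (y (Complex.exp L) - Bp (Complex.exp L)) / e L) (μ 1))
    (zm : μ 0 = 0 → y = Bm) (zp : μ 1 = 0 → y = Bp) (lin : μ 0 + μ 1 = 2 * μ (1 / 2))
    (zs : μ (1 / 2) = 0 → SO (θ - Real.pi / 4) (θ + Real.pi / 4)
      (fun L => (Bm (Complex.exp L) + Bp (Complex.exp L) - 2 * y (Complex.exp L)) / e L ^ 2)
      fun _ => 1) :
    ExpCorrected y Bm Bp E μ θ := by
  intro θ₁ θ₂ h1 h2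
  have side : ∀ (B : ℂ → ℂ) (m : ℂ), Near (θ - Real.pi / 4) (θ + Real.pi / 4)
      (fun L => (y (Complex.exp L) - B (Complex.exp L)) / e L) m → 
      ∃ C R : ℝ, 0 ≤ C ∧ 0 < R ∧ ∀ r φ : ℝ, R ≤ r → θ₁ ≤ φ → φ ≤ θ₂ →
        ‖y (pt r φ) - B (pt r φ) - m * E r φ‖ ≤ C * r⁻¹ ^ 2 * ‖E r φ‖ := by
    intro B m hB
    obtain ⟨C, R, hC, hR, hb⟩ := hB.exists_bound h1 h2
    refine ⟨C, R, hC, hR, fun r φ hr e1 e2 => ?_⟩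
    have hb := hb r φ hr e1 e2
    rw [← pt_eq (hR.trans_le hr), ← hE _ _ (hR.trans_le hr)] at hb
    have h0 : E r φ ≠ 0 := by rw [hE _ _ (hR.trans_le hr)]; exact he _
    have : y (pt r φ) - B (pt r φ) - m * E r φ =
        ((y (pt r φ) - B (pt r φ)) / E r φ - m) * E r φ := by field_simp
    rw [this, norm_mul]
    gcongr
  have side' : ∀ (B : ℂ → ℂ) (m : ℂ), Near (θ - Real.pi / 4) (θ + Real.pi / 4)
      (fun L => (y (Complex.exp L) - B (Complex.exp L)) / e L) m → (m = 0 → y = B) →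
      ∃ C R : ℝ, 0 ≤ C ∧ 0 < R ∧ ∀ r φ : ℝ, R ≤ r → θ₁ ≤ φ → φ ≤ θ₂ →
        ‖y (pt r φ) - B (pt r φ) - m * E r φ‖ ≤ C * (r⁻¹ ^ 2 * ‖m * E r φ‖) := by
    intro B m hB hz
    by_cases hm0 : m = 0
    · refine ⟨0, 1, le_rfl, one_pos, fun r φ _ _ _ => ?_⟩
      rw [← hz hm0, hm0]
      simp
    · obtain ⟨C, R, hC, hR, hb⟩ := side B m hB
      refine ⟨C * ‖m‖⁻¹, R, by positivity, hR, fun r φ hr e1 e2 => (hb r φ hr e1 e2).trans ?_⟩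
      have : ‖m‖ ≠ 0 := by simpa using hm0
      rw [norm_mul]
      refine le_of_eq ?_
      field_simp
  have ray : ∃ C R : ℝ, 0 ≤ C ∧ 0 < R ∧ ∀ r φ : ℝ, R ≤ r → θ₁ ≤ φ → φ ≤ θ₂ →
      ‖y (pt r φ) - (1 / 2 * Bm (pt r φ) + 1 / 2 * Bp (pt r φ)) - μ (1 / 2) * E r φ‖
        ≤ C * (r⁻¹ ^ 2 * ‖μ (1 / 2) * E r φ‖ + 1 / 4 * ‖E r φ‖ ^ 2) := by
    by_cases hz : μ (1 / 2) = 0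
    · obtain ⟨C, R, hC, hR, hb⟩ := (zs hz).exists_bound h1 h2
      refine ⟨2 * C, R, by positivity, hR, fun r φ hr e1 e2 => ?_⟩
      have hb := hb r φ hr e1 e2
      rw [← pt_eq (hR.trans_le hr), ← hE _ _ (hR.trans_le hr)] at hb
      have h0 : E r φ ≠ 0 := by rw [hE _ _ (hR.trans_le hr)]; exact he _
      have k1 : y (pt r φ) - (1 / 2 * Bm (pt r φ) + 1 / 2 * Bp (pt r φ)) - μ (1 / 2) * E r φ =
          -(1 / 2) * ((Bm (pt r φ) + Bp (pt r φ) - 2 * y (pt r φ)) / E r φ ^ 2 * E r φ ^ 2) := by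
        rw [hz]; field_simp; ring
      rw [k1, hz, norm_mul, norm_mul, norm_pow]
      simp only [norm_one, mul_one] at hb
      calc _ ≤ ‖(-(1 / 2) : ℂ)‖ * (C * ‖E r φ‖ ^ 2) := by gcongr
        _ = _ := by norm_num; ring
    · obtain ⟨C, R, hC, hR, hb⟩ := side Bm _ hm
      obtain ⟨C', R', hC', hR', hb'⟩ := side Bp _ hp
      have hz' : ‖μ (1 / 2)‖ ≠ 0 := by simpa using hz
      refine ⟨(C + C') / 2 * ‖μ (1 / 2)‖⁻¹, max R R', by positivity, lt_max_of_lt_left hR,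
        fun r φ hr e1 e2 => ?_⟩
      have hb := hb r φ ((le_max_left _ _).trans hr) e1 e2
      have hb' := hb' r φ ((le_max_right _ _).trans hr) e1 e2
      have k1 : y (pt r φ) - (1 / 2 * Bm (pt r φ) + 1 / 2 * Bp (pt r φ)) - μ (1 / 2) * E r φ =
          1 / 2 * ((y (pt r φ) - Bm (pt r φ) - μ 0 * E r φ) +
            (y (pt r φ) - Bp (pt r φ) - μ 1 * E r φ)) := by
        linear_combination (1 / 2) * E r φ * lin
      rw [k1, norm_mul]
      calc _ ≤ ‖(1 / 2 : ℂ)‖ * (C * r⁻¹ ^ 2 * ‖E r φ‖ + C' * r⁻¹ ^ 2 * ‖E r φ‖) := by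
            gcongr
            exact (norm_add_le _ _).trans (add_le_add hb hb')
        _ = (C + C') / 2 * ‖μ (1 / 2)‖⁻¹ * (r⁻¹ ^ 2 * ‖μ (1 / 2) * E r φ‖) := by
            rw [norm_mul]
            norm_num
            field_simp
        _ ≤ _ := by
            gcongr
            exact le_add_of_nonneg_right (by positivity)
  obtain ⟨C₀, R₀, hC₀, hR₀, hb₀⟩ := side' Bm _ hm zm
  obtain ⟨C₁, R₁, hC₁, hR₁, hb₁⟩ := side' Bp _ hp zp
  obtain ⟨C₂, R₂, hC₂, hR₂, hb₂⟩ := ray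
  refine ⟨C₀ + C₁ + C₂, max R₀ (max R₁ R₂), lt_max_of_lt_left hR₀, fun r φ t hr e1 e2 ht => ?_⟩
  have hr0 := (le_max_left _ _).trans hr
  have hr1 := ((le_max_left _ _).trans (le_max_right _ _)).trans hr
  have hr2 := ((le_max_right _ _).trans (le_max_right _ _)).trans hr
  rw [Theta] at ht
  split_ifs at ht
  · subst ht
    simp only [Complex.ofReal_zero, sub_zero, one_mul, zero_mul, add_zero]
    refine (hb₀ r φ hr0 e1 e2).trans ?_
    gcongr
    linarith
  · subst ht
    have := hb₂ r φ hr2 e1 e2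
    push_cast
    norm_num at this ⊢
    refine this.trans ?_
    gcongr
    linarith
  · subst ht
    simp only [Complex.ofReal_one, sub_self, one_mul, zero_mul, add_zero, mul_zero, zero_add]
    refine (hb₁ r φ hr1 e1 e2).trans ?_
    gcongr
    linarith

/-! ### The members of the hierarchy in the original variable -/

/-- The hierarchy sees only the ratio of w' and w. Equal coordinates therefore give equal solutions,
which settles the case of a vanishing multiplier. -/
theorem level_congr (K : ℂ) (hK : K ≠ 0) (h : ∀ x, w x = K * v x ∧ w' x = K * v' x) (n : ℕ) :
    level Y w w' n = level Y v v' n := by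
  have h1 : baseY w w' = baseY v v' := funext fun x => by
    rw [baseY, baseY, (h x).1, (h x).2, mul_div_mul_left _ _ hK]
  have h2 : baseP Y w w' = baseP Y v v' := funext fun x => by
    rw [baseP, baseP, (h x).1, (h x).2, mul_div_mul_left _ _ hK, mul_div_mul_left _ _ hK]
  induction n with
  | zero => rw [level, level, h1, h2]
  | succ n ih => rw [level, level, ih]

/-- `w` has the coordinate `c` in the even frame around `arg x = θ`. -/
structure EvenCoord (s : ℂ) (θ : ℝ) (c : ℂ) (w w' : ℂ → ℂ) : Prop where
  notInt : NotInt s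
  angle : Complex.exp (θ * Complex.I) ^ 2 = 1
  weber : IsWeber (-2 * s) w w'
  rel : EvenRel (Complex.exp (θ * Complex.I)) w w' (psi s 1 c) (psi' s 1 c)

/-- `w` has the coordinate `c` in the odd frame around `arg x = θ`. -/
structure OddCoord (s : ℂ) (θ : ℝ) (c : ℂ) (w w' : ℂ → ℂ) : Prop where
  notInt : NotInt s
  angle : Complex.exp (θ * Complex.I) ^ 2 = -1
  weber : IsWeber (2 * s) w w'
  rel : OddRel (2 * s) (Complex.exp (θ * Complex.I)) w w' (psi s 1 c) (psi' s 1 c)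

theorem EvenCoord.level_eq (h : EvenCoord s θ c w w') (h' : EvenCoord s θ c v v') (n : ℕ) :
    level (-2 * s) w w' n = level (-2 * s) v v' n := by
  obtain ⟨k, hk, e⟩ := h.rel
  obtain ⟨k', hk', e'⟩ := h'.rel
  have hε := Complex.exp_ne_zero (θ * Complex.I)
  refine level_congr (k / k') (div_ne_zero hk hk') (fun x => ?_) n
  have e1 := e ((Complex.exp (θ * Complex.I))⁻¹ * x)
  have e2 := e' ((Complex.exp (θ * Complex.I))⁻¹ * x)
  rw [mul_inv_cancel_left₀ hε] at e1 e2
  constructor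
  · rw [e1.1, e2.1]; field_simp
  · refine mul_left_cancel₀ hε ?_
    rw [mul_left_comm, e1.2, e2.2]; field_simp

theorem OddCoord.level_eq (h : OddCoord s θ c w w') (h' : OddCoord s θ c v v') (n : ℕ) :
    level (2 * s) w w' n = level (2 * s) v v' n := by
  obtain ⟨k, hk, e⟩ := h.rel
  obtain ⟨k', hk', e'⟩ := h'.rel
  have hε := Complex.exp_ne_zero (θ * Complex.I)
  have hs := h.notInt.ne_zero
  refine level_congr (k / k') (div_ne_zero hk hk') (fun x => ?_) n
  have e1 := e ((Complex.exp (θ * Complex.I))⁻¹ * x)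
  have e2 := e' ((Complex.exp (θ * Complex.I))⁻¹ * x)
  have hx := Complex.exp_ne_zero (-((Complex.exp (θ * Complex.I))⁻¹ * x) ^ 2)
  rw [mul_inv_cancel_left₀ hε] at e1 e2
  constructor
  · refine mul_left_cancel₀ (mul_ne_zero (mul_ne_zero hε (mul_ne_zero two_ne_zero hs)) hx) ?_
    linear_combination e1.2 - (k / k') * e2.2 -
      psi' s 1 c ((Complex.exp (θ * Complex.I))⁻¹ * x) * div_mul_cancel₀ k hk'
  · refine mul_left_cancel₀ hx ?_
    rw [mul_left_comm, e1.1, e2.1]; field_simp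

theorem EvenFrame.asympIn {p : ℂ → ℂ} {P : ℂ} (hβ : β ≠ 0) (h : EvenFrame β P θ φ₁ φ₂ y p) :
    AsympIn y (leadSmall β) (φ₁ + θ) (φ₂ + θ) := by
  refine asympIn_leadSmall hβ ((h.near_a.shift θ).congr (.of_forall fun L => ?_))
  rw [evenA, rot_sub]

/-- In the frame y/x = -2 - (a + b)e^{-2ℓ}, with a and b bounded. -/
theorem OddFrame.asympIn {p : ℂ → ℂ} {P : ℂ} (h : OddFrame β P θ φ₁ φ₂ y p) :
    AsympIn y leadLarge (φ₁ + θ) (φ₂ + θ) := by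
  have h1 := (Near.const (-2)).sub (Near.div_sqX (h.near_a.add h.near_b).bounded)
  refine asympIn_leadLarge (((h1.shift θ).congr (.of_forall fun L => ?_)).of_eq (by ring))
  have hx : sqX (L - θ * Complex.I) = -Complex.exp L ^ 2 := by
    rw [← rot_sub θ L, h.rot_sq, neg_neg]
  have := Complex.exp_ne_zero L
  rw [oddA, oddB, hx, rot_sub]
  field_simp
  ring

theorem EvenCoord.asympIn_left (h : EvenCoord s θ 0 w w') (hβ : β = -2 * s) (n : ℕ) :
    AsympIn (level β w w' n).1 (leadSmall β) (θ - 5 * Real.pi / 4) (θ + Real.pi / 4) := by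
  subst hβ
  have := (evenFrame_level h.notInt h.angle h.weber h.rel (dominant_psi_left h.notInt 1) n).asympIn
    (mul_ne_zero (by norm_num) h.notInt.ne_zero)
  convert this using 1 <;> ring

theorem EvenCoord.asympIn_right (h : EvenCoord s θ (-iSqrtPi) w w') (hβ : β = -2 * s) (n : ℕ) :
    AsympIn (level β w w' n).1 (leadSmall β) (θ - Real.pi / 4) (θ + 5 * Real.pi / 4) := by
  subst hβ
  have := (evenFrame_level h.notInt h.angle h.weber h.rel
    (dominant_psi_right h.notInt (by ring)) n).asympIn
    (mul_ne_zero (by norm_num) h.notInt.ne_zero)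
  convert this using 1 <;> ring

theorem OddCoord.asympIn_left (h : OddCoord s θ 0 w w') (hβ : β = 2 * s) (n : ℕ) :
    AsympIn (level β w w' n).1 leadLarge (θ - 5 * Real.pi / 4) (θ + Real.pi / 4) := by
  subst hβ
  have := (oddFrame_level h.notInt h.angle h.weber h.rel (dominant_psi_left h.notInt 1) n).asympIn
  convert this using 1 <;> ring

theorem OddCoord.asympIn_right (h : OddCoord s θ (-iSqrtPi) w w') (hβ : β = 2 * s) (n : ℕ) :
    AsympIn (level β w w' n).1 leadLarge (θ - Real.pi / 4) (θ + 5 * Real.pi / 4) := by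
  subst hβ
  have := (oddFrame_level h.notInt h.angle h.weber h.rel
    (dominant_psi_right h.notInt (by ring)) n).asympIn
  convert this using 1 <;> ring

theorem eq_of_multiplier_eq_zero {a d N : ℂ} (ha : a ≠ 0) (hN : N ≠ 0)
    (h : a * (2 * (d - c) * N) = 0) : d = c := by
  simpa [ha, hN, sub_eq_zero] using h

/-- The asymptotics around a Stokes ray with `x² > 0`. -/
theorem EvenCoord.expCorrected (h : EvenCoord s θ c w w') (h₁ : EvenCoord s θ 0 w₁ w₁')
    (h₂ : EvenCoord s θ (-iSqrtPi) w₂ w₂') (hβ : β = -2 * s) (n : ℕ)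
    (hμ : ∀ t : ℝ, μ t = Complex.exp (θ * Complex.I) *
      Complex.exp (-((2 * n - β) * (θ * Complex.I))) *
        (2 * (-iSqrtPi * t - c) * normSmall n β)) :
    ExpCorrected (level β w w' n).1 (level β w₁ w₁' n).1 (level β w₂ w₂' n).1 (expSmall n β) μ θ := by
  subst hβ
  have hN : normSmall n (-2 * s) = 2 ^ (s + n) / (n.factorial * Complex.Gamma s) := by
    rw [normSmall]; congr 2
    · ring
    · congr 2; ring
  have hN0 : normSmall n (-2 * s) ≠ 0 := by
    rw [hN]
    have h2 : (n.factorial : ℂ) ≠ 0 := by exact_mod_cast n.factorial_ne_zero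
    refine div_ne_zero ?_ (mul_ne_zero h2 h.notInt.gamma_ne_zero)
    simp [Complex.cpow_eq_zero_iff]
  have hε := Complex.exp_ne_zero (θ * Complex.I)
  set e : ℂ → ℂ := fun L => Complex.exp ((2 * n - -2 * s) * L - Complex.exp L ^ 2) with he
  have hlog : ∀ L, logE (2 * s + 2 * n) (L - θ * Complex.I) =
      Complex.exp (-((2 * n - -2 * s) * (θ * Complex.I))) * e L := fun L => by
    have : sqX (L - θ * Complex.I) = Complex.exp L ^ 2 := by
      rw [← rot_sub θ L, rot_sq, h.angle, one_mul]
    rw [logE, this, ← Complex.exp_add]; congr 1; ring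
  have hpi : ∀ x : ℝ, -x / 4 + θ = θ - x / 4 ∧ x / 4 + θ = θ + x / 4 :=
    fun x => ⟨by ring, by ring⟩
  have near : ∀ {c₀ : ℂ} {v v' : ℂ → ℂ}, EvenCoord s θ c₀ v v' → ∀ t : ℝ, c₀ = -iSqrtPi * t →
      Near (θ - Real.pi / 4) (θ + Real.pi / 4) (fun L => ((level (-2 * s) w w' n).1 (Complex.exp L) -
        (level (-2 * s) v v' n).1 (Complex.exp L)) / e L) (μ t) := by
    intro c₀ v v' hv t ht
    have := ((near_even_level h.notInt h.angle h.weber hv.weber h.rel hv.rel n).shift θ).const_mul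
      (Complex.exp (-((2 * n - -2 * s) * (θ * Complex.I))))
    rw [(hpi _).1, (hpi _).2] at this
    refine (this.congr (.of_forall fun L => ?_)).of_eq ?_
    · have h1 := Complex.exp_ne_zero (-((2 * n - -2 * s) * (θ * Complex.I)))
      rw [hlog, rot_sub, mul_div_assoc', mul_div_mul_left _ _ h1]
    · rw [hμ, hN, ht]; ring
  have heq : ∀ {c₀ : ℂ} {v v' : ℂ → ℂ}, EvenCoord s θ c₀ v v' → ∀ t : ℝ, c₀ = -iSqrtPi * t →
      μ t = 0 → (level (-2 * s) w w' n).1 = (level (-2 * s) v v' n).1 := by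
    intro c₀ v v' hv t ht h0
    rw [hμ] at h0
    have := eq_of_multiplier_eq_zero (mul_ne_zero hε (Complex.exp_ne_zero _)) hN0 h0
    rw [this] at ht
    subst ht
    rw [h.level_eq hv]
  -- The backgrounds have the coordinates -i√π t with t = 0 and t = 1. The multiplier at t = 1/2
  -- vanishes exactly when c is their midpoint.
  refine expCorrected_of_near (e := e) (fun r φ hr => ?_) (fun L => Complex.exp_ne_zero _)
    (near h₁ 0 (by simp)) (near h₂ 1 (by simp)) (heq h₁ 0 (by simp)) (heq h₂ 1 (by simp))
    (by simp only [hμ]; push_cast; ring) fun h0 => ?_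
  · rw [expSmall, pw, pt_eq hr, ← logPt, ← Complex.exp_add, ← sub_eq_add_neg]
  · rw [hμ] at h0
    have hc := eq_of_multiplier_eq_zero (mul_ne_zero hε (Complex.exp_ne_zero _)) hN0 h0
    push_cast at hc
    have := ((second_even_level h.notInt h.angle h.weber h₁.weber h₂.weber h.rel h₁.rel h₂.rel
      (by linear_combination 2 * hc) n).shift θ).const_mul
      (Complex.exp (-((2 * n - -2 * s) * (θ * Complex.I))) ^ 2)
    rw [(hpi _).1, (hpi _).2] at this
    refine this.congr_left fun L => ?_
    have h1 := Complex.exp_ne_zero (-((2 * n - -2 * s) * (θ * Complex.I)))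
    rw [hlog, rot_sub, mul_div_assoc', mul_pow, mul_div_mul_left _ _ (pow_ne_zero 2 h1)]

/-- The asymptotics around a Stokes ray with `x² < 0`. -/
theorem OddCoord.expCorrected (h : OddCoord s θ c w w') (h₁ : OddCoord s θ 0 w₁ w₁')
    (h₂ : OddCoord s θ (-iSqrtPi) w₂ w₂') (hβ : β = 2 * s) (n : ℕ) (hα : α - β / 2 = 1 / 2 + n)
    (hμ : ∀ t : ℝ, μ t = -Complex.exp (θ * Complex.I) *
      Complex.exp (-((4 * α - β) * (θ * Complex.I))) *
        (2 * (-iSqrtPi * t - c) * normLarge n α β)) :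
    ExpCorrected (level β w w' n).1 (level β w₁ w₁' n).1 (level β w₂ w₂' n).1 (expLarge α β) μ θ := by
  subst hβ
  obtain rfl : α = s + 1 / 2 + n := by linear_combination hα
  have hN : normLarge n (s + 1 / 2 + n) (2 * s) =
      2 ^ (1 + 2 * n + s) / (n.factorial * Complex.Gamma (n + 1 + s)) := by
    rw [normLarge]; congr 2
    · ring
    · congr 1; ring
  have hN0 : normLarge n (s + 1 / 2 + n) (2 * s) ≠ 0 := by
    rw [hN]
    have h2 : (n.factorial : ℂ) ≠ 0 := by exact_mod_cast n.factorial_ne_zero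
    refine div_ne_zero ?_ (mul_ne_zero h2 (Complex.Gamma_ne_zero fun m hm =>
      h.notInt (-m - n - 1) ?_))
    · simp [Complex.cpow_eq_zero_iff]
    · push_cast; linear_combination hm
  have hε := neg_ne_zero.2 (Complex.exp_ne_zero (θ * Complex.I))
  set p : ℂ := 4 * (s + 1 / 2 + n) - 2 * s with hp
  set e : ℂ → ℂ := fun L => Complex.exp (p * L + Complex.exp L ^ 2) with he
  have hlog : ∀ L, logE (2 + 2 * s + 4 * n) (L - θ * Complex.I) =
      Complex.exp (-(p * (θ * Complex.I))) * e L := fun L => by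
    have : sqX (L - θ * Complex.I) = -Complex.exp L ^ 2 := by
      rw [← rot_sub θ L, rot_sq, h.angle]; ring
    rw [logE, this, ← Complex.exp_add]; congr 1; simp only [hp]; ring
  have hpi : ∀ x : ℝ, -x / 4 + θ = θ - x / 4 ∧ x / 4 + θ = θ + x / 4 :=
    fun x => ⟨by ring, by ring⟩
  have near : ∀ {c₀ : ℂ} {v v' : ℂ → ℂ}, OddCoord s θ c₀ v v' → ∀ t : ℝ, c₀ = -iSqrtPi * t →
      Near (θ - Real.pi / 4) (θ + Real.pi / 4) (fun L => ((level (2 * s) w w' n).1 (Complex.exp L) -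
        (level (2 * s) v v' n).1 (Complex.exp L)) / e L) (μ t) := by
    intro c₀ v v' hv t ht
    have := ((near_odd_level h.notInt h.angle h.weber hv.weber h.rel hv.rel n).shift θ).const_mul
      (Complex.exp (-(p * (θ * Complex.I))))
    rw [(hpi _).1, (hpi _).2] at this
    refine (this.congr (.of_forall fun L => ?_)).of_eq ?_
    · have h1 := Complex.exp_ne_zero (-(p * (θ * Complex.I)))
      rw [hlog, rot_sub, mul_div_assoc', mul_div_mul_left _ _ h1]
    · rw [hμ, hN, ht]; ring
  have heq : ∀ {c₀ : ℂ} {v v' : ℂ → ℂ}, OddCoord s θ c₀ v v' → ∀ t : ℝ, c₀ = -iSqrtPi * t →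
      μ t = 0 → (level (2 * s) w w' n).1 = (level (2 * s) v v' n).1 := by
    intro c₀ v v' hv t ht h0
    rw [hμ] at h0
    have := eq_of_multiplier_eq_zero (mul_ne_zero hε (Complex.exp_ne_zero _)) hN0 h0
    rw [this] at ht
    subst ht
    rw [h.level_eq hv]
  refine expCorrected_of_near (e := e) (fun r φ hr => ?_) (fun L => Complex.exp_ne_zero _)
    (near h₁ 0 (by simp)) (near h₂ 1 (by simp)) (heq h₁ 0 (by simp)) (heq h₂ 1 (by simp))
    (by simp only [hμ]; push_cast; ring) fun h0 => ?_
  · rw [expLarge, pw, pt_eq hr, ← logPt, ← Complex.exp_add]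
  · rw [hμ] at h0
    have hc := eq_of_multiplier_eq_zero (mul_ne_zero hε (Complex.exp_ne_zero _)) hN0 h0
    push_cast at hc
    have := ((second_odd_level h.notInt h.angle h.weber h₁.weber h₂.weber h.rel h₁.rel h₂.rel
      (by linear_combination 2 * hc) n).shift θ).const_mul
      (Complex.exp (-(p * (θ * Complex.I))) ^ 2)
    rw [(hpi _).1, (hpi _).2] at this
    refine this.congr_left fun L => ?_
    have h1 := Complex.exp_ne_zero (-(p * (θ * Complex.I)))
    rw [hlog, rot_sub, mul_div_assoc', mul_pow, mul_div_mul_left _ _ (pow_ne_zero 2 h1)]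

end PainleveIV

end

noncomputable section

namespace PainleveIV

open Topology Set Asymptotics

variable {s A C c α β κ : ℂ} {n : ℕ}

/-! ### The coordinates of the family in the four sectors -/

theorem iSqrtPi_sq : iSqrtPi ^ 2 = -Real.pi := by
  have e : iSqrtPi = Complex.I * sqrtPi := rfl
  rw [e, mul_pow, Complex.I_sq, sqrtPi_sq, neg_one_mul]

theorem iSqrtPi_ne_zero : iSqrtPi ≠ 0 := mul_ne_zero Complex.I_ne_zero sqrtPi_ne_zero

theorem NotInt.phase_pow_ne_one (h : NotInt s) : phase s ^ 4 ≠ 1 := by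
  rw [phase, ← Complex.exp_nat_mul, Ne, Complex.exp_eq_one_iff]
  rintro ⟨m, hm⟩
  have hpi : (Real.pi : ℂ) ≠ 0 := by exact_mod_cast Real.pi_ne_zero
  refine h m ?_
  push_cast at hm
  have : Complex.I * (2 * Real.pi) * (s - m) = 0 := by linear_combination hm
  simpa [hpi, sub_eq_zero] using this

theorem exp_pi_div_two_I : Complex.exp (((Real.pi / 2 : ℝ) : ℂ) * Complex.I) = Complex.I := by
  push_cast; exact Complex.exp_pi_div_two_mul_I

theorem exp_three_pi_div_two_I :
    Complex.exp (((3 * Real.pi / 2 : ℝ) : ℂ) * Complex.I) = -1 * Complex.I := by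
  rw [show ((3 * Real.pi / 2 : ℝ) : ℂ) * Complex.I =
      Real.pi * Complex.I + Real.pi / 2 * Complex.I by push_cast; ring,
    Complex.exp_add, Complex.exp_pi_mul_I, Complex.exp_pi_div_two_mul_I]

theorem evenRel_psi (s A C : ℂ) : EvenRel 1 (psi s A C) (psi' s A C) (psi s A C) (psi' s A C) :=
  ⟨1, one_ne_zero, fun z => by simp⟩

theorem oddRel_psi (h : NotInt s) (A C : ℂ) :
    OddRel (-2 * s) Complex.I (psi s A C) (psi' s A C)
      (psi (-s) ((1 - phase s ^ 4) * (C + iSqrtPi * A)) (Real.pi * A))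
      (psi' (-s) ((1 - phase s ^ 4) * (C + iSqrtPi * A)) (Real.pi * A)) := by
  simpa using (evenRel_psi s A C).rotate h (by norm_num)

/-- The second quarter turn starts from -s, for which `phase ^ 4` is inverted; (i√π)² = -π merges
the two terms in A. -/
theorem evenRel_neg_psi (h : NotInt s) (A C : ℂ) :
    EvenRel (-1) (psi s A C) (psi' s A C)
      (psi s ((1 - (phase s ^ 4)⁻¹) *
          (Real.pi * phase s ^ 4 * A + iSqrtPi * (1 - phase s ^ 4) * C))
        (Real.pi * ((1 - phase s ^ 4) * (C + iSqrtPi * A))))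
      (psi' s ((1 - (phase s ^ 4)⁻¹) *
          (Real.pi * phase s ^ 4 * A + iSqrtPi * (1 - phase s ^ 4) * C))
        (Real.pi * ((1 - phase s ^ 4) * (C + iSqrtPi * A)))) := by
  have h1 := oddRel_psi h A C
  rw [show -2 * s = 2 * -s by ring] at h1
  have h2 := h1.rotate h.neg Complex.I_sq
  rw [neg_neg, Complex.I_mul_I, phase_neg, inv_pow] at h2
  convert h2 using 2 <;>
  · congr 1
    linear_combination -((1 - phase s ^ 4) * A) * iSqrtPi_sq

/-- After the third quarter turn the terms in A cancel in the leading coefficient, so it vanishes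
only for C = 0. -/
theorem oddRel_neg_psi (h : NotInt s) (A C : ℂ) :
    OddRel (-2 * s) (-1 * Complex.I) (psi s A C) (psi' s A C)
      (psi (-s) (Real.pi * (1 - phase s ^ 4) ^ 2 * (phase s ^ 4)⁻¹ * C)
        (Real.pi * ((1 - (phase s ^ 4)⁻¹) *
          (Real.pi * phase s ^ 4 * A + iSqrtPi * (1 - phase s ^ 4) * C))))
      (psi' (-s) (Real.pi * (1 - phase s ^ 4) ^ 2 * (phase s ^ 4)⁻¹ * C)
        (Real.pi * ((1 - (phase s ^ 4)⁻¹) *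
          (Real.pi * phase s ^ 4 * A + iSqrtPi * (1 - phase s ^ 4) * C)))) := by
  have h2 := (evenRel_neg_psi h A C).rotate h (by norm_num)
  have hq : phase s ^ 4 ≠ 0 := pow_ne_zero _ (phase_ne_zero s)
  have hpi : (Real.pi : ℂ) = -iSqrtPi ^ 2 := by rw [iSqrtPi_sq, neg_neg]
  convert h2 using 2 <;>
  · rw [hpi]
    generalize phase s ^ 4 = q at hq ⊢
    field_simp
    ring

theorem evenCoord_zero (h : NotInt s) (c : ℂ) :
    EvenCoord s 0 c (psi s 1 c) (psi' s 1 c) := by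
  refine ⟨h, by simp, h.isWeber_psi 1 c, ?_⟩
  simpa using evenRel_psi s 1 c

theorem oddCoord_half_pi (h : NotInt s) (h0 : C + iSqrtPi * A ≠ 0)
    (hc : Real.pi * A = c * ((1 - phase s ^ 4) * (C + iSqrtPi * A))) :
    OddCoord (-s) (Real.pi / 2) c (psi s A C) (psi' s A C) := by
  have e : 2 * -s = -2 * s := by ring
  refine ⟨h.neg, by rw [exp_pi_div_two_I, Complex.I_sq], e ▸ h.isWeber_psi A C, ?_⟩
  rw [exp_pi_div_two_I, e]
  exact (oddRel_psi h A C).normalize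
    (mul_ne_zero (sub_ne_zero.2 h.phase_pow_ne_one.symm) h0) hc

theorem evenCoord_pi (h : NotInt s)
    (h0 : Real.pi * phase s ^ 4 * A + iSqrtPi * (1 - phase s ^ 4) * C ≠ 0)
    (hc : Real.pi * ((1 - phase s ^ 4) * (C + iSqrtPi * A)) = c * ((1 - (phase s ^ 4)⁻¹) *
      (Real.pi * phase s ^ 4 * A + iSqrtPi * (1 - phase s ^ 4) * C))) :
    EvenCoord s Real.pi c (psi s A C) (psi' s A C) := by
  refine ⟨h, by rw [Complex.exp_pi_mul_I]; norm_num, h.isWeber_psi A C, ?_⟩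
  rw [Complex.exp_pi_mul_I]
  refine (evenRel_neg_psi h A C).normalize (mul_ne_zero (sub_ne_zero.2 fun e => ?_) h0) hc
  exact h.phase_pow_ne_one (inv_eq_one.1 e.symm)

theorem oddCoord_three_half_pi (h : NotInt s) (h0 : C ≠ 0)
    (hc : Real.pi * ((1 - (phase s ^ 4)⁻¹) *
      (Real.pi * phase s ^ 4 * A + iSqrtPi * (1 - phase s ^ 4) * C)) =
        c * (Real.pi * (1 - phase s ^ 4) ^ 2 * (phase s ^ 4)⁻¹ * C)) :
    OddCoord (-s) (3 * Real.pi / 2) c (psi s A C) (psi' s A C) := by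
  have e : 2 * -s = -2 * s := by ring
  have hq : phase s ^ 4 ≠ 0 := pow_ne_zero _ (phase_ne_zero s)
  have hpi : (Real.pi : ℂ) ≠ 0 := by exact_mod_cast Real.pi_ne_zero
  refine ⟨h.neg, by rw [exp_three_pi_div_two_I, mul_pow, Complex.I_sq]; norm_num,
    e ▸ h.isWeber_psi A C, ?_⟩
  rw [exp_three_pi_div_two_I, e]
  exact (oddRel_neg_psi h A C).normalize (mul_ne_zero (mul_ne_zero (mul_ne_zero hpi
    (pow_ne_zero 2 (sub_ne_zero.2 h.phase_pow_ne_one.symm))) (inv_ne_zero hq)) h0) hc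

/-! ### The multipliers -/

theorem exp_neg_nat_mul_two_pi_I (n : ℕ) : Complex.exp (-(n * (2 * Real.pi * Complex.I))) = 1 := by
  rw [Complex.exp_neg, Complex.exp_nat_mul_two_pi_mul_I, inv_one]

/-- This and the next three identities compare the stated multipliers with those of the frames. A
frame measures powers from its own axis arg x = θ, so an exponent p contributes the branch factor
e^{-ipθ}. -/
theorem mu1_eq (n : ℕ) (β κ : ℂ) (t : ℝ) :
    mu1 n β κ t = Complex.exp ((0 : ℝ) * Complex.I) *
      Complex.exp (-((2 * n - β) * ((0 : ℝ) * Complex.I))) *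
        (2 * (-iSqrtPi * t - κ) * normSmall n β) := by
  simp [mu1]
  ring

/-- Here 4α - β = β + 2 + 4n, so the branch factor at θ = π/2 is e^{-iπβ/2} up to the sign e^{-iπ}.
-/
theorem mu2_eq (hα : α - β / 2 = 1 / 2 + n) (κ : ℂ) (t : ℝ) :
    mu2 n α β κ t = -Complex.exp ((Real.pi / 2 : ℝ) * Complex.I) *
      Complex.exp (-((4 * α - β) * ((Real.pi / 2 : ℝ) * Complex.I))) *
        (2 * (-iSqrtPi * t - iSqrtPi * κ) * normLarge n α β) := by
  have e : Complex.exp (-((4 * α - β) * ((Real.pi / 2 : ℝ) * Complex.I))) =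
      Complex.exp (-(Complex.I * Real.pi * β / 2)) * Complex.exp (-(Real.pi * Complex.I)) *
        Complex.exp (-(n * (2 * Real.pi * Complex.I))) := by
    rw [← Complex.exp_add, ← Complex.exp_add]; congr 1; push_cast
    linear_combination -2 * Real.pi * Complex.I * hα
  rw [e, exp_neg_nat_mul_two_pi_I, Complex.exp_neg (Real.pi * Complex.I), Complex.exp_pi_mul_I,
    exp_pi_div_two_I, mu2, iSqrtPi]
  norm_num
  linear_combination 2 * (Real.sqrt Real.pi : ℂ) * (κ + t) *
    Complex.exp (-(Complex.I * Real.pi * β / 2)) * normLarge n α β * Complex.I_sq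

theorem mu3_eq (n : ℕ) (β κ : ℂ) (t : ℝ) :
    mu3 n β κ t = Complex.exp (Real.pi * Complex.I) *
      Complex.exp (-((2 * n - β) * (Real.pi * Complex.I))) *
        (2 * (-iSqrtPi * t - -iSqrtPi * κ) * normSmall n β) := by
  have e : Complex.exp (-((2 * n - β) * (Real.pi * Complex.I))) =
      Complex.exp (Complex.I * Real.pi * β) * Complex.exp (-(n * (2 * Real.pi * Complex.I))) := by
    rw [← Complex.exp_add]; congr 1; ring
  rw [e, exp_neg_nat_mul_two_pi_I, Complex.exp_pi_mul_I, mu3]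
  ring

theorem mu4_eq (hα : α - β / 2 = 1 / 2 + n) (κ : ℂ) (t : ℝ) :
    mu4 n α β κ t = -Complex.exp ((3 * Real.pi / 2 : ℝ) * Complex.I) *
      Complex.exp (-((4 * α - β) * ((3 * Real.pi / 2 : ℝ) * Complex.I))) *
        (2 * (-iSqrtPi * t - -iSqrtPi * (κ + 1)) * normLarge n α β) := by
  have e : Complex.exp (-((4 * α - β) * ((3 * Real.pi / 2 : ℝ) * Complex.I))) =
      Complex.exp (-(3 * Complex.I * Real.pi * β / 2)) * Complex.exp (-(Real.pi * Complex.I)) ^ 3 *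
        Complex.exp (-(n * (2 * Real.pi * Complex.I))) ^ 3 := by
    rw [← Complex.exp_nat_mul, ← Complex.exp_nat_mul, ← Complex.exp_add, ← Complex.exp_add]
    congr 1; push_cast
    linear_combination -6 * Real.pi * Complex.I * hα
  rw [e, exp_neg_nat_mul_two_pi_I, Complex.exp_neg (Real.pi * Complex.I), Complex.exp_pi_mul_I,
    exp_three_pi_div_two_I, mu4, iSqrtPi]
  norm_num
  linear_combination 2 * (Real.sqrt Real.pi : ℂ) * (κ + 1 - t) *
    Complex.exp (-(3 * Complex.I * Real.pi * β / 2)) * normLarge n α β * Complex.I_sq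

/-! ### The family -/

/-- The member of the family of classical solutions with the coordinates `(A, C)`. -/
def family (β : ℂ) (n : ℕ) (A C : ℂ) : ℂ → ℂ :=
  (level β (psi (-β / 2) A C) (psi' (-β / 2) A C) n).1

theorem family_isSolution (h : NotInt (-β / 2)) (hα : α - β / 2 = 1 / 2 + n)
    (hAC : A ≠ 0 ∨ C ≠ 0) :
    IsSolution α β (family β n A C) ∧ IsClassical α β (family β n A C) := by
  have hY : ∀ m : ℕ, β + 2 * m ≠ 0 := fun m e => h m (by linear_combination (-1 / 2) * e)
  have hβ : β ≠ 0 := by simpa using hY 0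
  have hw := h.isWeber_psi A C
  rw [show -2 * (-β / 2) = β by ring] at hw
  have h0 := psi_initial_ne_zero h hAC
  refine ⟨(hw.isTriple_level hY h0 n).isSolution hβ rfl (by linear_combination -2 * hα), ?_⟩
  have := hw.isClassical_level hY h0 n
  rwa [show β / 2 + 1 / 2 + n = α by linear_combination -hα] at this

end PainleveIV

end

/-! ### The connection formulas in the four sectors. -/

theorem theorem2 (α β : ℂ) (n : ℕ) (hn : α - β / 2 = 1 / 2 + n)
    (hα : ∀ m : ℤ, α + 1 / 2 ≠ m) :
    ∃ (B₁m B₁p B₂m B₂p B₃m B₃p B₄m B₄p : ℂ → ℂ) (y : ℂ → ℂ → ℂ) (yInf : ℂ → ℂ),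
      -- the algebraic backgrounds on the two sides of each Stokes ray
      (PainleveIV.IsTruncated α β (PainleveIV.leadSmall β) B₁m
          (-3 * Real.pi / 4) (Real.pi / 4) ∧
        PainleveIV.IsTruncated α β (PainleveIV.leadSmall β) B₁p
          (-Real.pi / 4) (3 * Real.pi / 4) ∧
        PainleveIV.IsTruncated α β PainleveIV.leadLarge B₂m
          (-Real.pi / 4) (3 * Real.pi / 4) ∧
        PainleveIV.IsTruncated α β PainleveIV.leadLarge B₂p
          (Real.pi / 4) (5 * Real.pi / 4) ∧
        PainleveIV.IsTruncated α β (PainleveIV.leadSmall β) B₃m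
          (Real.pi / 4) (5 * Real.pi / 4) ∧
        PainleveIV.IsTruncated α β (PainleveIV.leadSmall β) B₃p
          (3 * Real.pi / 4) (7 * Real.pi / 4) ∧
        PainleveIV.IsTruncated α β PainleveIV.leadLarge B₄m
          (3 * Real.pi / 4) (7 * Real.pi / 4) ∧
        PainleveIV.IsTruncated α β PainleveIV.leadLarge B₄p
          (5 * Real.pi / 4) (9 * Real.pi / 4)) ∧
      -- classical solutions
      (∀ c : ℂ, PainleveIV.IsSolution α β (y c) ∧ PainleveIV.IsClassical α β (y c)) ∧
      (PainleveIV.IsSolution α β yInf ∧ PainleveIV.IsClassical α β yInf) ∧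
      -- their asymptotics for finite `c`
      (∀ c : ℂ,
        -- sector (-π/4, π/4)
        PainleveIV.ExpCorrected (y c) B₁m B₁p (PainleveIV.expSmall n β)
          (PainleveIV.mu1 n β c) 0 ∧
        -- sector (π/4, 3π/4)
        (c + PainleveIV.iSqrtPi ≠ 0 →
          PainleveIV.ExpCorrected (y c) B₂m B₂p (PainleveIV.expLarge α β)
            (PainleveIV.mu2 n α β (PainleveIV.iSqrtPi /
              ((c + PainleveIV.iSqrtPi) * (Complex.exp (-(Complex.I * Real.pi * β)) - 1))))
            (Real.pi / 2)) ∧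
        (c + PainleveIV.iSqrtPi = 0 →
          PainleveIV.AsympIn (y c) (PainleveIV.leadSmall β) (Real.pi / 4) (3 * Real.pi / 4)) ∧
        -- sector (3π/4, 5π/4)
        (c * (1 - Complex.exp (Complex.I * Real.pi * β)) + PainleveIV.iSqrtPi ≠ 0 →
          PainleveIV.ExpCorrected (y c) B₃m B₃p (PainleveIV.expSmall n β)
            (PainleveIV.mu3 n β ((c + PainleveIV.iSqrtPi) /
              (c * (1 - Complex.exp (Complex.I * Real.pi * β)) + PainleveIV.iSqrtPi)))
            Real.pi) ∧
        (c * (1 - Complex.exp (Complex.I * Real.pi * β)) + PainleveIV.iSqrtPi = 0 →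
          PainleveIV.AsympIn (y c) PainleveIV.leadLarge
            (3 * Real.pi / 4) (5 * Real.pi / 4)) ∧
        -- sector (5π/4, 7π/4)
        (c ≠ 0 →
          PainleveIV.ExpCorrected (y c) B₄m B₄p (PainleveIV.expLarge α β)
            (PainleveIV.mu4 n α β (PainleveIV.iSqrtPi /
              (c * (1 - Complex.exp (Complex.I * Real.pi * β)))))
            (3 * Real.pi / 2)) ∧
        (c = 0 →
          PainleveIV.AsympIn (y c) (PainleveIV.leadSmall β)
            (5 * Real.pi / 4) (7 * Real.pi / 4))) ∧
      -- the member `c = ∞` of the family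
      (PainleveIV.AsympIn yInf PainleveIV.leadLarge (-Real.pi / 4) (Real.pi / 4) ∧
        PainleveIV.ExpCorrected yInf B₂m B₂p (PainleveIV.expLarge α β)
          (PainleveIV.mu2 n α β 0) (Real.pi / 2) ∧
        PainleveIV.ExpCorrected yInf B₃m B₃p (PainleveIV.expSmall n β)
          (PainleveIV.mu3 n β (1 / (1 - Complex.exp (Complex.I * Real.pi * β)))) Real.pi ∧
        PainleveIV.ExpCorrected yInf B₄m B₄p (PainleveIV.expLarge α β)
          (PainleveIV.mu4 n α β 0) (3 * Real.pi / 2)) := by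
  -- With s = -β/2 one has α + 1/2 = n + 1 - s, so the hypothesis on α says that s is not an
  -- integer.
  have hs : PainleveIV.NotInt (-β / 2) := fun m hm => hα (n + 1 - m) (by
    push_cast; linear_combination hn - hm)
  set s := -β / 2 with hsβ
  have hβ0 : β = -2 * s := by rw [hsβ]; ring
  have hβ1 : β = 2 * -s := by rw [hsβ]; ring
  have hβne : β ≠ 0 := by rw [hβ0]; exact mul_ne_zero (by norm_num) hs.ne_zero
  -- This is q = e^{2πis} = e^{-iπβ}, and q ≠ 1 because s is not an integer.
  set q := PainleveIV.phase s ^ 4 with hq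
  have hq0 : q ≠ 0 := pow_ne_zero _ (PainleveIV.phase_ne_zero s)
  have hq1 : q ≠ 1 := hs.phase_pow_ne_one
  have hq1' : 1 - q ≠ 0 := sub_ne_zero.2 hq1.symm
  have hq2 : q - 1 ≠ 0 := sub_ne_zero.2 hq1
  have hqe : Complex.exp (-(Complex.I * Real.pi * β)) = q := by
    rw [hq, PainleveIV.phase, ← Complex.exp_nat_mul, hβ0]; congr 1; push_cast; ring
  have hqe' : Complex.exp (Complex.I * Real.pi * β) = q⁻¹ := by
    rw [← hqe, Complex.exp_neg, inv_inv]
  have hJ := PainleveIV.iSqrtPi_ne_zero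
  have hpi : (Real.pi : ℂ) = -PainleveIV.iSqrtPi ^ 2 := by
    rw [PainleveIV.iSqrtPi_sq, neg_neg]
  rw [hqe, hqe']
  set J := PainleveIV.iSqrtPi with hJdef
  -- The root of c(1 - q⁻¹) + J = 0: the member whose leading coefficient vanishes in the third
  -- sector.
  set cs : ℂ := -J * q / (q - 1) with hcs
  have hcs0 : cs ≠ 0 := by
    rw [hcs]; exact div_ne_zero (mul_ne_zero (neg_ne_zero.2 hJ) hq0) hq2
  have hqi : 1 - q⁻¹ = (q - 1) / q := by field_simp
  have hcs_iff : ∀ c : ℂ, c * (1 - q⁻¹) + J = 0 → c = cs := fun c hc => by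
    rw [hqi] at hc
    rw [hcs]
    field_simp at hc ⊢
    linear_combination hc
  have den2 : ∀ c : ℂ, c * (1 - q⁻¹) + J ≠ 0 →
      Real.pi * q * 1 + J * (1 - q) * c ≠ 0 := fun c hc e => by
    refine hc ?_
    rw [hpi] at e
    rw [hqi]
    have : -J * (c * (q - 1) + J * q) = 0 := by linear_combination e
    have := (mul_eq_zero.1 this).resolve_left (neg_ne_zero.2 hJ)
    field_simp
    linear_combination this
  set fam := PainleveIV.family β n with hfam
  -- coordinates
  have E0 : ∀ c, PainleveIV.EvenCoord s 0 c (PainleveIV.psi s 1 c) (PainleveIV.psi' s 1 c) :=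
    PainleveIV.evenCoord_zero hs
  -- The quotients C/A after one, two and three quarter turns are written as Jκ, -Jκ and -J(κ + 1),
  -- to match `mu2_eq`, `mu3_eq` and `mu4_eq`.
  have O1 : ∀ c, c + J ≠ 0 → PainleveIV.OddCoord (-s) (Real.pi / 2)
      (J * (J / ((c + J) * (q - 1)))) (PainleveIV.psi s 1 c) (PainleveIV.psi' s 1 c) :=
    fun c hc => PainleveIV.oddCoord_half_pi hs (by rwa [mul_one]) (by
      rw [← hq, ← hJdef, hpi]
      field_simp
      ring)
  have O1i : PainleveIV.OddCoord (-s) (Real.pi / 2) 0 (PainleveIV.psi s 0 1)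
      (PainleveIV.psi' s 0 1) :=
    PainleveIV.oddCoord_half_pi hs (by simp) (by simp)
  -- A coordinate -J makes a member the background after a ray, a coordinate 0 the background before
  -- it.
  have O1s : PainleveIV.OddCoord (-s) (Real.pi / 2) (-J) (PainleveIV.psi s 1 cs)
      (PainleveIV.psi' s 1 cs) := by
    have e : cs + J = -J / (q - 1) := by rw [hcs]; field_simp; ring
    have := O1 cs (by rw [e]; exact div_ne_zero (neg_ne_zero.2 hJ) hq2)
    rw [e] at this
    convert this using 1
    field_simp
  have E2 : ∀ c, c * (1 - q⁻¹) + J ≠ 0 → PainleveIV.EvenCoord s Real.pi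
      (-J * ((c + J) / (c * (1 - q⁻¹) + J))) (PainleveIV.psi s 1 c) (PainleveIV.psi' s 1 c) :=
    fun c hc => PainleveIV.evenCoord_pi hs (den2 c hc) (by
      rw [← hq, ← hJdef, hpi, mul_div_assoc', div_mul_eq_mul_div, eq_div_iff hc, hqi]
      field_simp
      ring)
  have E2l : PainleveIV.EvenCoord s Real.pi 0 (PainleveIV.psi s 1 (-J))
      (PainleveIV.psi' s 1 (-J)) := by
    have := E2 (-J) (by
      rw [show -J * (1 - q⁻¹) + J = J * q⁻¹ by ring]; exact mul_ne_zero hJ (inv_ne_zero hq0))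
    simpa using this
  have E2r : PainleveIV.EvenCoord s Real.pi (-J) (PainleveIV.psi s 1 0)
      (PainleveIV.psi' s 1 0) := by
    simpa [hJ] using E2 0 (by simpa using hJ)
  have E2i : PainleveIV.EvenCoord s Real.pi (-J * (1 / (1 - q⁻¹))) (PainleveIV.psi s 0 1)
      (PainleveIV.psi' s 0 1) :=
    PainleveIV.evenCoord_pi hs (by
      rw [mul_zero, zero_add, mul_one]; exact mul_ne_zero hJ hq1') (by
      rw [← hq, ← hJdef, hpi, hqi]
      field_simp
      ring)
  have O3 : ∀ c, c ≠ 0 → PainleveIV.OddCoord (-s) (3 * Real.pi / 2)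
      (-J * (J / (c * (1 - q⁻¹)) + 1)) (PainleveIV.psi s 1 c) (PainleveIV.psi' s 1 c) :=
    fun c hc => PainleveIV.oddCoord_three_half_pi hs hc (by
      rw [← hq, ← hJdef, hpi, hqi]
      field_simp
      ring)
  have O3l : PainleveIV.OddCoord (-s) (3 * Real.pi / 2) 0 (PainleveIV.psi s 1 cs)
      (PainleveIV.psi' s 1 cs) := by
    have := O3 cs hcs0
    rwa [show cs * (1 - q⁻¹) = -J by rw [hcs, hqi]; field_simp, div_neg, div_self hJ,
      neg_add_cancel, mul_zero] at this
  have O3r : PainleveIV.OddCoord (-s) (3 * Real.pi / 2) (-J * (0 + 1)) (PainleveIV.psi s 0 1)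
      (PainleveIV.psi' s 0 1) :=
    PainleveIV.oddCoord_three_half_pi hs one_ne_zero (by
      rw [← hq, ← hJdef, hpi]
      field_simp
      ring)
  have O3r' := O3r
  rw [zero_add, mul_one] at O3r'
  have sol : ∀ c, PainleveIV.IsSolution α β (fam 1 c) ∧ PainleveIV.IsClassical α β (fam 1 c) :=
    fun c => PainleveIV.family_isSolution hs hn (Or.inl one_ne_zero)
  have solInf : PainleveIV.IsSolution α β (fam 0 1) ∧ PainleveIV.IsClassical α β (fam 0 1) :=
    PainleveIV.family_isSolution hs hn (Or.inr one_ne_zero)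
  have pos := Real.pi_pos
  -- Four exceptional members supply all eight backgrounds: c = 0 before the first ray and after the
  -- third, c = -J after the first and before the third, c = ∞ before the second and after the
  -- fourth, c = cs after the second and before the fourth.
  refine ⟨fam 1 0, fam 1 (-J), fam 0 1, fam 1 cs, fam 1 (-J), fam 1 0, fam 1 cs, fam 0 1,
    fam 1, fam 0 1, ⟨⟨(sol 0).1, ?_⟩, ⟨(sol _).1, ?_⟩, ⟨solInf.1, ?_⟩, ⟨(sol _).1, ?_⟩,
      ⟨(sol _).1, ?_⟩, ⟨(sol _).1, ?_⟩, ⟨(sol _).1, ?_⟩, ⟨solInf.1, ?_⟩⟩, sol, solInf,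
    fun c => ⟨?_, fun hc => ?_, fun hc => ?_, fun hc => ?_, fun hc => ?_, fun hc => ?_,
      fun hc => ?_⟩, ?_, ?_, ?_, ?_⟩
  · exact ((E0 0).asympIn_left hβ0 n).mono_sector (by linarith) (by linarith)
  · exact ((E0 (-J)).asympIn_right hβ0 n).mono_sector (by linarith) (by linarith)
  · exact (O1i.asympIn_left hβ1 n).mono_sector (by linarith) (by linarith)
  · exact (O1s.asympIn_right hβ1 n).mono_sector (by linarith) (by linarith)
  · exact (E2l.asympIn_left hβ0 n).mono_sector (by linarith) (by linarith)
  · exact (E2r.asympIn_right hβ0 n).mono_sector (by linarith) (by linarith)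
  · exact (O3l.asympIn_left hβ1 n).mono_sector (by linarith) (by linarith)
  · exact (O3r'.asympIn_right hβ1 n).mono_sector (by linarith) (by linarith)
  · exact (E0 c).expCorrected (E0 0) (E0 (-J)) hβ0 n (PainleveIV.mu1_eq n β c)
  · exact (O1 c hc).expCorrected O1i O1s hβ1 n hn (PainleveIV.mu2_eq hn _)
  · rw [eq_neg_of_add_eq_zero_left hc]
    exact ((E0 (-J)).asympIn_right hβ0 n).mono_sector (by linarith) (by linarith)
  · exact (E2 c hc).expCorrected E2l E2r hβ0 n (PainleveIV.mu3_eq n β _)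
  · rw [hcs_iff c hc]
    exact (O1s.asympIn_right hβ1 n).mono_sector (by linarith) (by linarith)
  · exact (O3 c hc).expCorrected O3l O3r' hβ1 n hn (PainleveIV.mu4_eq hn _)
  · rw [hc]
    -- As the background after the third ray, this member is algebraic for 3π/4 < arg x < 9π/4,
    -- which covers the fourth sector.
    exact (E2r.asympIn_right hβ0 n).mono_sector (by linarith) (by linarith)
  · exact (O1i.asympIn_left hβ1 n).mono_sector (by linarith) (by linarith)
  · exact (show PainleveIV.OddCoord _ _ (J * 0) _ _ by rwa [mul_zero]).expCorrected O1i O1s hβ1 n hn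
      (PainleveIV.mu2_eq hn 0)
  · exact E2i.expCorrected E2l E2r hβ0 n (PainleveIV.mu3_eq n β _)
  · exact O3r.expCorrected O3l O3r' hβ1 n hn (PainleveIV.mu4_eq hn 0)
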